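/- Let $\mathbb G$ be a finite simple graph with node set $V$, edge set $E$ and degrees $\Delta(v)$, and let every node $v$ carry a list $L(v)\subseteq\{1,\dots,q\}$ of colors. A list coloring assigns to every node a color of its list so that adjacent nodes get different colors; $Z(\mathbb G,\mathbf L)$ is the number of list colorings, $\|\mathbf L\|=\max_v|L(v)|$, and the size of the instance is $n=\max\{|V|,|E|,q\}$. Let $\alpha>\alpha^{**}$, where $\alpha^{**}\approx 2.8432$ is the root of $\alpha^{**}e^{-1/\alpha^{**}}=2$, and let $\beta>0$ satisfy $$\Big(1-\frac1\beta\Big)\,\alpha\, e^{-\frac1\alpha\left(1+\frac1\beta\right)}>2 .\qquad(*)$$ Let $\mathcal C$ be the class of all pairs $(\mathbb G,\mathbf L)$ such that $\mathbb G$ is triangle-free and $|L(v)|\ge\alpha\Delta(v)+\beta$ for every node $v$. **Algorithm CountCOLOR.** It has rational constants $b,\varepsilon_0>0$, with $b\le\beta$ satisfying $(*)$ in place of $\beta$ and $2(1+\varepsilon_0)\le\alpha e^{-\frac1\alpha(1+\frac1b)}$. Define $\Phi(\mathbb G,\mathbf L,v,i,d)$ as follows. It is $0$ if $i\notin L(v)$.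 For $i\in L(v)$ it is $1/|L(v)|$ if $d=0$ or $v$ is isolated. Otherwise let $v_1,\dots,v_m$ be the neighbors of $v$ in the order of their indices, and put $$\Phi(\mathbb G,\mathbf L,v,i,d)=\min\Big[\frac1{2(1+\varepsilon_0)m},\ \frac1b,\ \frac{A_i}{\sum_{j\in L(v)}A_j}\Big],\qquad A_j=\prod_{k=1}^m\big(1-\Phi(\mathbb G\setminus\{v\},\mathbf L_{k,j},v_k,j,d-1)\big),$$ where $\mathbf L_{k,j}$ is obtained from $\mathbf L$ by deleting $j$ from the lists of $v_1,\dots,v_{k-1}$. CountCOLOR with depth $d$ starts with $\hat Z=1$; while nodes remain, it picks an arbitrary remaining node $v$ and an arbitrary color $i$ of its current list, multiplies $\hat Z$ by $\Phi(\cdot,v,i,d)^{-1}$ for the current pair, deletes $v$, and deletes $i$ from the lists of the neighbors of $v$. It outputs $\hat Z$. **Theorem.** There are such constants $b,\varepsilon_0$, a natural number $K$ and a deterministic algorithm $P$, all depending on $\alpha$ and $\beta$ only, with the following properties. On input $(\mathbb G,\mathbf L)\in\mathcal C$ and $\delta>0$ (given as $\lceil 1/\delta\rceil$), $P$ outputs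 the result of a run of CountCOLOR with depth $d=K\cdot\mathrm{bitlength}(n+\lceil1/\delta\rceil)$; so $d=O(\log n)$ for fixed $\delta$. 1. For all $(\mathbb G,\mathbf L)\in\mathcal C$ and $\delta>0$, every run of CountCOLOR with this depth, and in particular $P$, outputs a value $\hat Z$ with $1-\delta\le \hat Z/Z(\mathbb G,\mathbf L)\le 1+\delta$. 2. For every constant $\ell$, on the pairs in $\mathcal C$ with $\|\mathbf L\|\le\ell$ the running time of $P$ is polynomial in $n$ and $1/\delta$. Hence $P$ is a deterministic FPTAS for $Z(\mathbb G,\mathbf L)$ on these pairs. 3. On all of $\mathcal C$, with no bound on the list sizes, the running time of the same algorithm $P$ is $2^{O(\log^2(n+1/\delta+2))}$; in particular, for fixed $\delta$ it is $2^{O(\log^2 n)}$ for $n\ge2$, where the implied constant depends on $\alpha,\beta,\delta$ only. Running time is the number of steps of a deterministic program that works on natural numbers, rational numbers, pairs and lists, where every elementary construct costs at least one step and every arithmetic operation costs the square of the bit length of its operands. -/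

import Mathlib

/-! ## Programs with a step count

Deterministic call-by-value programs of a small first-order functional language, with a step
count in which every construct costs at least one step and every arithmetic operation is charged
the square of the bit length of its operands (so step counts are polynomially related to Turing
machine time). -/

/-- Data types. -/
inductive Ty : Type
  | nat : Ty
  | rat : Ty
  | prod : Ty → Ty → Ty
  | list : Ty → Ty

/-- The values of a data type. -/
@[reducible] def Ty.Val : Ty → Type
  | .nat => ℕ
  | .rat => ℚ
  | .prod a b => a.Val × b.Val
  | .list a => List a.Val

/-- Bit length of a value. -/
def Ty.bits : (τ : Ty) → τ.Val → ℕ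
  | .nat, n => Nat.size n
  | .rat, x => Nat.size x.num.natAbs + Nat.size x.den
  | .prod a b, x => a.bits x.1 + b.bits x.2
  | .list a, l => (l.map fun x => a.bits x + 1).sum

/-- Primitive arithmetic operations, from arguments of the first type to results of the second.
Comparisons answer `1` or `0`. -/
inductive Prim : Ty → Ty → Type
  | natAdd : Prim (.prod .nat .nat) .nat
  | natSub : Prim (.prod .nat .nat) .nat
  | natMul : Prim (.prod .nat .nat) .nat
  | natLe : Prim (.prod .nat .nat) .nat
  | natEq : Prim (.prod .nat .nat) .nat
  | natBits : Prim .nat .nat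
  | ratOf : Prim (.prod .nat .nat) .rat
  | ratAdd : Prim (.prod .rat .rat) .rat
  | ratSub : Prim (.prod .rat .rat) .rat
  | ratMul : Prim (.prod .rat .rat) .rat
  | ratDiv : Prim (.prod .rat .rat) .rat
  | ratLe : Prim (.prod .rat .rat) .nat

/-- The result of a primitive operation; `ratOf` forms the fraction of two natural numbers, and
division by zero gives zero. -/
def Prim.apply : {a b : Ty} → Prim a b → a.Val → b.Val
  | _, _, .natAdd, x => ((x.1 : ℕ) + (x.2 : ℕ) : ℕ)
  | _, _, .natSub, x => ((x.1 : ℕ) - (x.2 : ℕ) : ℕ)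
  | _, _, .natMul, x => ((x.1 : ℕ) * (x.2 : ℕ) : ℕ)
  | _, _, .natLe, x => if (x.1 : ℕ) ≤ (x.2 : ℕ) then (1 : ℕ) else (0 : ℕ)
  | _, _, .natEq, x => if (x.1 : ℕ) = (x.2 : ℕ) then (1 : ℕ) else (0 : ℕ)
  | _, _, .natBits, x => Nat.size x
  | _, _, .ratOf, x => (((x.1 : ℕ) : ℚ) / ((x.2 : ℕ) : ℚ) : ℚ)
  | _, _, .ratAdd, x => ((x.1 : ℚ) + (x.2 : ℚ) : ℚ)
  | _, _, .ratSub, x => ((x.1 : ℚ) - (x.2 : ℚ) : ℚ)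
  | _, _, .ratMul, x => ((x.1 : ℚ) * (x.2 : ℚ) : ℚ)
  | _, _, .ratDiv, x => ((x.1 : ℚ) / (x.2 : ℚ) : ℚ)
  | _, _, .ratLe, x => if (x.1 : ℚ) ≤ (x.2 : ℚ) then (1 : ℕ) else (0 : ℕ)

/-- Positions in a context. -/
inductive Pos {α : Type} : List α → α → Type
  | here {a : α} {Γ : List α} : Pos (a :: Γ) a
  | there {a b : α} {Γ : List α} : Pos Γ a → Pos (b :: Γ) a

/-- Values for the variables of a context. -/
@[reducible] def Env : List Ty → Type
  | [] => Unit
  | a :: Γ => a.Val × Env Γ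

/-- Look up a variable. -/
def Env.get : {Γ : List Ty} → {a : Ty} → Env Γ → Pos Γ a → a.Val
  | _ :: _, _, e, .here => e.1
  | _ :: _, _, e, .there p => Env.get e.2 p

/-- Interpretations of the function variables: each returns a value and a number of steps. -/
@[reducible] def FEnv : List (Ty × Ty) → Type
  | [] => Unit
  | f :: Φ => (f.1.Val → f.2.Val × ℕ) × FEnv Φ

/-- Look up a function variable. -/
def FEnv.get : {Φ : List (Ty × Ty)} → {f : Ty × Ty} → FEnv Φ → Pos Φ f → f.1.Val → f.2.Val × ℕ
  | _ :: _, _, e, .here => e.1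
  | _ :: _, _, e, .there p => FEnv.get e.2 p

/-- Program terms with function variables `Φ` and variables `Γ`. -/
inductive Tm : List (Ty × Ty) → List Ty → Ty → Type
  | var {Φ : List (Ty × Ty)} {Γ : List Ty} {a : Ty} : Pos Γ a → Tm Φ Γ a
  | lit {Φ : List (Ty × Ty)} {Γ : List Ty} : ℕ → Tm Φ Γ .nat
  | prim {Φ : List (Ty × Ty)} {Γ : List Ty} {a b : Ty} : Prim a b → Tm Φ Γ a → Tm Φ Γ b
  | pair {Φ : List (Ty × Ty)} {Γ : List Ty} {a b : Ty} :
      Tm Φ Γ a → Tm Φ Γ b → Tm Φ Γ (.prod a b)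
  | fst {Φ : List (Ty × Ty)} {Γ : List Ty} {a b : Ty} : Tm Φ Γ (.prod a b) → Tm Φ Γ a
  | snd {Φ : List (Ty × Ty)} {Γ : List Ty} {a b : Ty} : Tm Φ Γ (.prod a b) → Tm Φ Γ b
  | nil {Φ : List (Ty × Ty)} {Γ : List Ty} {a : Ty} : Tm Φ Γ (.list a)
  | cons {Φ : List (Ty × Ty)} {Γ : List Ty} {a : Ty} :
      Tm Φ Γ a → Tm Φ Γ (.list a) → Tm Φ Γ (.list a)
  /-- `if c ≠ 0 then t else e` -/
  | ite {Φ : List (Ty × Ty)} {Γ : List Ty} {a : Ty} :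
      Tm Φ Γ .nat → Tm Φ Γ a → Tm Φ Γ a → Tm Φ Γ a
  /-- `let x := s; t x` -/
  | bind {Φ : List (Ty × Ty)} {Γ : List Ty} {a b : Ty} :
      Tm Φ Γ a → Tm Φ (a :: Γ) b → Tm Φ Γ b
  /-- left fold over a list: `body` sees the list element and the accumulator -/
  | foldl {Φ : List (Ty × Ty)} {Γ : List Ty} {a b : Ty} :
      Tm Φ Γ (.list a) → Tm Φ Γ b → Tm Φ (a :: b :: Γ) b → Tm Φ Γ b
  /-- right fold over a list: `body` sees the list element and the accumulator -/
  | foldr {Φ : List (Ty × Ty)} {Γ : List Ty} {a b : Ty} :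
      Tm Φ Γ (.list a) → Tm Φ Γ b → Tm Φ (a :: b :: Γ) b → Tm Φ Γ b
  /-- `recur depth arg base step`: recursion of the given depth; `step` may call the function
  of depth one less any number of times, and `base` is the function of depth zero -/
  | recur {Φ : List (Ty × Ty)} {Γ : List Ty} {a b : Ty} :
      Tm Φ Γ .nat → Tm Φ Γ a → Tm Φ (a :: Γ) b → Tm ((a, b) :: Φ) (a :: Γ) b → Tm Φ Γ b
  | call {Φ : List (Ty × Ty)} {Γ : List Ty} {a b : Ty} :
      Pos Φ (a, b) → Tm Φ Γ a → Tm Φ Γ b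

/-- Run a term: its value and the number of steps. -/
def Tm.run : {Φ : List (Ty × Ty)} → {Γ : List Ty} → {a : Ty} →
    Tm Φ Γ a → FEnv Φ → Env Γ → a.Val × ℕ
  | _, _, _, .var p, _, e => (e.get p, 1)
  | _, _, _, .lit n, _, _ => (n, 1 + Nat.size n)
  | _, _, _, .prim (a := a) op s, f, e =>
      let x := s.run f e
      (op.apply x.1, x.2 + (1 + a.bits x.1) ^ 2)
  | _, _, _, .pair s t, f, e =>
      let x := s.run f e
      let y := t.run f e
      ((x.1, y.1), x.2 + y.2 + 1)
  | _, _, _, .fst s, f, e =>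
      let x := s.run f e
      (x.1.1, x.2 + 1)
  | _, _, _, .snd s, f, e =>
      let x := s.run f e
      (x.1.2, x.2 + 1)
  | _, _, _, .nil, _, _ => ([], 1)
  | _, _, _, .cons s t, f, e =>
      let x := s.run f e
      let y := t.run f e
      (x.1 :: y.1, x.2 + y.2 + 1)
  | _, _, _, .ite c s t, f, e =>
      let x := c.run f e
      let y := if (x.1 : ℕ) ≠ 0 then s.run f e else t.run f e
      (y.1, x.2 + y.2 + 1)
  | _, _, _, .bind s t, f, e =>
      let x := s.run f e
      let y := t.run f (x.1, e)
      (y.1, x.2 + y.2 + 1)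
  | _, _, _, .foldl l s body, f, e =>
      let x := l.run f e
      let y := s.run f e
      List.foldl (fun acc u =>
        let z := body.run f (u, acc.1, e)
        (z.1, acc.2 + z.2 + 1)) (y.1, x.2 + y.2 + 1) x.1
  | _, _, _, .foldr l s body, f, e =>
      let x := l.run f e
      let y := s.run f e
      List.foldr (fun u acc =>
        let z := body.run f (u, acc.1, e)
        (z.1, acc.2 + z.2 + 1)) (y.1, x.2 + y.2 + 1) x.1
  | _, _, _, .recur (a := a) (b := b) n s base step, f, e =>
      let k := n.run f e
      let x := s.run f e
      let F : ℕ → a.Val → b.Val × ℕ := fun k =>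
        Nat.rec (motive := fun _ => a.Val → b.Val × ℕ)
          (fun u => base.run f (u, e))
          (fun _ g u => step.run (g, f) (u, e)) k
      let y := F k.1 x.1
      (y.1, k.2 + x.2 + y.2 + (1 + Nat.size k.1))
  | _, _, _, .call p s, f, e =>
      let x := s.run f e
      let y := f.get p x.1
      (y.1, x.2 + y.2 + 1)

/-! ## Graph/list pairs and their list colorings -/

/-- A graph on the nodes `0, …, N - 1` together with a list of colors, out of `q` colors, for
every node. -/
structure GraphList where
  N : ℕ
  q : ℕ
  G : SimpleGraph (Fin N)
  L : Fin N → Finset (Fin q)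

namespace GraphList

/-- The degree of a node. -/
noncomputable def deg (I : GraphList) (v : Fin I.N) : ℕ := (I.G.neighborSet v).ncard

/-- The size of the instance, `max {|V|, |E|, q}`. -/
noncomputable def size (I : GraphList) : ℕ := max I.N (max I.G.edgeSet.ncard I.q)

/-- The number of list colorings. -/
noncomputable def Z (I : GraphList) : ℕ :=
  Nat.card {c : Fin I.N → Fin I.q //
    (∀ v, c v ∈ I.L v) ∧ ∀ u v, I.G.Adj u v → c u ≠ c v}

/-- Triangle-free graph/list pairs with `|L(v)| ≥ α Δ(v) + β` for every node `v`. -/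
def Good (α β : ℝ) (I : GraphList) : Prop :=
  I.G.CliqueFree 3 ∧ ∀ v, α * (I.deg v : ℝ) + β ≤ ((I.L v).card : ℝ)

end GraphList

/-- The condition relating the constants `α` and `β`. -/
def BetaCond (α β : ℝ) : Prop :=
  2 < (1 - 1 / β) * α * Real.exp (-(1 / α) * (1 + 1 / β))

/-! ## The algorithm CountCOLOR

A graph/list pair met on the way is given by the set `S` of remaining nodes and the current
lists `L`; the neighbors of a node are ordered by their index. -/

section CountColor

variable {V C : Type} [LinearOrder V] [DecidableEq C]

open Classical in
/-- The neighbors of `v` among the remaining nodes. -/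
noncomputable def nbrs (G : SimpleGraph V) (S : Finset V) (v : V) : Finset V :=
  S.filter fun u => G.Adj v u

/-- Delete the color `i` from the lists of the nodes in `T`. -/
def dropColor (L : V → Finset C) (T : Finset V) (i : C) : V → Finset C :=
  fun u => if u ∈ T then (L u).erase i else L u

/-- The depth-`d` approximation of the probability that `v` has color `i` in a uniformly random
list coloring. -/
noncomputable def Phi (β ε₀ : ℝ) (G : SimpleGraph V) :
    ℕ → Finset V → (V → Finset C) → V → C → ℝ
  | 0, _, L, v, i => if i ∈ L v then 1 / ((L v).card : ℝ) else 0
  | d + 1, S, L, v, i =>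
      let A : C → ℝ := fun j => ∏ w ∈ nbrs G S v,
        (1 - Phi β ε₀ G d (S.erase v) (dropColor L ((nbrs G S v).filter (· < w)) j) w j)
      if i ∈ L v then
        if (nbrs G S v).card = 0 then 1 / ((L v).card : ℝ)
        else min (min (1 / (2 * (1 + ε₀) * ((nbrs G S v).card : ℝ))) (1 / β))
          (A i / ∑ j ∈ L v, A j)
      else 0

/-- `CountColor β ε₀ G d S L z`: the loop of CountCOLOR with depth `d`, started on the remaining
nodes `S` with lists `L`, can output `z`; each round picks an arbitrary remaining node and an
arbitrary color of its list. -/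
inductive CountColor (β ε₀ : ℝ) (G : SimpleGraph V) (d : ℕ) :
    Finset V → (V → Finset C) → ℝ → Prop
  | done (L : V → Finset C) : CountColor β ε₀ G d ∅ L 1
  | step (S : Finset V) (L : V → Finset C) (v : V) (i : C) (z : ℝ) (hv : v ∈ S) (hi : i ∈ L v)
      (h : CountColor β ε₀ G d (S.erase v) (dropColor L (nbrs G S v) i) z) :
      CountColor β ε₀ G d S L ((Phi β ε₀ G d S L v i)⁻¹ * z)

end CountColor

/-! ## Approximation schemes for the number of list colorings -/

/-- The input of an algorithm: the number of colors and, for every node, the list of its neighbors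
and the list of its colors; then the accuracy parameter. -/
abbrev inputTy : Ty :=
  .prod (.prod .nat (.list (.prod (.list .nat) (.list .nat)))) .nat

/-- Programs that output a rational number. -/
abbrev Program : Type := Tm [] [inputTy] .rat

namespace GraphList

open Classical in
/-- The instance as input data, all lists in increasing order. -/
noncomputable def encode (I : GraphList) : ℕ × List (List ℕ × List ℕ) :=
  (I.q, (List.finRange I.N).map fun v =>
    (((List.finRange I.N).filter fun u => I.G.Adj v u).map Fin.val,
     ((List.finRange I.q).filter fun i => i ∈ I.L v).map Fin.val))

end GraphList

namespace Program

/-- The input for accuracy `δ`, which is handed over as the natural number `⌈1 / δ⌉`. -/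
noncomputable def input (I : GraphList) (δ : ℝ) : Env [inputTy] :=
  ((I.encode, ⌈1 / δ⌉₊), ())

/-- The value that the program outputs. -/
noncomputable def output (P : Program) (I : GraphList) (δ : ℝ) : ℚ :=
  (Tm.run P () (input I δ)).1

/-- The number of steps of the program. -/
noncomputable def time (P : Program) (I : GraphList) (δ : ℝ) : ℕ :=
  (Tm.run P () (input I δ)).2

/-- The program approximates the number of list colorings of the pairs in `K`. -/
def Approximates (P : Program) (K : Set GraphList) : Prop :=
  ∀ I ∈ K, ∀ δ : ℝ, 0 < δ →
    1 - δ ≤ (P.output I δ : ℝ) / (I.Z : ℝ) ∧ (P.output I δ : ℝ) / (I.Z : ℝ) ≤ 1 + δ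

/-- The running time on the pairs in `K` is polynomial in the size of the instance and `1 / δ`. -/
def PolyTime (P : Program) (K : Set GraphList) : Prop :=
  ∃ (c : ℝ) (k : ℕ), ∀ I ∈ K, ∀ δ : ℝ, 0 < δ →
    (P.time I δ : ℝ) ≤ c * ((I.size : ℝ) + 1 / δ + 1) ^ k

/-- A deterministic fully polynomial time approximation scheme for the pairs in `K`. -/
def IsFPTAS (P : Program) (K : Set GraphList) : Prop :=
  P.Approximates K ∧ P.PolyTime K

end Program

/-!
Sorting the list colorings by the color of a node `v` gives the exact recursion `marg_eq_ratio` for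
the marginal probabilities: the probability that `v` has color `i` is a normalized product of
factors `1 - p`, one for each neighbor of `v`, where `p` is a marginal probability in the graph
without `v`. `Phi` is this recursion cut off at a given depth.

The errors decay. In a triangle-free graph the neighbors of `v` are independent. When all nodes
outside the neighborhood are colored, what remains is a star, for which the inequality between
arithmetic and geometric means shows that on average many colors are free at `v`
(`card_mul_exp_mul_count_erase_le`). Hence marginal probabilities are at most `1 / (2 (1 + ε) m)`
at a node with `m` neighbors (`GoodOn.marg_mul_le`), and they are at most `1 / b` since the lists
exceed the degrees by `b`. Below these two bounds, `log (1 - p)` is a Lipschitz function of `log p`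
with constant `1 / (2 (1 + ε) m (1 - 1 / b))` (`abs_log_one_sub_sub_le`). The factor `1 / m` pays
for the `m` neighbors of the next level, the factor `1 / 2` for the normalization, and what is left
is the contraction factor `1 / ((1 + ε) (1 - 1 / b)) < 1` (`Phi_spec`). The output of CountCOLOR is
a product of inverse estimates whose exact versions multiply to the number of colorings, so a depth
proportional to the bit length of `n + ⌈1 / δ⌉` makes the total error small
(`CountColor.accurate`).

The program passes the instance unchanged through all calls, together with one list of deletions of
nodes and of colors (`Rep`). Its recursion calls at most `(W + 1) ^ 2` estimates of smaller depth,
if the lists have at most `W` colors, and by `unitSize_phiL` the bit length of the denominators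
grows by a factor `4 (W + 1) ^ 2` per level. Both effects together give a running time of a
polynomial times `(4 (W + 1)) ^ O(depth)` (`exists_time_bound`). This is polynomial if `W` is a
constant (`polyTime_countTm`), and it is `2 ^ O(log ^ 2)` for `W = n` (`quasiPolyTime_countTm`).
-/

set_option linter.unusedSectionVars false

/-! ### Counting list colorings -/

section Counting

variable {V C : Type} [LinearOrder V] [DecidableEq C]

theorem mem_nbrs {G : SimpleGraph V} {S : Finset V} {v u : V} :
    u ∈ nbrs G S v ↔ u ∈ S ∧ G.Adj v u := by
  classical
  simp [nbrs]

theorem nbrs_subset_erase (G : SimpleGraph V) (S : Finset V) (v : V) :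
    nbrs G S v ⊆ S.erase v := by
  intro u h
  obtain ⟨h1, h2⟩ := mem_nbrs.1 h
  exact Finset.mem_erase.2 ⟨h2.ne', h1⟩

theorem nbrs_erase_of_not_adj {G : SimpleGraph V} {S : Finset V} {u v : V} (h : ¬ G.Adj v u) :
    nbrs G (S.erase u) v = nbrs G S v := by
  ext w
  simp only [mem_nbrs, Finset.mem_erase]
  constructor
  · rintro ⟨⟨_, h2⟩, h3⟩; exact ⟨h2, h3⟩
  · rintro ⟨h2, h3⟩
    exact ⟨⟨fun e => h (e ▸ h3), h2⟩, h3⟩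

theorem card_nbrs_erase_of_adj {G : SimpleGraph V} {S : Finset V} {u v : V} (hu : u ∈ S)
    (h : G.Adj v u) : (nbrs G (S.erase u) v).card + 1 = (nbrs G S v).card := by
  have : nbrs G (S.erase u) v = (nbrs G S v).erase u := by
    ext w
    simp only [mem_nbrs, Finset.mem_erase]
    tauto
  rw [this]
  exact Finset.card_erase_add_one (mem_nbrs.2 ⟨hu, h⟩)

theorem dropColor_subset (L : V → Finset C) (T : Finset V) (i : C) (u : V) :
    dropColor L T i u ⊆ L u := by
  unfold dropColor
  split_ifs
  · exact Finset.erase_subset _ _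
  · exact subset_rfl

theorem dropColor_of_notMem {L : V → Finset C} {T : Finset V} {i : C} {u : V} (h : u ∉ T) :
    dropColor L T i u = L u := by
  simp [dropColor, h]

theorem dropColor_of_mem {L : V → Finset C} {T : Finset V} {i : C} {u : V} (h : u ∈ T) :
    dropColor L T i u = (L u).erase i := by
  simp [dropColor, h]

theorem card_le_card_dropColor_add_one (L : V → Finset C) (T : Finset V) (i : C) (u : V) :
    (L u).card ≤ (dropColor L T i u).card + 1 := by
  unfold dropColor
  split_ifs
  · have := Finset.pred_card_le_card_erase (s := L u) (a := i)
    omega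
  · omega

theorem dropColor_mono {L L' : V → Finset C} {T : Finset V} {i : C} {u : V} (h : L u ⊆ L' u) :
    dropColor L T i u ⊆ dropColor L' T i u := by
  unfold dropColor
  split_ifs
  · exact Finset.erase_subset_erase _ h
  · exact h

theorem dropColor_insert (L : V → Finset C) (T : Finset V) (a : V) (i : C) :
    dropColor L (insert a T) i = dropColor (dropColor L T i) {a} i := by
  funext u
  unfold dropColor
  by_cases h1 : u = a
  · subst h1; by_cases h2 : u ∈ T <;> simp [h2]
  · by_cases h2 : u ∈ T <;> simp [h1, h2]

variable [Fintype V] [Fintype C]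

open Classical in
/-- The list colorings of the subgraph induced by `S`, encoded as functions on all nodes with the
value `none` outside `S`. -/
noncomputable def colorings (G : SimpleGraph V) (S : Finset V) (L : V → Finset C) :
    Finset (V → Option C) :=
  Finset.univ.filter fun f => (∀ u ∈ S, ∃ c ∈ L u, f u = some c) ∧ (∀ u, u ∉ S → f u = none) ∧
    ∀ u ∈ S, ∀ w ∈ S, G.Adj u w → f u ≠ f w

/-- The number of list colorings of the subgraph induced by `S`. -/
noncomputable def count (G : SimpleGraph V) (S : Finset V) (L : V → Finset C) : ℕ :=
  (colorings G S L).card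

theorem mem_colorings {G : SimpleGraph V} {S : Finset V} {L : V → Finset C} {f : V → Option C} :
    f ∈ colorings G S L ↔ (∀ u ∈ S, ∃ c ∈ L u, f u = some c) ∧ (∀ u, u ∉ S → f u = none) ∧
      ∀ u ∈ S, ∀ w ∈ S, G.Adj u w → f u ≠ f w := by
  classical
  simp [colorings]

theorem count_empty (G : SimpleGraph V) (L : V → Finset C) : count G ∅ L = 1 := by
  unfold count
  rw [Finset.card_eq_one]
  refine ⟨fun _ => none, ?_⟩
  ext f
  simp [mem_colorings, funext_iff]

theorem count_mono (G : SimpleGraph V) {S : Finset V} {L L' : V → Finset C}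
    (h : ∀ u ∈ S, L u ⊆ L' u) : count G S L ≤ count G S L' := by
  refine Finset.card_le_card fun f hf => ?_
  obtain ⟨h1, h2, h3⟩ := mem_colorings.1 hf
  refine mem_colorings.2 ⟨fun u hu => ?_, h2, h3⟩
  obtain ⟨c, hc, e⟩ := h1 u hu
  exact ⟨c, h u hu hc, e⟩

theorem count_congr (G : SimpleGraph V) {S : Finset V} {L L' : V → Finset C}
    (h : ∀ u ∈ S, L u = L' u) : count G S L = count G S L' :=
  le_antisymm (count_mono G fun u hu => (h u hu).subset)
    (count_mono G fun u hu => (h u hu).superset)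

/-- The basic recursion: colorings are sorted by the color of the node `v`. -/
theorem count_eq_sum (G : SimpleGraph V) {S : Finset V} (L : V → Finset C) {v : V} (hv : v ∈ S) :
    count G S L = ∑ i ∈ L v, count G (S.erase v) (dropColor L (nbrs G S v) i) := by
  classical
  unfold count
  have key : ∀ f ∈ colorings G S L, f v ∈ (L v).map Function.Embedding.some := by
    intro f hf
    obtain ⟨c, hc, e⟩ := (mem_colorings.1 hf).1 v hv
    simp [e, hc]
  rw [Finset.card_eq_sum_card_fiberwise key, Finset.sum_map]
  refine Finset.sum_congr rfl fun i hi => ?_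
  refine Finset.card_bij' (fun f _ => Function.update f v none)
    (fun g _ => Function.update g v (some i)) ?_ ?_ ?_ ?_
  · intro f hf
    rw [Finset.mem_filter] at hf
    obtain ⟨hf, hfv⟩ := hf
    obtain ⟨h1, h2, h3⟩ := mem_colorings.1 hf
    refine mem_colorings.2 ⟨?_, ?_, ?_⟩
    · intro u hu
      obtain ⟨huv, huS⟩ := Finset.mem_erase.1 hu
      obtain ⟨c, hc, e⟩ := h1 u huS
      refine ⟨c, ?_, by simp [huv, e]⟩
      unfold dropColor
      split_ifs with hn
      · refine Finset.mem_erase.2 ⟨fun hci => ?_, hc⟩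
        refine h3 v hv u huS (mem_nbrs.1 hn).2 ?_
        rw [hfv, e, hci]; rfl
      · exact hc
    · intro u hu
      by_cases huv : u = v
      · simp [huv]
      · simp only [ne_eq, huv, not_false_eq_true, Function.update_of_ne]
        exact h2 u fun h => hu (Finset.mem_erase.2 ⟨huv, h⟩)
    · intro u hu w hw huw
      obtain ⟨hu1, hu2⟩ := Finset.mem_erase.1 hu
      obtain ⟨hw1, hw2⟩ := Finset.mem_erase.1 hw
      simpa [hu1, hw1] using h3 u hu2 w hw2 huw
  · intro g hg
    obtain ⟨h1, h2, h3⟩ := mem_colorings.1 hg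
    have hne : ∀ u ∈ S, u ≠ v → G.Adj v u → g u ≠ some i := by
      intro u hu huv hadj e
      obtain ⟨c, hc, e'⟩ := h1 u (Finset.mem_erase.2 ⟨huv, hu⟩)
      rw [dropColor_of_mem (mem_nbrs.2 ⟨hu, hadj⟩)] at hc
      rw [e] at e'
      exact (Finset.mem_erase.1 hc).1 (Option.some.inj e').symm
    rw [Finset.mem_filter]
    refine ⟨mem_colorings.2 ⟨?_, ?_, ?_⟩, by simp⟩
    · intro u hu
      by_cases huv : u = v
      · subst huv; exact ⟨i, hi, by simp⟩
      · obtain ⟨c, hc, e⟩ := h1 u (Finset.mem_erase.2 ⟨huv, hu⟩)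
        exact ⟨c, dropColor_subset _ _ _ _ hc, by simp [huv, e]⟩
    · intro u hu
      have huv : u ≠ v := fun e => hu (e ▸ hv)
      simp only [ne_eq, huv, not_false_eq_true, Function.update_of_ne]
      exact h2 u fun h => hu (Finset.mem_erase.1 h).2
    · intro u hu w hw huw
      by_cases huv : u = v
      · subst huv
        have := hne w hw huw.ne' huw
        simpa [huw.ne'] using this.symm
      · by_cases hwv : w = v
        · subst hwv
          simpa [huv] using hne u hu huv huw.symm
        · simpa [huv, hwv] using h3 u (Finset.mem_erase.2 ⟨huv, hu⟩) w
            (Finset.mem_erase.2 ⟨hwv, hw⟩) huw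
  · intro f hf
    rw [Finset.mem_filter] at hf
    funext u
    by_cases huv : u = v
    · subst huv; simpa using hf.2.symm
    · simp [huv]
  · intro g hg
    obtain ⟨h1, h2, h3⟩ := mem_colorings.1 hg
    funext u
    by_cases huv : u = v
    · subst huv; simpa using (h2 u (Finset.notMem_erase _ _)).symm
    · simp [huv]

/-- The number of list colorings that give the node `v` the color `i`. -/
noncomputable def countWith (G : SimpleGraph V) (S : Finset V) (L : V → Finset C) (v : V)
    (i : C) : ℕ :=
  if i ∈ L v then count G (S.erase v) (dropColor L (nbrs G S v) i) else 0

theorem countWith_mono (G : SimpleGraph V) {S : Finset V} {L L' : V → Finset C}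
    (h : ∀ u, L u ⊆ L' u) (v : V) (i : C) : countWith G S L v i ≤ countWith G S L' v i := by
  unfold countWith
  split_ifs with h1 h2
  · exact count_mono G fun u _ => dropColor_mono (h u)
  · exact absurd (h v h1) h2
  · exact Nat.zero_le _
  · exact le_rfl

theorem sum_countWith_le (G : SimpleGraph V) {S : Finset V} (L : V → Finset C) {v : V}
    (hv : v ∈ S) (X : Finset C) : ∑ i ∈ X, countWith G S L v i ≤ count G S L := by
  classical
  rw [count_eq_sum G L hv]
  unfold countWith
  rw [← Finset.sum_filter]
  exact Finset.sum_le_sum_of_subset fun i hi => (Finset.mem_filter.1 hi).2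

theorem count_dropColor_singleton (G : SimpleGraph V) {S : Finset V} (L : V → Finset C) {w : V}
    (hw : w ∈ S) (j : C) :
    count G S L = count G S (dropColor L {w} j) + countWith G S L w j := by
  rw [count_eq_sum G L hw, count_eq_sum G _ hw, dropColor_of_mem (Finset.mem_singleton_self w)]
  have : ∀ i, count G (S.erase w) (dropColor (dropColor L {w} j) (nbrs G S w) i) =
      count G (S.erase w) (dropColor L (nbrs G S w) i) := by
    intro i
    refine count_congr G fun u hu => ?_
    have huw : u ∉ ({w} : Finset V) := by simpa using (Finset.mem_erase.1 hu).1
    unfold dropColor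
    simp only [huw, if_false]
  simp only [this]
  unfold countWith
  split_ifs with h
  · exact (Finset.sum_erase_add _ _ h).symm
  · rw [Finset.erase_eq_of_notMem h, add_zero]

/-- The probability that `v` has color `i` in a uniformly random list coloring of the subgraph
induced by `S`; it is `0` if there is no such coloring. -/
noncomputable def marg (G : SimpleGraph V) (S : Finset V) (L : V → Finset C) (v : V)
    (i : C) : ℝ :=
  (countWith G S L v i : ℝ) / (count G S L : ℝ)

theorem marg_nonneg (G : SimpleGraph V) (S : Finset V) (L : V → Finset C) (v : V)
    (i : C) : 0 ≤ marg G S L v i := by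
  unfold marg; positivity

theorem count_dropColor_singleton_real (G : SimpleGraph V) {S : Finset V} (L : V → Finset C)
    {w : V} (hw : w ∈ S) (j : C) :
    (count G S (dropColor L {w} j) : ℝ) = count G S L * (1 - marg G S L w j) := by
  have h := count_dropColor_singleton G L hw j
  by_cases h0 : count G S L = 0
  · have : count G S (dropColor L {w} j) = 0 := by omega
    simp [h0, this]
  · have h0' : (count G S L : ℝ) ≠ 0 := by exact_mod_cast h0
    have h' : (count G S L : ℝ) = count G S (dropColor L {w} j) + countWith G S L w j := by
      exact_mod_cast h
    unfold marg
    field_simp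
    linarith

/-- Telescoping: the nodes of `T` avoid the color `j` one after the other. -/
theorem count_dropColor_eq_prod (G : SimpleGraph V) {S : Finset V} (L : V → Finset C)
    (j : C) (T : Finset V) (hT : T ⊆ S) :
    (count G S (dropColor L T j) : ℝ) =
      count G S L * ∏ w ∈ T, (1 - marg G S (dropColor L (T.filter (· < w)) j) w j) := by
  induction T using Finset.induction_on_max with
  | empty =>
    have : dropColor L ∅ j = L := by funext u; simp [dropColor]
    simp [this]
  | insert a T hmax ih =>
    have ha : a ∉ T := fun h => lt_irrefl _ (hmax a h)
    have e1 : (insert a T).filter (· < a) = T := by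
      ext x
      simp only [Finset.mem_filter, Finset.mem_insert]
      constructor
      · rintro ⟨rfl | h, h2⟩
        · exact absurd h2 (lt_irrefl _)
        · exact h
      · exact fun h => ⟨Or.inr h, hmax x h⟩
    have e2 : ∀ w ∈ T, (insert a T).filter (· < w) = T.filter (· < w) := by
      intro w hw
      rw [Finset.filter_insert, if_neg (not_lt.2 (hmax w hw).le)]
    rw [Finset.prod_insert ha, e1, dropColor_insert,
      count_dropColor_singleton_real G _ (hT (Finset.mem_insert_self a T)),
      ih fun x hx => hT (Finset.mem_insert_of_mem hx)]
    rw [Finset.prod_congr rfl fun w hw => by rw [← e2 w hw]]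
    ring

/-- The exact recursion for the marginal probabilities. -/
theorem marg_eq_ratio (G : SimpleGraph V) {S : Finset V} (L : V → Finset C) {v : V} (hv : v ∈ S)
    {i : C} (hi : i ∈ L v) (hpos : 0 < count G (S.erase v) L) :
    marg G S L v i =
      (∏ w ∈ nbrs G S v,
        (1 - marg G (S.erase v) (dropColor L ((nbrs G S v).filter (· < w)) i) w i)) /
      ∑ j ∈ L v, ∏ w ∈ nbrs G S v,
        (1 - marg G (S.erase v) (dropColor L ((nbrs G S v).filter (· < w)) j) w j) := by
  have hpos' : (count G (S.erase v) L : ℝ) ≠ 0 := by exact_mod_cast hpos.ne'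
  unfold marg
  rw [countWith, if_pos hi, count_eq_sum G L hv, Nat.cast_sum]
  simp_rw [count_dropColor_eq_prod G L _ _ (nbrs_subset_erase G S v)]
  rw [← Finset.mul_sum, mul_div_mul_left _ _ hpos']
  rfl

theorem count_le_count_dropColor_add (G : SimpleGraph V) {S : Finset V} (L : V → Finset C)
    (j : C) (T : Finset V) (hT : T ⊆ S) :
    count G S L ≤ count G S (dropColor L T j) + ∑ w ∈ T, countWith G S L w j := by
  induction T using Finset.induction_on with
  | empty =>
    have : dropColor L ∅ j = L := by funext u; simp [dropColor]
    simp [this]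
  | insert a T ha ih =>
    have h1 := ih fun x hx => hT (Finset.mem_insert_of_mem hx)
    have h2 := count_dropColor_singleton G (dropColor L T j)
      (hT (Finset.mem_insert_self a T)) j
    have h3 : countWith G S (dropColor L T j) a j ≤ countWith G S L a j :=
      countWith_mono G (fun u => dropColor_subset L T j u) a j
    rw [dropColor_insert, Finset.sum_insert ha]
    omega

/-- Every coloring of the other nodes blocks at most `deg v` colors at `v`. -/
theorem card_mul_count_erase_le (G : SimpleGraph V) {S : Finset V} (L : V → Finset C) {v : V}
    (hv : v ∈ S) :
    (L v).card * count G (S.erase v) L ≤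
      count G S L + (nbrs G S v).card * count G (S.erase v) L := by
  rw [count_eq_sum G L hv]
  calc (L v).card * count G (S.erase v) L = ∑ _i ∈ L v, count G (S.erase v) L := by simp
    _ ≤ ∑ i ∈ L v, (count G (S.erase v) (dropColor L (nbrs G S v) i) +
          ∑ w ∈ nbrs G S v, countWith G (S.erase v) L w i) :=
        Finset.sum_le_sum fun i _ => count_le_count_dropColor_add G L i _ (nbrs_subset_erase G S v)
    _ = ∑ i ∈ L v, count G (S.erase v) (dropColor L (nbrs G S v) i) +
          ∑ w ∈ nbrs G S v, ∑ i ∈ L v, countWith G (S.erase v) L w i := by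
        rw [Finset.sum_add_distrib, Finset.sum_comm]
    _ ≤ _ := by
        gcongr
        calc _ ≤ ∑ _w ∈ nbrs G S v, count G (S.erase v) L :=
              Finset.sum_le_sum fun w hw => sum_countWith_le G L (nbrs_subset_erase G S v hw) _
          _ = _ := by simp

theorem count_eq_prod_of_independent (G : SimpleGraph V) (T : Finset V) (L : V → Finset C)
    (hT : ∀ u ∈ T, ∀ w ∈ T, ¬ G.Adj u w) : count G T L = ∏ w ∈ T, (L w).card := by
  induction T using Finset.induction_on generalizing L with
  | empty => simp [count_empty]
  | insert a T ha ih =>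
    have hn : nbrs G (insert a T) a = ∅ := by
      ext u
      simp only [mem_nbrs, Finset.notMem_empty, iff_false, not_and]
      exact fun hu => hT a (Finset.mem_insert_self a T) u hu
    have hd : ∀ i, dropColor L ∅ i = L := fun i => by funext u; simp [dropColor]
    rw [count_eq_sum G L (Finset.mem_insert_self a T), hn, Finset.prod_insert ha]
    simp only [hd, Finset.erase_insert ha, Finset.sum_const, smul_eq_mul]
    rw [ih L fun u hu w hw => hT u (Finset.mem_insert_of_mem hu) w (Finset.mem_insert_of_mem hw)]

end Counting

theorem GraphList.count_univ_eq_Z (I : GraphList) : count I.G Finset.univ I.L = I.Z := by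
  classical
  unfold GraphList.Z count
  rw [← Nat.card_eq_finsetCard]
  symm
  refine Nat.card_congr (Equiv.ofBijective
    (fun c => (⟨fun u => some (c.1 u), ?_⟩ : colorings I.G Finset.univ I.L)) ⟨?_, ?_⟩)
  · rw [mem_colorings]
    refine ⟨fun u _ => ⟨_, c.2.1 u, rfl⟩, fun u hu => absurd (Finset.mem_univ u) hu, ?_⟩
    intro u _ w _ h e
    exact c.2.2 u w h (Option.some.inj e)
  · intro c c' h
    apply Subtype.ext
    funext u
    exact Option.some.inj (congrFun (congrArg Subtype.val h) u)
  · rintro ⟨f, hf⟩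
    obtain ⟨h1, h2, h3⟩ := mem_colorings.1 hf
    choose c hc hfc using fun u => h1 u (Finset.mem_univ u)
    refine ⟨⟨c, hc, fun u w h e => h3 u (Finset.mem_univ _) w (Finset.mem_univ _) h ?_⟩, ?_⟩
    · rw [hfc, hfc, e]
    · apply Subtype.ext
      funext u
      exact (hfc u).symm

/-! ### Logarithmic estimates -/

theorem exp_neg_sub_sq_le_one_sub {t : ℝ} (h0 : 0 ≤ t) (h1 : t ≤ 1 / 2) :
    Real.exp (-(t * (1 + t))) ≤ 1 - t := by
  have h2 : 0 ≤ t * (1 + t) := by positivity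
  have h3 := Real.quadratic_le_exp_of_nonneg h2
  rw [Real.exp_neg, inv_le_comm₀ (Real.exp_pos _) (by linarith)]
  refine le_trans ?_ h3
  rw [inv_le_iff_one_le_mul₀ (by linarith)]
  have h4 : 0 ≤ t ^ 2 * (1 - t - t ^ 2 - t ^ 3) := by
    have : t ^ 2 ≤ 1 / 4 := by nlinarith
    have : t ^ 3 ≤ 1 / 8 := by nlinarith
    have : 0 ≤ 1 - t - t ^ 2 - t ^ 3 := by linarith
    positivity
  nlinarith

/-- `x ↦ log (1 - x)` as a function of `log x` is Lipschitz on `x ≤ min M r`. -/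
theorem abs_log_one_sub_sub_le {x y M r : ℝ} (hx : 0 < x) (hy : 0 < y) (hxM : x ≤ M)
    (hyM : y ≤ M) (hxr : x ≤ r) (hyr : y ≤ r) (hr : r < 1) :
    |Real.log (1 - x) - Real.log (1 - y)| ≤ M / (1 - r) * |Real.log x - Real.log y| := by
  wlog h : x ≤ y generalizing x y with H
  · rw [abs_sub_comm, abs_sub_comm (Real.log x)]
    exact H hy hx hyM hxM hyr hxr (le_of_not_ge h)
  have hx1 : 0 < 1 - x := by linarith
  have hy1 : 0 < 1 - y := by linarith
  have hl : Real.log x ≤ Real.log y := Real.log_le_log hx h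
  have hl' : Real.log (1 - y) ≤ Real.log (1 - x) := Real.log_le_log hy1 (by linarith)
  rw [abs_of_nonneg (by linarith), abs_of_nonpos (by linarith)]
  have a1 : Real.log (1 - x) - Real.log (1 - y) ≤ (y - x) / (1 - y) := by
    rw [← Real.log_div hx1.ne' hy1.ne']
    refine (Real.log_le_sub_one_of_pos (by positivity)).trans_eq ?_
    field_simp; ring
  have a2 : y - x ≤ y * (Real.log y - Real.log x) := by
    have := Real.log_le_sub_one_of_pos (div_pos hx hy)
    rw [Real.log_div hx.ne' hy.ne'] at this
    have h3 : y * (x / y) = x := by field_simp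
    nlinarith
  calc _ ≤ (y - x) / (1 - y) := a1
    _ ≤ (y * (Real.log y - Real.log x)) / (1 - r) :=
        div_le_div₀ (mul_nonneg hy.le (by linarith)) a2 (by linarith) (by linarith)
    _ ≤ (M * (Real.log y - Real.log x)) / (1 - r) := by
        have : 0 ≤ Real.log y - Real.log x := by linarith
        have : 0 < 1 - r := by linarith
        gcongr
    _ = _ := by ring

theorem abs_log_sub_log_min_le {x y B : ℝ} (hx : 0 < x) (hB : x ≤ B) :
    |Real.log x - Real.log (min B y)| ≤ |Real.log x - Real.log y| := by
  rcases le_total B y with h | h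
  · rw [min_eq_left h]
    have h1 := Real.log_le_log hx hB
    have h2 := Real.log_le_log (hx.trans_le hB) h
    rw [abs_of_nonpos (by linarith), abs_of_nonpos (by linarith)]
    linarith
  · rw [min_eq_right h]

/-- Passing from weights `A` to normalized weights at most doubles the logarithmic error. -/
theorem abs_log_ratio_sub_le {C : Type} (X : Finset C) (A A' : C → ℝ) (h : ℝ) {i : C}
    (hi : i ∈ X) (hA : ∀ j ∈ X, 0 < A j) (hA' : ∀ j ∈ X, 0 < A' j)
    (hh : ∀ j ∈ X, |Real.log (A j) - Real.log (A' j)| ≤ h) :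
    |Real.log (A i / ∑ j ∈ X, A j) - Real.log (A' i / ∑ j ∈ X, A' j)| ≤ 2 * h := by
  have aux : ∀ B B' : C → ℝ, (∀ j ∈ X, 0 < B j) → (∀ j ∈ X, 0 < B' j) →
      (∀ j ∈ X, |Real.log (B j) - Real.log (B' j)| ≤ h) →
      Real.log (∑ j ∈ X, B j) ≤ h + Real.log (∑ j ∈ X, B' j) := by
    intro B B' hB hB' hh
    have hp : 0 < ∑ j ∈ X, B j := Finset.sum_pos hB ⟨i, hi⟩
    have hp' : 0 < ∑ j ∈ X, B' j := Finset.sum_pos hB' ⟨i, hi⟩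
    rw [← Real.log_exp h, ← Real.log_mul (Real.exp_ne_zero _) hp'.ne']
    refine Real.log_le_log hp ?_
    rw [Finset.mul_sum]
    refine Finset.sum_le_sum fun j hj => ?_
    have := (abs_le.1 (hh j hj)).2
    calc B j = Real.exp (Real.log (B j)) := (Real.exp_log (hB j hj)).symm
      _ ≤ Real.exp (h + Real.log (B' j)) := Real.exp_le_exp.2 (by linarith)
      _ = Real.exp h * B' j := by rw [Real.exp_add, Real.exp_log (hB' j hj)]
  have hp : 0 < ∑ j ∈ X, A j := Finset.sum_pos hA ⟨i, hi⟩
  have hp' : 0 < ∑ j ∈ X, A' j := Finset.sum_pos hA' ⟨i, hi⟩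
  rw [Real.log_div (hA i hi).ne' hp.ne', Real.log_div (hA' i hi).ne' hp'.ne']
  have h1 := aux A A' hA hA' hh
  have h2 := aux A' A hA' hA fun j hj => by rw [abs_sub_comm]; exact hh j hj
  have h3 := abs_le.1 (hh i hi)
  rw [abs_le]
  constructor <;> linarith [h3.1, h3.2]

/-! ### Bounds for marginal probabilities -/

section Marginals

variable {V C : Type} [LinearOrder V] [DecidableEq C]

/-- In a star with center list `X` and leaves `T` with lists of size at least `κ ≥ 2`, the number
of list colorings is bounded below, by the inequality between arithmetic and geometric means. -/
theorem card_mul_exp_mul_prod_le (X : Finset C) (T : Finset V) (L : V → Finset C) {κ : ℝ}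
    (hκ : 2 ≤ κ) (hX : X.Nonempty) (hL : ∀ w ∈ T, κ ≤ ((L w).card : ℝ)) :
    (X.card : ℝ) * Real.exp (-((T.card : ℝ) / X.card * (1 + 1 / κ))) *
        ∏ w ∈ T, ((L w).card : ℝ) ≤ ∑ j ∈ X, ∏ w ∈ T, (((L w).erase j).card : ℝ) := by
  classical
  set s : ℝ := 1 + 1 / κ with hs
  have hs0 : 0 < s := by positivity
  set t : V → C → ℝ := fun w j => if j ∈ L w then 1 / ((L w).card : ℝ) else 0 with ht
  have hpos : ∀ w ∈ T, 0 < ((L w).card : ℝ) := fun w hw => by linarith [hL w hw]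
  have h1 : ∀ j, ∀ w ∈ T, ((L w).card : ℝ) * Real.exp (-(s * t w j)) ≤
      (((L w).erase j).card : ℝ) := by
    intro j w hw
    have hp := hpos w hw
    by_cases hj : j ∈ L w
    · have e : (((L w).erase j).card : ℝ) = (L w).card * (1 - 1 / ((L w).card : ℝ)) := by
        have : (((L w).erase j).card : ℝ) + 1 = (L w).card := by
          exact_mod_cast Finset.card_erase_add_one hj
        field_simp
        linarith
      rw [e]
      refine mul_le_mul_of_nonneg_left ?_ hp.le
      simp only [ht, hj, if_true]
      have h2 : 1 / ((L w).card : ℝ) ≤ 1 / κ :=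
        one_div_le_one_div_of_le (by linarith) (hL w hw)
      have h3 : 1 / κ ≤ 1 / 2 := one_div_le_one_div_of_le (by norm_num) hκ
      refine le_trans (Real.exp_le_exp.2 ?_)
        (exp_neg_sub_sq_le_one_sub (by positivity) (h2.trans h3))
      have : 0 < 1 / ((L w).card : ℝ) := by positivity
      rw [hs]
      nlinarith
    · rw [Finset.erase_eq_of_notMem hj]
      simp [ht, hj]
  have hsum : ∑ j ∈ X, ∑ w ∈ T, t w j ≤ T.card := by
    rw [Finset.sum_comm]
    calc _ ≤ ∑ _w ∈ T, (1 : ℝ) := by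
          refine Finset.sum_le_sum fun w hw => ?_
          have hp := hpos w hw
          simp only [ht]
          rw [← Finset.sum_filter, Finset.sum_const, nsmul_eq_mul, mul_one_div,
            div_le_one hp]
          exact_mod_cast Finset.card_le_card fun i hi => (Finset.mem_filter.1 hi).2
      _ = _ := by simp
  have hXpos : (0 : ℝ) < X.card := by exact_mod_cast hX.card_pos
  set a : ℝ := -((T.card : ℝ) / X.card * s) with ha
  -- the tangent of `exp` at `a`, summed over the colors
  have hjens : (X.card : ℝ) * Real.exp a ≤ ∑ j ∈ X, Real.exp (-(s * ∑ w ∈ T, t w j)) := by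
    have : ∀ j ∈ X, Real.exp a * (1 - s * (∑ w ∈ T, t w j) - a) ≤
        Real.exp (-(s * ∑ w ∈ T, t w j)) := by
      intro j _
      have h5 := Real.add_one_le_exp (-(s * ∑ w ∈ T, t w j) - a)
      calc _ ≤ Real.exp a * Real.exp (-(s * ∑ w ∈ T, t w j) - a) := by
            refine mul_le_mul_of_nonneg_left ?_ (Real.exp_pos _).le
            linarith
        _ = _ := by rw [← Real.exp_add]; ring_nf
    refine le_trans ?_ (Finset.sum_le_sum this)
    rw [← Finset.mul_sum, Finset.sum_sub_distrib, Finset.sum_sub_distrib, ← Finset.mul_sum]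
    simp only [Finset.sum_const, nsmul_eq_mul, mul_one]
    have h6 : (X.card : ℝ) * a = -(T.card * s) := by rw [ha]; field_simp
    have h7 : s * ∑ j ∈ X, ∑ w ∈ T, t w j ≤ s * T.card := by gcongr
    have h8 : (X.card : ℝ) ≤ X.card - s * ∑ j ∈ X, ∑ w ∈ T, t w j - X.card * a := by
      rw [h6]; linarith
    calc _ = Real.exp a * X.card := mul_comm _ _
      _ ≤ _ := mul_le_mul_of_nonneg_left h8 (Real.exp_pos _).le
  have hprod0 : 0 ≤ ∏ w ∈ T, ((L w).card : ℝ) := Finset.prod_nonneg fun w _ => Nat.cast_nonneg _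
  calc _ ≤ (∑ j ∈ X, Real.exp (-(s * ∑ w ∈ T, t w j))) * ∏ w ∈ T, ((L w).card : ℝ) :=
        mul_le_mul_of_nonneg_right hjens hprod0
    _ = ∑ j ∈ X, ∏ w ∈ T, (((L w).card : ℝ) * Real.exp (-(s * t w j))) := by
        rw [Finset.sum_mul]
        refine Finset.sum_congr rfl fun j _ => ?_
        rw [Finset.prod_mul_distrib, ← Real.exp_sum, mul_comm, Finset.mul_sum,
          Finset.sum_neg_distrib]
    _ ≤ _ := by
        refine Finset.sum_le_sum fun j _ => Finset.prod_le_prod ?_ ?_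
        · intro w _; positivity
        · intro w hw; exact h1 j w hw

variable [Fintype V] [Fintype C]

/-- If the neighbors of `v` are independent and have at least `κ` colors left whatever happens
outside, then many colors are available at `v` on average. The nodes outside the neighborhood are
eliminated one by one, which reduces the claim to a star. -/
theorem card_mul_exp_mul_count_erase_le (G : SimpleGraph V) {κ : ℝ} (hκ : 2 ≤ κ) (v : V) (k : ℕ) :
    ∀ (S : Finset V) (L : V → Finset C), v ∈ S → (L v).Nonempty →
      (S \ insert v (nbrs G S v)).card = k →
      (∀ u ∈ nbrs G S v, ∀ w ∈ nbrs G S v, ¬ G.Adj u w) →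
      (∀ w ∈ nbrs G S v, κ + ((nbrs G (S.erase v) w).card : ℝ) ≤ (L w).card) →
      ((L v).card : ℝ) * Real.exp (-(((nbrs G S v).card : ℝ) / (L v).card * (1 + 1 / κ))) *
        count G (S.erase v) L ≤ count G S L := by
  induction k with
  | zero =>
    intro S L hv hne hk hind hL
    have hS : S.erase v = nbrs G S v := by
      refine Finset.Subset.antisymm (fun u hu => ?_) (nbrs_subset_erase G S v)
      obtain ⟨h1, h2⟩ := Finset.mem_erase.1 hu
      by_contra h3
      have : u ∈ S \ insert v (nbrs G S v) := by simp [h2, h1, h3]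
      rw [Finset.card_eq_zero.1 hk] at this
      simp at this
    rw [count_eq_sum G L hv, hS]
    simp only [count_eq_prod_of_independent G (nbrs G S v) _ hind]
    have h := card_mul_exp_mul_prod_le (L v) (nbrs G S v) L hκ hne fun w hw => by
      have := hL w hw
      have h0 : (0 : ℝ) ≤ (nbrs G (S.erase v) w).card := Nat.cast_nonneg _
      linarith
    push_cast
    refine h.trans_eq (Finset.sum_congr rfl fun j _ => Finset.prod_congr rfl fun w hw => ?_)
    rw [dropColor_of_mem hw]
  | succ k ih =>
    intro S L hv hne hk hind hL
    obtain ⟨u, hu⟩ : (S \ insert v (nbrs G S v)).Nonempty := by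
      rw [← Finset.card_pos]; omega
    obtain ⟨huS, huN⟩ := Finset.mem_sdiff.1 hu
    rw [Finset.mem_insert, not_or] at huN
    obtain ⟨huv, huN⟩ := huN
    have hnadj : ¬ G.Adj v u := fun h => huN (mem_nbrs.2 ⟨huS, h⟩)
    have hnv : nbrs G (S.erase u) v = nbrs G S v := nbrs_erase_of_not_adj hnadj
    have hnu : nbrs G (S.erase v) u = nbrs G S u := nbrs_erase_of_not_adj fun h => hnadj h.symm
    have hvu : v ∉ nbrs G S u := fun h => hnadj (mem_nbrs.1 h).2.symm
    rw [count_eq_sum G L huS, count_eq_sum G (S := S.erase v) L (Finset.mem_erase.2 ⟨huv, huS⟩),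
      hnu]
    push_cast
    rw [Finset.mul_sum]
    refine Finset.sum_le_sum fun c _ => ?_
    have hLv : dropColor L (nbrs G S u) c v = L v := dropColor_of_notMem hvu
    have := ih (S.erase u) (dropColor L (nbrs G S u) c)
      (Finset.mem_erase.2 ⟨fun h => huv h.symm, hv⟩) (by rwa [hLv]) ?_ ?_ ?_
    · rwa [hLv, hnv, Finset.erase_right_comm] at this
    · rw [hnv]
      have e : S.erase u \ insert v (nbrs G S v) = (S \ insert v (nbrs G S v)).erase u := by
        ext x; simp only [Finset.mem_sdiff, Finset.mem_erase]; tauto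
      rw [e, Finset.card_erase_of_mem hu, hk]; rfl
    · rwa [hnv]
    · rw [hnv]
      intro w hw
      have h1 := hL w hw
      rw [Finset.erase_right_comm]
      by_cases hwu : G.Adj w u
      · have h2 := card_nbrs_erase_of_adj (S := S.erase v) (Finset.mem_erase.2 ⟨huv, huS⟩) hwu
        have h3 := card_le_card_dropColor_add_one L (nbrs G S u) c w
        have h2' : ((nbrs G ((S.erase v).erase u) w).card : ℝ) + 1 =
          (nbrs G (S.erase v) w).card := by exact_mod_cast h2
        have h3' : ((L w).card : ℝ) ≤ (dropColor L (nbrs G S u) c w).card + 1 := by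
          exact_mod_cast h3
        linarith
      · rw [nbrs_erase_of_not_adj hwu, dropColor_of_notMem]
        · exact h1
        · exact fun h => hwu (mem_nbrs.1 h).2.symm

/-- The constants of the algorithm: the first condition makes the cut-off `1 / (2 (1 + ε) m)` a
valid bound for marginal probabilities, the second one gives contraction. -/
structure Admissible (α b ε : ℝ) : Prop where
  one_lt_b : 1 < b
  eps_pos : 0 < ε
  cutoff : 2 * (1 + ε) ≤ α * Real.exp (-(1 / α) * (1 + 1 / b))
  contract : 1 < (1 + ε) * (1 - 1 / b)
  alpha_pos : 0 < α

namespace Admissible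

variable {α b ε : ℝ}

theorem two_lt (h : Admissible α b ε) : 2 < α := by
  have h1 := h.cutoff
  have h2 := h.eps_pos
  have h3 := h.alpha_pos
  have hb := h.one_lt_b
  have h5 : 0 ≤ 1 / α * (1 + 1 / b) := by positivity
  have : Real.exp (-(1 / α) * (1 + 1 / b)) ≤ 1 := Real.exp_le_one_iff.2 (by linarith)
  nlinarith

theorem inv_b_lt (h : Admissible α b ε) : 1 / b < 1 := by
  rw [div_lt_one (by linarith [h.one_lt_b])]
  exact h.one_lt_b

end Admissible

/-- The condition `|L(v)| ≥ α Δ(v) + b` in the subgraph induced by `S`. -/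
def GoodOn (α b : ℝ) (G : SimpleGraph V) (S : Finset V) (L : V → Finset C) : Prop :=
  ∀ v ∈ S, α * ((nbrs G S v).card : ℝ) + b ≤ ((L v).card : ℝ)

variable {α b ε : ℝ} {G : SimpleGraph V} {S : Finset V} {L : V → Finset C} {v : V}

theorem GoodOn.erase (hα : 1 ≤ α) (h : GoodOn α b G S L) {v : V} (hv : v ∈ S) {T : Finset V}
    (hT : T ⊆ nbrs G S v) (i : C) : GoodOn α b G (S.erase v) (dropColor L T i) := by
  intro u hu
  obtain ⟨huv, huS⟩ := Finset.mem_erase.1 hu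
  have h1 := h u huS
  by_cases hadj : G.Adj u v
  · have h2 : (((nbrs G (S.erase v) u).card : ℝ)) + 1 = (nbrs G S u).card := by
      exact_mod_cast card_nbrs_erase_of_adj hv hadj
    have h3 : ((L u).card : ℝ) ≤ (dropColor L T i u).card + 1 := by
      exact_mod_cast card_le_card_dropColor_add_one L T i u
    have : α * (((nbrs G (S.erase v) u).card : ℝ) + 1) + b ≤ (L u).card := by rwa [h2]
    linarith
  · rw [nbrs_erase_of_not_adj hadj, dropColor_of_notMem]
    · exact h1
    · exact fun hu' => hadj (mem_nbrs.1 (hT hu')).2.symm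

theorem GoodOn.erase_self (hα : 1 ≤ α) (h : GoodOn α b G S L) (v : V) :
    GoodOn α b G (S.erase v) L := by
  intro u hu
  obtain ⟨huv, huS⟩ := Finset.mem_erase.1 hu
  have h1 := h u huS
  have h2 : ((nbrs G (S.erase v) u).card : ℝ) ≤ (nbrs G S u).card := by
    refine Nat.cast_le.2 (Finset.card_le_card fun w hw => ?_)
    obtain ⟨h3, h4⟩ := mem_nbrs.1 hw
    exact mem_nbrs.2 ⟨(Finset.mem_erase.1 h3).2, h4⟩
  nlinarith

/-- The number of colors exceeds the number of neighbors by `b` at least. -/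
theorem GoodOn.le_sub (hα : 1 ≤ α) (h : GoodOn α b G S L) (hv : v ∈ S) :
    b ≤ (L v).card - ((nbrs G S v).card : ℝ) := by
  have h1 := h v hv
  have h0 : (0 : ℝ) ≤ (nbrs G S v).card := Nat.cast_nonneg _
  nlinarith

theorem GoodOn.sub_mul_le (_ : GoodOn α b G S L) (hv : v ∈ S) :
    (((L v).card : ℝ) - (nbrs G S v).card) * count G (S.erase v) L ≤ count G S L := by
  have := card_mul_count_erase_le G L hv
  have : ((L v).card : ℝ) * count G (S.erase v) L ≤
      count G S L + (nbrs G S v).card * count G (S.erase v) L := by exact_mod_cast this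
  linarith

theorem GoodOn.count_pos (hα : 1 ≤ α) (hb : 0 < b) (h : GoodOn α b G S L) : 0 < count G S L := by
  induction S using Finset.strongInduction with
  | H S ih =>
    rcases S.eq_empty_or_nonempty with rfl | ⟨v, hv⟩
    · rw [count_empty]; exact one_pos
    · have h1 := ih (S.erase v) (Finset.erase_ssubset hv) (h.erase_self hα v)
      have h2 := h.le_sub hα hv
      have h3 := h.sub_mul_le hv
      have h1' : (0 : ℝ) < count G (S.erase v) L := by exact_mod_cast h1
      have : (0 : ℝ) < count G S L := by nlinarith
      exact_mod_cast this

theorem marg_of_notMem {i : C} (hi : i ∉ L v) : marg G S L v i = 0 := by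
  simp [marg, countWith, hi]

theorem GoodOn.marg_pos (hα : 1 ≤ α) (hb : 0 < b) (h : GoodOn α b G S L) (hv : v ∈ S) {i : C}
    (hi : i ∈ L v) : 0 < marg G S L v i := by
  have h1 := h.count_pos hα hb
  have h2 := (h.erase hα hv subset_rfl i).count_pos hα hb
  unfold marg countWith
  rw [if_pos hi]
  positivity

theorem GoodOn.sub_mul_marg_le (hα : 1 ≤ α) (hb : 0 < b) (h : GoodOn α b G S L) (hv : v ∈ S)
    (i : C) : (((L v).card : ℝ) - (nbrs G S v).card) * marg G S L v i ≤ 1 := by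
  have h1 : (0 : ℝ) < count G S L := by exact_mod_cast h.count_pos hα hb
  have h2 := h.sub_mul_le hv
  have h3 := h.le_sub hα hv
  have h4 : (countWith G S L v i : ℝ) ≤ count G (S.erase v) L := by
    norm_cast
    unfold countWith
    split_ifs
    · exact count_mono G fun u _ => dropColor_subset _ _ _ _
    · exact Nat.zero_le _
  unfold marg
  rw [← mul_div_assoc, div_le_one h1]
  nlinarith

theorem GoodOn.marg_le_inv (hα : 1 ≤ α) (hb : 0 < b) (h : GoodOn α b G S L) (hv : v ∈ S)
    (i : C) : marg G S L v i ≤ 1 / b := by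
  have h1 := h.sub_mul_marg_le hα hb hv i
  have h2 := h.le_sub hα hv
  have h3 := marg_nonneg G S L v i
  rw [le_div_iff₀ hb]
  nlinarith

/-- In a triangle-free graph the marginal probabilities are at most `1 / (2 (1 + ε) m)`: once `v`
is deleted each of its neighbors has at least `α + b` colors to spare, so the independent
neighborhood leaves many colors free at `v`. -/
theorem GoodOn.marg_mul_le (hc : Admissible α b ε) (hG : G.CliqueFree 3) (h : GoodOn α b G S L)
    (hv : v ∈ S) (i : C) :
    2 * (1 + ε) * ((nbrs G S v).card : ℝ) * marg G S L v i ≤ 1 := by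
  have hα2 := hc.two_lt
  have hα : 1 ≤ α := by linarith
  have hα0 : 0 < α := by linarith
  have hb : 0 < b := by linarith [hc.one_lt_b]
  have h1 : (0 : ℝ) < count G S L := by exact_mod_cast h.count_pos hα hb
  have hsub := h.le_sub hα hv
  have hm0 : (0 : ℝ) ≤ (nbrs G S v).card := Nat.cast_nonneg _
  have hLpos : (0 : ℝ) < (L v).card := by linarith
  have hκ : (2 : ℝ) ≤ α + b := by linarith
  have key := card_mul_exp_mul_count_erase_le G hκ v _ S L hv
    (Finset.card_pos.1 (by exact_mod_cast hLpos)) rfl ?_ ?_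
  · have h4 : (countWith G S L v i : ℝ) ≤ count G (S.erase v) L := by
      norm_cast
      unfold countWith
      split_ifs
      · exact count_mono G fun u _ => dropColor_subset _ _ _ _
      · exact Nat.zero_le _
    have hgood := h v hv
    have h5 : ((nbrs G S v).card : ℝ) / (L v).card ≤ 1 / α := by
      rw [div_le_div_iff₀ hLpos hα0]
      linarith
    have h6 : 1 / (α + b) ≤ 1 / b := one_div_le_one_div_of_le hb (by linarith)
    have h7 : ((nbrs G S v).card : ℝ) / (L v).card * (1 + 1 / (α + b)) ≤
        1 / α * (1 + 1 / b) := by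
      gcongr
    have h8 : Real.exp (-(1 / α) * (1 + 1 / b)) ≤
        Real.exp (-(((nbrs G S v).card : ℝ) / (L v).card * (1 + 1 / (α + b)))) :=
      Real.exp_le_exp.2 (by linarith)
    have h9 : 2 * (1 + ε) * ((nbrs G S v).card : ℝ) ≤
        (L v).card * Real.exp (-(((nbrs G S v).card : ℝ) / (L v).card * (1 + 1 / (α + b)))) := by
      calc _ ≤ α * Real.exp (-(1 / α) * (1 + 1 / b)) * ((nbrs G S v).card : ℝ) := by
            exact mul_le_mul_of_nonneg_right hc.cutoff hm0
        _ = (α * (nbrs G S v).card) * Real.exp (-(1 / α) * (1 + 1 / b)) := by ring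
        _ ≤ _ := by
            gcongr
            linarith
    unfold marg
    rw [← mul_div_assoc, div_le_one h1]
    calc _ ≤ (L v).card * Real.exp (-(((nbrs G S v).card : ℝ) / (L v).card *
          (1 + 1 / (α + b)))) * count G (S.erase v) L := by gcongr
      _ ≤ _ := key
  · intro u hu w hw huw
    exact hG {v, u, w} (SimpleGraph.is3Clique_triple_iff.2
      ⟨(mem_nbrs.1 hu).2, (mem_nbrs.1 hw).2, huw⟩)
  · intro w hw
    obtain ⟨hwS, hadj⟩ := mem_nbrs.1 hw
    have h2 : (((nbrs G (S.erase v) w).card : ℝ)) + 1 = (nbrs G S w).card := by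
      exact_mod_cast card_nbrs_erase_of_adj hv hadj.symm
    have h3 := h w hwS
    rw [← h2] at h3
    have : (0 : ℝ) ≤ (nbrs G (S.erase v) w).card := Nat.cast_nonneg _
    nlinarith

end Marginals

/-! ### Correlation decay -/

section Decay

variable {V C : Type} [LinearOrder V] [DecidableEq C]

/-- The factor by which one more level of the recursion reduces the error. -/
noncomputable def contraction (b ε : ℝ) : ℝ := 1 / ((1 + ε) * (1 - 1 / b))

/-- The error of the trivial estimate `1 / |L(v)|`, per neighbor of `v`. -/
noncomputable def baseError (b : ℝ) : ℝ := 1 - Real.log (1 - 1 / b)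

theorem Admissible.contraction_pos {α b ε : ℝ} (h : Admissible α b ε) :
    0 < contraction b ε := by
  have := h.contract
  unfold contraction
  positivity

theorem Admissible.contraction_lt_one {α b ε : ℝ} (h : Admissible α b ε) :
    contraction b ε < 1 := by
  have := h.contract
  unfold contraction
  rw [div_lt_one (by linarith)]
  exact this

theorem Admissible.one_le_baseError {α b ε : ℝ} (h : Admissible α b ε) : 1 ≤ baseError b := by
  have h1 := h.inv_b_lt
  have h2 : 0 < 1 / b := by have := h.one_lt_b; positivity
  have : Real.log (1 - 1 / b) ≤ 0 := Real.log_nonpos (by linarith) (by linarith)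
  unfold baseError
  linarith

/-- The weights `A_j` of the recursion, for marginal estimates given by `p`. -/
noncomputable def weight (G : SimpleGraph V) (S : Finset V) (L : V → Finset C) (v : V)
    (p : Finset V → (V → Finset C) → V → C → ℝ) (j : C) : ℝ :=
  ∏ w ∈ nbrs G S v, (1 - p (S.erase v) (dropColor L ((nbrs G S v).filter (· < w)) j) w j)

theorem Phi_succ (b ε : ℝ) (G : SimpleGraph V) (d : ℕ) (S : Finset V) (L : V → Finset C) (v : V)
    {i : C} (hi : i ∈ L v) : Phi b ε G (d + 1) S L v i =
      if (nbrs G S v).card = 0 then 1 / ((L v).card : ℝ)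
      else min (min (1 / (2 * (1 + ε) * ((nbrs G S v).card : ℝ))) (1 / b))
        (weight G S L v (Phi b ε G d) i / ∑ j ∈ L v, weight G S L v (Phi b ε G d) j) := by
  rw [Phi, if_pos hi]
  rfl

theorem Phi_of_notMem (b ε : ℝ) (G : SimpleGraph V) (d : ℕ) (S : Finset V) (L : V → Finset C)
    (v : V) {i : C} (hi : i ∉ L v) : Phi b ε G d S L v i = 0 := by
  cases d <;> rw [Phi] <;> simp [hi]

variable [Fintype V] [Fintype C]
variable {α b ε : ℝ} {G : SimpleGraph V} {S : Finset V} {L : V → Finset C} {v : V}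

theorem marg_eq_weight (hα : 1 ≤ α) (hb : 0 < b) (h : GoodOn α b G S L) (hv : v ∈ S) {i : C}
    (hi : i ∈ L v) :
    marg G S L v i = weight G S L v (marg G) i / ∑ j ∈ L v, weight G S L v (marg G) j :=
  marg_eq_ratio G L hv hi ((h.erase_self hα v).count_pos hα hb)

theorem GoodOn.sub_dropColor (hα : 1 ≤ α) (h : GoodOn α b G S L) (hv : v ∈ S) (j : C) (w : V) :
    GoodOn α b G (S.erase v) (dropColor L ((nbrs G S v).filter (· < w)) j) :=
  h.erase hα hv (Finset.filter_subset _ _) j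

theorem weight_marg_mem_Icc (hc : Admissible α b ε) (h : GoodOn α b G S L) (hv : v ∈ S) (j : C) :
    (1 - 1 / b) ^ (nbrs G S v).card ≤ weight G S L v (marg G) j ∧
      weight G S L v (marg G) j ≤ 1 := by
  have hα : 1 ≤ α := by linarith [hc.two_lt]
  have hb : 0 < b := by linarith [hc.one_lt_b]
  have hb1 := hc.inv_b_lt
  have hle : ∀ w ∈ nbrs G S v,
      marg G (S.erase v) (dropColor L ((nbrs G S v).filter (· < w)) j) w j ≤ 1 / b :=
    fun w hw => (h.sub_dropColor hα hv j w).marg_le_inv hα hb (nbrs_subset_erase G S v hw) j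
  constructor
  · rw [← Finset.prod_const]
    refine Finset.prod_le_prod (fun w _ => by linarith) fun w hw => ?_
    linarith [hle w hw]
  · refine Finset.prod_le_one (fun w hw => by linarith [hle w hw]) fun w hw => ?_
    linarith [marg_nonneg G (S.erase v) (dropColor L ((nbrs G S v).filter (· < w)) j) w j]

/-- The trivial estimate `1 / |L(v)|` is off by a bounded factor per neighbor. -/
theorem abs_log_marg_sub_base_le (hc : Admissible α b ε) (h : GoodOn α b G S L) (hv : v ∈ S)
    {i : C} (hi : i ∈ L v) :
    |Real.log (marg G S L v i) - Real.log (1 / ((L v).card : ℝ))| ≤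
      (nbrs G S v).card * baseError b := by
  have hα : 1 ≤ α := by linarith [hc.two_lt]
  have hb : 0 < b := by linarith [hc.one_lt_b]
  have hb1 := hc.inv_b_lt
  have hr : 0 < 1 - 1 / b := by linarith
  set m : ℝ := ((nbrs G S v).card : ℝ) with hm
  have hm0 : 0 ≤ m := Nat.cast_nonneg _
  have hsub := h.le_sub hα hv
  have hLpos : (0 : ℝ) < (L v).card := by linarith
  have hpos := h.marg_pos hα hb hv hi
  have hlog : Real.log (1 - 1 / b) ≤ 0 := Real.log_nonpos (by linarith) (by
    have : 0 < 1 / b := by positivity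
    linarith)
  rw [one_div, Real.log_inv, sub_neg_eq_add, ← Real.log_mul hpos.ne' hLpos.ne', abs_le]
  unfold baseError
  constructor
  · have h1 : (1 - 1 / b) ^ (nbrs G S v).card ≤ marg G S L v i * (L v).card := by
      rw [marg_eq_weight hα hb h hv hi]
      have hw := fun j => weight_marg_mem_Icc hc h hv j
      have hwp : ∀ j, 0 < weight G S L v (marg G) j := fun j => (pow_pos hr _).trans_le (hw j).1
      have hsum : ∑ j ∈ L v, weight G S L v (marg G) j ≤ (L v).card := by
        simpa using Finset.sum_le_sum fun j (_ : j ∈ L v) => (hw j).2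
      have hsp : 0 < ∑ j ∈ L v, weight G S L v (marg G) j :=
        Finset.sum_pos (fun j _ => hwp j) ⟨i, hi⟩
      rw [div_mul_eq_mul_div, le_div_iff₀ hsp]
      calc _ ≤ weight G S L v (marg G) i * ∑ j ∈ L v, weight G S L v (marg G) j := by
            gcongr; exact (hw i).1
        _ ≤ _ := by gcongr; exact (hwp i).le
    have h2 := Real.log_le_log (pow_pos hr _) h1
    rw [Real.log_pow, ← hm] at h2
    nlinarith
  · have h1 := h.sub_mul_marg_le hα hb hv i
    have h3 : marg G S L v i * (L v).card ≤ (L v).card / ((L v).card - m) := by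
      rw [le_div_iff₀ (by linarith)]
      nlinarith
    have h4 := Real.log_le_log (by positivity) h3
    have h5 : Real.log ((L v).card / ((L v).card - m)) ≤ m := by
      refine (Real.log_le_sub_one_of_pos (div_pos hLpos (by linarith))).trans ?_
      rw [div_sub_one (by linarith), sub_sub_cancel]
      refine div_le_self hm0 ?_
      linarith [hc.one_lt_b]
    nlinarith

/-- Correlation decay: the error of the depth-`d` estimate, divided by the degree, decreases
geometrically in `d`. -/
theorem Phi_spec (hc : Admissible α b ε) (hG : G.CliqueFree 3) (d : ℕ) :
    ∀ (S : Finset V) (L : V → Finset C) (v : V) (i : C), GoodOn α b G S L → v ∈ S → i ∈ L v →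
      0 < Phi b ε G d S L v i ∧ Phi b ε G d S L v i ≤ 1 / b ∧
      2 * (1 + ε) * ((nbrs G S v).card : ℝ) * Phi b ε G d S L v i ≤ 1 ∧
      |Real.log (marg G S L v i) - Real.log (Phi b ε G d S L v i)| ≤
        (nbrs G S v).card * (baseError b * contraction b ε ^ d) := by
  have hα2 := hc.two_lt
  have hα : 1 ≤ α := by linarith
  have hb : 0 < b := by linarith [hc.one_lt_b]
  have hb1 := hc.inv_b_lt
  have hε := hc.eps_pos
  have hr : 0 < 1 - 1 / b := by linarith
  have hbase : ∀ (S : Finset V) (L : V → Finset C) (v : V) (i : C), GoodOn α b G S L → v ∈ S →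
      0 < 1 / ((L v).card : ℝ) ∧ 1 / ((L v).card : ℝ) ≤ 1 / b ∧
      2 * (1 + ε) * ((nbrs G S v).card : ℝ) * (1 / ((L v).card : ℝ)) ≤ 1 := by
    intro S L v i h hv
    have hm0 : (0 : ℝ) ≤ (nbrs G S v).card := Nat.cast_nonneg _
    have hg := h v hv
    have hle : b ≤ ((L v).card : ℝ) := by nlinarith
    have hLpos : (0 : ℝ) < (L v).card := by linarith
    refine ⟨by positivity, one_div_le_one_div_of_le hb hle, ?_⟩
    rw [mul_one_div, div_le_one hLpos]
    have h1 : 2 * (1 + ε) ≤ α := by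
      refine hc.cutoff.trans ?_
      have h5 : 0 ≤ 1 / α * (1 + 1 / b) := by positivity
      have : Real.exp (-(1 / α) * (1 + 1 / b)) ≤ 1 := Real.exp_le_one_iff.2 (by linarith)
      nlinarith
    nlinarith
  have hE0 : 0 ≤ baseError b := by linarith [hc.one_le_baseError]
  induction d with
  | zero =>
    intro S L v i h hv hi
    rw [Phi, if_pos hi]
    obtain ⟨h1, h2, h3⟩ := hbase S L v i h hv
    exact ⟨h1, h2, h3, by simpa using abs_log_marg_sub_base_le hc h hv hi⟩
  | succ d ih =>
    intro S L v i h hv hi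
    rw [Phi_succ _ _ _ _ _ _ _ hi]
    split_ifs with hm
    · obtain ⟨h1, h2, h3⟩ := hbase S L v i h hv
      refine ⟨h1, h2, h3, (abs_log_marg_sub_base_le hc h hv hi).trans ?_⟩
      simp [hm]
    · have hmpos : (0 : ℝ) < (nbrs G S v).card := by
        exact_mod_cast Nat.pos_of_ne_zero hm
      set E : ℝ := baseError b * contraction b ε ^ d with hE
      have hEn : 0 ≤ E := mul_nonneg hE0 (pow_nonneg hc.contraction_pos.le d)
      -- one factor of a weight
      have hfac : ∀ j, ∀ w ∈ nbrs G S v,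
          0 < 1 - Phi b ε G d (S.erase v) (dropColor L ((nbrs G S v).filter (· < w)) j) w j ∧
          0 < 1 - marg G (S.erase v) (dropColor L ((nbrs G S v).filter (· < w)) j) w j ∧
          |Real.log (1 - marg G (S.erase v) (dropColor L ((nbrs G S v).filter (· < w)) j) w j) -
           Real.log (1 - Phi b ε G d (S.erase v)
            (dropColor L ((nbrs G S v).filter (· < w)) j) w j)| ≤ E * contraction b ε / 2 := by
        intro j w hw
        have hw' := nbrs_subset_erase G S v hw
        have hg := h.sub_dropColor hα hv j w
        set L' := dropColor L ((nbrs G S v).filter (· < w)) j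
        have hcn : 0 ≤ E * contraction b ε / 2 := by
          have := hc.contraction_pos
          positivity
        by_cases hj : j ∈ L' w
        · obtain ⟨p1, p2, p3, p4⟩ := ih (S.erase v) L' w j hg hw' hj
          have q1 := hg.marg_pos hα hb hw' hj
          have q2 := hg.marg_le_inv hα hb hw' j
          have q3 := hg.marg_mul_le hc hG hw' j
          refine ⟨by linarith, by linarith, ?_⟩
          rcases Nat.eq_zero_or_pos (nbrs G (S.erase v) w).card with hz | hz
          · have hl := abs_log_one_sub_sub_le q1 p1 q2 p2 q2 p2 hb1
            have : |Real.log (marg G (S.erase v) L' w j) -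
                Real.log (Phi b ε G d (S.erase v) L' w j)| = 0 := by
              refine le_antisymm ?_ (abs_nonneg _)
              simpa [hz] using p4
            rw [this, mul_zero] at hl
            exact hl.trans hcn
          · have hz' : (0 : ℝ) < (nbrs G (S.erase v) w).card := by exact_mod_cast hz
            have hK : 0 < 2 * (1 + ε) * ((nbrs G (S.erase v) w).card : ℝ) := by positivity
            have hl := abs_log_one_sub_sub_le (M := 1 / (2 * (1 + ε) *
              ((nbrs G (S.erase v) w).card : ℝ))) q1 p1
              ((le_div_iff₀ hK).2 (by linarith)) ((le_div_iff₀ hK).2 (by linarith)) q2 p2 hb1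
            refine hl.trans ((mul_le_mul_of_nonneg_left p4 (by positivity)).trans_eq ?_)
            unfold contraction
            field_simp
        · rw [Phi_of_notMem _ _ _ _ _ _ _ hj, marg_of_notMem hj]
          simpa using hcn
      have hWΦ : ∀ j, 0 < weight G S L v (Phi b ε G d) j := fun j =>
        Finset.prod_pos fun w hw => (hfac j w hw).1
      have hWm : ∀ j, 0 < weight G S L v (marg G) j := fun j =>
        Finset.prod_pos fun w hw => (hfac j w hw).2.1
      have hW : ∀ j ∈ L v, |Real.log (weight G S L v (marg G) j) -
          Real.log (weight G S L v (Phi b ε G d) j)| ≤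
          (nbrs G S v).card * (E * contraction b ε / 2) := by
        intro j _
        unfold weight
        rw [Real.log_prod fun w hw => (hfac j w hw).2.1.ne',
          Real.log_prod fun w hw => (hfac j w hw).1.ne', ← Finset.sum_sub_distrib]
        refine (Finset.abs_sum_le_sum_abs _ _).trans ?_
        refine (Finset.sum_le_sum fun w hw => (hfac j w hw).2.2).trans_eq ?_
        simp
      have hratio := abs_log_ratio_sub_le (L v) _ _ _ hi (fun j _ => hWm j) (fun j _ => hWΦ j) hW
      rw [← marg_eq_weight hα hb h hv hi] at hratio
      have hK : 0 < 2 * (1 + ε) * ((nbrs G S v).card : ℝ) := by positivity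
      have hrpos : 0 < weight G S L v (Phi b ε G d) i /
          ∑ j ∈ L v, weight G S L v (Phi b ε G d) j :=
        div_pos (hWΦ i) (Finset.sum_pos (fun j _ => hWΦ j) ⟨i, hi⟩)
      refine ⟨lt_min (lt_min (by positivity) (by positivity)) hrpos,
        (min_le_left _ _).trans (min_le_right _ _), ?_, ?_⟩
      · have := (min_le_left (min (1 / (2 * (1 + ε) * ((nbrs G S v).card : ℝ))) (1 / b))
          (weight G S L v (Phi b ε G d) i / ∑ j ∈ L v, weight G S L v (Phi b ε G d) j)).trans
          (min_le_left _ _)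
        rw [le_div_iff₀ hK] at this
        linarith
      · refine (abs_log_sub_log_min_le (h.marg_pos hα hb hv hi) ?_).trans (hratio.trans_eq ?_)
        · refine le_min ?_ (h.marg_le_inv hα hb hv i)
          rw [le_div_iff₀ hK]
          linarith [h.marg_mul_le hc hG hv i]
        · rw [hE, pow_succ]; ring

/-- The error of a run of CountCOLOR adds up over the rounds. -/
theorem CountColor.abs_log_sub_le (hc : Admissible α b ε) (hG : G.CliqueFree 3) {d : ℕ} {z : ℝ}
    (hz : CountColor b ε G d S L z) (h : GoodOn α b G S L) :
    0 < z ∧ |Real.log z - Real.log (count G S L)| ≤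
      S.card * (Fintype.card V * (baseError b * contraction b ε ^ d)) := by
  have hα : 1 ≤ α := by linarith [hc.two_lt]
  have hb : 0 < b := by linarith [hc.one_lt_b]
  induction hz with
  | done L => simp [count_empty]
  | step S L v i z hv hi _ ih =>
    obtain ⟨hz, hle⟩ := ih (h.erase hα hv subset_rfl i)
    obtain ⟨p1, -, -, p4⟩ := Phi_spec hc hG d S L v i h hv hi
    refine ⟨by positivity, ?_⟩
    have hpos : (0 : ℝ) < count G S L := by exact_mod_cast h.count_pos hα hb
    have hpos' : (0 : ℝ) < count G (S.erase v) (dropColor L (nbrs G S v) i) := by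
      exact_mod_cast (h.erase hα hv subset_rfl i).count_pos hα hb
    have hm : Real.log (marg G S L v i) =
        Real.log (count G (S.erase v) (dropColor L (nbrs G S v) i)) - Real.log (count G S L) := by
      rw [marg, countWith, if_pos hi, Real.log_div hpos'.ne' hpos.ne']
    rw [Real.log_mul (inv_ne_zero p1.ne') hz.ne', Real.log_inv]
    rw [hm] at p4
    have hE : 0 ≤ baseError b * contraction b ε ^ d :=
      mul_nonneg (by linarith [hc.one_le_baseError]) (pow_nonneg hc.contraction_pos.le d)
    have hn : ((nbrs G S v).card : ℝ) ≤ Fintype.card V := by exact_mod_cast Finset.card_le_univ _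
    have hcard : ((S.erase v).card : ℝ) + 1 = S.card := by
      exact_mod_cast Finset.card_erase_add_one hv
    have p5 := p4.trans (mul_le_mul_of_nonneg_right hn hE)
    rw [← hcard, add_mul, one_mul]
    rw [abs_le] at *
    constructor <;> linarith [hle.1, hle.2, p5.1, p5.2]

end Decay

/-! ### The constants and the accuracy of a run -/

theorem BetaCond.one_lt {α β : ℝ} (hα : 0 < α) (hβ : 0 < β) (h : BetaCond α β) : 1 < β := by
  by_contra hle
  have h1 : 1 ≤ 1 / β := by rw [le_div_iff₀ hβ]; linarith
  unfold BetaCond at h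
  have h2 : 0 < α * Real.exp (-(1 / α) * (1 + 1 / β)) := by positivity
  nlinarith

/-- Rational constants exist because the condition on `β` is strict and continuous in `β`. -/
theorem exists_constants {α β : ℝ} (hα : 0 < α) (hβ : 0 < β) (h : BetaCond α β) :
    ∃ b ε : ℚ, 0 < b ∧ (b : ℝ) ≤ β ∧ BetaCond α b ∧ 0 < ε ∧ Admissible α b ε := by
  have hcont : ContinuousAt
      (fun x : ℝ => (1 - 1 / x) * α * Real.exp (-(1 / α) * (1 + 1 / x))) β := by
    have : ContinuousAt (fun x : ℝ => 1 / x) β := continuousAt_const.div continuousAt_id hβ.ne'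
    exact ((continuousAt_const.sub this).mul continuousAt_const).mul
      (Real.continuous_exp.continuousAt.comp
        (continuousAt_const.mul (continuousAt_const.add this)))
  have hev : ∀ᶠ x : ℝ in nhds β, BetaCond α x := hcont.eventually (lt_mem_nhds h)
  obtain ⟨l, hl, hlt⟩ := exists_Ioc_subset_of_mem_nhds hev ⟨0, hβ⟩
  obtain ⟨b, hb1, hb2⟩ := exists_rat_btwn (max_lt hl hβ)
  have hb0 : (0 : ℝ) < b := (le_max_right _ _).trans_lt hb1
  have hbc : BetaCond α b := hlt ⟨(le_max_left _ _).trans_lt hb1, hb2.le⟩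
  have hb1' := hbc.one_lt hα hb0
  have hr : 0 < 1 - 1 / (b : ℝ) := by
    have : 1 / (b : ℝ) < 1 := by rw [div_lt_one hb0]; exact hb1'
    linarith
  have hlt : 1 / (1 - 1 / (b : ℝ)) - 1 <
      α * Real.exp (-(1 / α) * (1 + 1 / (b : ℝ))) / 2 - 1 := by
    have h3 : 1 / (1 - 1 / (b : ℝ)) < α * Real.exp (-(1 / α) * (1 + 1 / (b : ℝ))) / 2 := by
      rw [div_lt_div_iff₀ hr two_pos]
      unfold BetaCond at hbc
      linarith
    linarith
  obtain ⟨ε, he1, he2⟩ := exists_rat_btwn hlt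
  have hone : 1 < 1 / (1 - 1 / (b : ℝ)) := by
    rw [lt_div_iff₀ hr]
    have : 0 < 1 / (b : ℝ) := by positivity
    linarith
  have hε : (0 : ℝ) < ε := by linarith
  -- `1 / (1 - 1 / b) < 1 + ε` is contraction, the upper bound for `ε` is the cut-off condition
  refine ⟨b, ε, by exact_mod_cast hb0, hb2.le, hbc, by exact_mod_cast hε,
    hb1', hε, by linarith, ?_, hα⟩
  have : 1 / (1 - 1 / (b : ℝ)) < 1 + ε := by linarith
  rwa [div_lt_iff₀ hr] at this

namespace GraphList

variable {I : GraphList}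

theorem deg_eq (I : GraphList) (v : Fin I.N) : I.deg v = (nbrs I.G Finset.univ v).card := by
  unfold deg
  rw [← Set.ncard_coe_finset]
  congr 1
  ext u
  simp [mem_nbrs]

theorem Good.goodOn {α β b : ℝ} (h : I.Good α β) (hb : b ≤ β) :
    GoodOn α b I.G Finset.univ I.L := by
  intro v _
  rw [← deg_eq]
  linarith [h.2 v]

theorem N_le_size (I : GraphList) : I.N ≤ I.size := le_max_left _ _

theorem q_le_size (I : GraphList) : I.q ≤ I.size :=
  (le_max_right _ _).trans (le_max_right _ _)

end GraphList

/-- Accuracy of every run whose depth is a large multiple of the bit length. -/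
theorem CountColor.accurate {α β b ε : ℝ} (hc : Admissible α b ε) (hb : b ≤ β) {K : ℕ}
    (hK : contraction b ε ^ K ≤ 1 / (16 * baseError b)) {I : GraphList} (hI : I.Good α β)
    {δ : ℝ} (hδ : 0 < δ) {z : ℝ}
    (hz : CountColor b ε I.G (K * Nat.size (I.size + ⌈1 / δ⌉₊)) Finset.univ I.L z) :
    1 - δ ≤ z / (I.Z : ℝ) ∧ z / (I.Z : ℝ) ≤ 1 + δ := by
  have hα : 1 ≤ α := by linarith [hc.two_lt]
  have hb0 : 0 < b := by linarith [hc.one_lt_b]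
  obtain ⟨hz0, hle⟩ := hz.abs_log_sub_le hc hI.1 (hI.goodOn hb)
  have hZ := (hI.goodOn hb).count_pos hα hb0
  rw [GraphList.count_univ_eq_Z] at hle hZ
  have hZ' : (0 : ℝ) < I.Z := by exact_mod_cast hZ
  set r : ℕ := ⌈1 / δ⌉₊ with hr
  set s : ℕ := Nat.size (I.size + r) with hs
  have hr0 : 0 < r := Nat.ceil_pos.2 (by positivity)
  have hrδ : 1 / δ ≤ (r : ℝ) := Nat.le_ceil _
  have hs1 : 1 ≤ s := Nat.size_pos.2 (by omega)
  have hlt : I.size + r < 2 ^ s := Nat.lt_size_self _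
  set C := baseError b with hC
  have hC1 : 1 ≤ C := hc.one_le_baseError
  set Q : ℝ := 2 ^ s with hQ
  have hQ2 : 2 ≤ Q := by
    calc (2 : ℝ) = 2 ^ 1 := by norm_num
      _ ≤ 2 ^ s := pow_le_pow_right₀ (by norm_num) hs1
  have hNQ : (I.N : ℝ) ≤ Q := by
    have : I.N ≤ 2 ^ s := by have := I.N_le_size; omega
    rw [hQ]; exact_mod_cast this
  have hrQ : (r : ℝ) ≤ Q := by
    have : r ≤ 2 ^ s := by omega
    rw [hQ]; exact_mod_cast this
  -- the bit length `s` as exponent turns `1 / 16` into `2 ^ (-4 s)`, which beats `N ^ 2` and `r`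
  have hθ : C * contraction b ε ^ (K * s) ≤ 1 / Q ^ 4 := by
    rw [pow_mul]
    calc C * (contraction b ε ^ K) ^ s ≤ C * (1 / (16 * C)) ^ s := by
          have := hc.contraction_pos
          gcongr
      _ = C / C ^ s / Q ^ 4 := by
          rw [one_div, inv_pow, mul_pow, hQ, ← pow_mul, mul_comm s 4, pow_mul]
          norm_num
          field_simp
      _ ≤ 1 / Q ^ 4 := by
          gcongr
          rw [div_le_one (by positivity)]
          exact le_self_pow₀ hC1 (by omega)
  set x : ℝ := |Real.log z - Real.log I.Z| with hx
  have hr0' : (0 : ℝ) < r := by exact_mod_cast hr0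
  have hxle : x ≤ 1 / (2 * r) := by
    refine hle.trans ?_
    simp only [Finset.card_univ, Fintype.card_fin]
    calc (I.N : ℝ) * (I.N * (C * contraction b ε ^ (K * s))) ≤ Q * (Q * (1 / Q ^ 4)) := by
          have := hc.contraction_pos
          gcongr
      _ = 1 / (Q * Q) := by field_simp
      _ ≤ 1 / (2 * r) := by
          apply one_div_le_one_div_of_le (by positivity)
          gcongr
  have hx0 : 0 ≤ x := abs_nonneg _
  have h1r : 1 / (r : ℝ) ≤ δ := by
    rw [div_le_iff₀ hr0']
    rwa [div_le_iff₀ hδ, mul_comm] at hrδ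
  have hx2 : 2 * x ≤ δ := by
    refine le_trans ?_ h1r
    calc 2 * x ≤ 2 * (1 / (2 * r)) := by linarith
      _ = 1 / r := by field_simp
  have hxhalf : x ≤ 1 / 2 := by
    refine hxle.trans (one_div_le_one_div_of_le (by norm_num) ?_)
    have : (1 : ℝ) ≤ r := by exact_mod_cast hr0
    linarith
  have hq : z / I.Z = Real.exp (Real.log z - Real.log I.Z) := by
    rw [Real.exp_sub, Real.exp_log hz0, Real.exp_log hZ']
  rw [hq]
  constructor
  · have h1 := Real.add_one_le_exp (Real.log z - Real.log I.Z)
    have h2 := neg_abs_le (Real.log z - Real.log I.Z)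
    linarith
  · have h1 : Real.exp (Real.log z - Real.log I.Z) ≤ Real.exp x :=
      Real.exp_le_exp.2 (le_abs_self _)
    have h2 : Real.exp x * (1 - x) ≤ 1 := by
      have h3 := Real.add_one_le_exp (-x)
      calc Real.exp x * (1 - x) ≤ Real.exp x * Real.exp (-x) := by
            gcongr; linarith
        _ = 1 := by rw [← Real.exp_add]; simp
    nlinarith [Real.exp_pos x]

theorem Admissible.exists_depth_factor {α b ε : ℝ} (hc : Admissible α b ε) :
    ∃ K : ℕ, contraction b ε ^ K ≤ 1 / (16 * baseError b) := by
  have hC := hc.one_le_baseError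
  obtain ⟨K, hK⟩ := exists_pow_lt_of_lt_one (show 0 < 1 / (16 * baseError b) by positivity)
    hc.contraction_lt_one
  exact ⟨K, hK.le⟩

/-! ### Bit lengths of natural and rational numbers -/

theorem Nat.size_mul_le (a b : ℕ) : Nat.size (a * b) ≤ Nat.size a + Nat.size b := by
  rw [Nat.size_le, pow_add]
  exact Nat.mul_lt_mul'' (Nat.lt_size_self a) (Nat.lt_size_self b)

theorem Nat.size_le_self (a : ℕ) : Nat.size a ≤ a := by
  rw [Nat.size_le]
  exact Nat.lt_two_pow_self

/-- Bit length of the denominator. -/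
def denSize (x : ℚ) : ℕ := Nat.size x.den

/-- Bit length of a rational number. -/
def ratSize (x : ℚ) : ℕ := Nat.size x.num.natAbs + Nat.size x.den

theorem denSize_one : denSize 1 = 1 := by simp [denSize]

theorem denSize_zero : denSize 0 = 1 := by simp [denSize]

theorem denSize_le_of_dvd {x : ℚ} {a b : ℕ} (ha : 0 < a) (hb : 0 < b) (h : x.den ∣ a * b) :
    denSize x ≤ Nat.size a + Nat.size b :=
  (Nat.size_le_size (Nat.le_of_dvd (Nat.mul_pos ha hb) h)).trans (Nat.size_mul_le a b)

theorem denSize_mul_le (x y : ℚ) : denSize (x * y) ≤ denSize x + denSize y :=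
  denSize_le_of_dvd x.den_pos y.den_pos (Rat.mul_den_dvd x y)

theorem denSize_add_le (x y : ℚ) : denSize (x + y) ≤ denSize x + denSize y :=
  denSize_le_of_dvd x.den_pos y.den_pos (Rat.add_den_dvd x y)

theorem denSize_one_sub_le (x : ℚ) : denSize (1 - x) ≤ denSize x := by
  refine Nat.size_le_size (Nat.le_of_dvd x.den_pos ?_)
  have := Rat.sub_den_dvd 1 x
  rwa [Rat.den_one, one_mul] at this

theorem num_natAbs_le {x : ℚ} {k : ℕ} (h0 : 0 ≤ x) (h1 : x ≤ k) : x.num.natAbs ≤ k * x.den := by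
  have hd : (0 : ℚ) < x.den := by exact_mod_cast x.den_pos
  have h2 : (x.num : ℚ) ≤ k * x.den := by
    have := Rat.num_div_den x
    rw [← this, div_le_iff₀ hd] at h1
    exact h1
  have h3 : x.num ≤ k * x.den := by exact_mod_cast h2
  have h4 : 0 ≤ x.num := Rat.num_nonneg.2 h0
  zify
  rw [abs_of_nonneg h4]
  exact h3

theorem ratSize_le_of_le {x : ℚ} {k : ℕ} (h0 : 0 ≤ x) (h1 : x ≤ k) :
    ratSize x ≤ k + 2 * denSize x := by
  have h2 := (Nat.size_le_size (num_natAbs_le h0 h1)).trans (Nat.size_mul_le _ _)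
  have h3 := Nat.size_le_self k
  unfold ratSize denSize
  omega

theorem ratSize_le_of_le_one {x : ℚ} (h0 : 0 ≤ x) (h1 : x ≤ 1) : ratSize x ≤ 2 * denSize x := by
  have h2 := Nat.size_le_size (num_natAbs_le (k := 1) h0 (by simpa using h1))
  rw [one_mul] at h2
  unfold ratSize denSize
  omega

theorem denSize_inv_le (x : ℚ) : denSize x⁻¹ ≤ Nat.size x.num.natAbs + 1 := by
  unfold denSize
  rw [Rat.den_inv]
  split_ifs
  · simp
  · omega

theorem denSize_inv_le_of_le {x : ℚ} {k : ℕ} (h0 : 0 ≤ x) (h1 : x ≤ k) :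
    denSize x⁻¹ ≤ k + denSize x + 1 := by
  have h2 := (Nat.size_le_size (num_natAbs_le h0 h1)).trans (Nat.size_mul_le _ _)
  have h3 := Nat.size_le_self k
  have h4 := denSize_inv_le x
  unfold denSize at *
  omega

theorem ratSize_inv_le (x : ℚ) : ratSize x⁻¹ ≤ ratSize x := by
  unfold ratSize
  rw [Rat.num_inv, Rat.den_inv, Int.natAbs_mul, Int.natAbs_natCast]
  split_ifs with h
  · have : 1 ≤ Nat.size x.den := Nat.size_pos.2 x.den_pos
    simp [h]
    omega
  · rw [Int.natAbs_sign_of_ne_zero h, one_mul]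
    omega

theorem ratSize_mul_le (x y : ℚ) : ratSize (x * y) ≤ ratSize x + ratSize y := by
  have h1 := denSize_mul_le x y
  have h2 : Nat.size (x * y).num.natAbs ≤ Nat.size x.num.natAbs + Nat.size y.num.natAbs := by
    by_cases h0 : x * y = 0
    · simp [h0]
    · refine le_trans (Nat.size_le_size ?_) (Nat.size_mul_le _ _)
      rw [← Int.natAbs_mul]
      refine Nat.le_of_dvd (Int.natAbs_pos.2 ?_) (Int.natAbs_dvd_natAbs.2 ?_)
      · have h0' := mul_ne_zero_iff.1 h0
        exact mul_ne_zero (Rat.num_ne_zero.2 h0'.1) (Rat.num_ne_zero.2 h0'.2)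
      · have := Rat.mul_num x y
        rw [this]
        exact Int.ediv_dvd_of_dvd (Int.natCast_dvd.2 (by
          rw [Int.natAbs_mul]; exact Nat.gcd_dvd_left _ _))
  unfold ratSize denSize at *
  omega

theorem ratSize_div_le (x y : ℚ) : ratSize (x / y) ≤ ratSize x + ratSize y := by
  rw [div_eq_mul_inv]
  exact (ratSize_mul_le _ _).trans (Nat.add_le_add_left (ratSize_inv_le y) _)

theorem denSize_natCast_div_le (p q : ℕ) : denSize ((p : ℚ) / q) ≤ q + 1 := by
  rw [div_eq_mul_inv]
  by_cases hq : q = 0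
  · simp [hq, denSize]
  refine (denSize_mul_le _ _).trans ?_
  have h2 := Nat.size_le_self q
  have h3 : denSize (p : ℚ) = 1 := by simp [denSize]
  have h4 : denSize ((q : ℚ)⁻¹) ≤ q := by
    unfold denSize; rw [Rat.den_inv]; simpa [hq] using h2
  omega

/-! ### Rules for step counts -/

/-- A run yields the value `v` in at most `T` steps. -/
def Runs {A : Type} (r : A × ℕ) (v : A) (T : ℕ) : Prop := r.1 = v ∧ r.2 ≤ T

namespace Runs

variable {Φ : List (Ty × Ty)} {Γ : List Ty} {a b c : Ty} {f : FEnv Φ} {e : Env Γ}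

theorem mono {A : Type} {r : A × ℕ} {v : A} {T T' : ℕ} (h : Runs r v T) (hT : T ≤ T') :
    Runs r v T' := ⟨h.1, h.2.trans hT⟩

theorem congr {A : Type} {r : A × ℕ} {v v' : A} {T : ℕ} (h : Runs r v T) (hv : v = v') :
    Runs r v' T := hv ▸ h

theorem lit (n : ℕ) : Runs ((Tm.lit (Φ := Φ) (Γ := Γ) n).run f e) n (n + 1) :=
  ⟨rfl, by have := Nat.size_le_self n; simp only [Tm.run]; omega⟩

theorem prim {op : Prim a b} {s : Tm Φ Γ a} {x : a.Val} {T B : ℕ} (hs : Runs (s.run f e) x T)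
    (hB : a.bits x ≤ B) : Runs ((Tm.prim op s).run f e) (op.apply x) (T + (1 + B) ^ 2) := by
  obtain ⟨h1, h2⟩ := hs
  refine ⟨by simp only [Tm.run]; rw [h1], ?_⟩
  simp only [Tm.run]
  rw [h1]
  gcongr

theorem pair {s : Tm Φ Γ a} {t : Tm Φ Γ b} {x : a.Val} {y : b.Val} {T T' : ℕ}
    (hs : Runs (s.run f e) x T) (ht : Runs (t.run f e) y T') :
    Runs ((Tm.pair s t).run f e) (x, y) (T + T' + 1) := by
  obtain ⟨h1, h2⟩ := hs
  obtain ⟨h3, h4⟩ := ht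
  refine ⟨by simp only [Tm.run]; rw [h1, h3], ?_⟩
  simp only [Tm.run]
  omega

theorem fst {s : Tm Φ Γ (.prod a b)} {x : (Ty.prod a b).Val} {T : ℕ}
    (hs : Runs (s.run f e) x T) : Runs ((Tm.fst s).run f e) x.1 (T + 1) := by
  obtain ⟨h1, h2⟩ := hs
  refine ⟨by simp only [Tm.run]; rw [h1], ?_⟩
  simp only [Tm.run]
  omega

theorem snd {s : Tm Φ Γ (.prod a b)} {x : (Ty.prod a b).Val} {T : ℕ}
    (hs : Runs (s.run f e) x T) : Runs ((Tm.snd s).run f e) x.2 (T + 1) := by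
  obtain ⟨h1, h2⟩ := hs
  refine ⟨by simp only [Tm.run]; rw [h1], ?_⟩
  simp only [Tm.run]
  omega

theorem nil : Runs ((Tm.nil (Φ := Φ) (Γ := Γ) (a := a)).run f e) [] 1 := ⟨rfl, le_rfl⟩

theorem cons {s : Tm Φ Γ a} {t : Tm Φ Γ (.list a)} {x : a.Val} {y : List a.Val} {T T' : ℕ}
    (hs : Runs (s.run f e) x T) (ht : Runs (t.run f e) y T') :
    Runs ((Tm.cons s t).run f e) (x :: y) (T + T' + 1) := by
  obtain ⟨h1, h2⟩ := hs
  obtain ⟨h3, h4⟩ := ht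
  refine ⟨by simp only [Tm.run]; rw [h1, h3], ?_⟩
  simp only [Tm.run]
  omega

theorem ite {s : Tm Φ Γ .nat} {t t' : Tm Φ Γ a} {p : Prop} [Decidable p] {x : ℕ} {y y' : a.Val}
    {T U : ℕ} (hs : Runs (s.run f e) x T) (hp : x ≠ 0 ↔ p)
    (ht : p → Runs (t.run f e) y U) (ht' : ¬ p → Runs (t'.run f e) y' U) :
    Runs ((Tm.ite s t t').run f e) (if p then y else y') (T + U + 1) := by
  obtain ⟨h1, h2⟩ := hs
  simp only [Tm.run]
  rw [h1]
  by_cases h : p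
  · obtain ⟨h3, h4⟩ := ht h
    simp only [hp.2 h, h, if_true, ne_eq, not_false_eq_true]
    exact ⟨h3, by simp only; omega⟩
  · obtain ⟨h3, h4⟩ := ht' h
    have : x = 0 := by by_contra hx; exact h (hp.1 hx)
    simp only [this, h, if_false, ne_eq, not_true_eq_false]
    exact ⟨h3, by simp only; omega⟩

theorem bind {s : Tm Φ Γ a} {t : Tm Φ (a :: Γ) b} {x : a.Val} {y : b.Val} {T T' : ℕ}
    (hs : Runs (s.run f e) x T) (ht : Runs (t.run f (x, e)) y T') :
    Runs ((Tm.bind s t).run f e) y (T + T' + 1) := by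
  obtain ⟨h1, h2⟩ := hs
  obtain ⟨h3, h4⟩ := ht
  simp only [Tm.run]
  rw [h1]
  exact ⟨h3, by simp only; omega⟩

theorem call {p : Pos Φ (a, b)} {s : Tm Φ Γ a} {x : a.Val} {y : b.Val} {T T' : ℕ}
    (hs : Runs (s.run f e) x T) (hp : Runs (f.get p x) y T') :
    Runs ((Tm.call p s).run f e) y (T + T' + 1) := by
  obtain ⟨h1, h2⟩ := hs
  obtain ⟨h3, h4⟩ := hp
  simp only [Tm.run]
  rw [h1]
  exact ⟨h3, by simp only; omega⟩

/-- Left folds, with an invariant that knows the number of elements already processed. -/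
theorem foldl {l : Tm Φ Γ (.list a)} {s : Tm Φ Γ b} {body : Tm Φ (a :: b :: Γ) b}
    {xs : List a.Val} {y : b.Val} {T T' C : ℕ} (F : b.Val → a.Val → b.Val)
    (Inv : ℕ → b.Val → Prop) (hl : Runs (l.run f e) xs T) (hs : Runs (s.run f e) y T')
    (h0 : Inv 0 y)
    (hstep : ∀ k < xs.length, ∀ u ∈ xs, ∀ acc, Inv k acc →
      Runs (body.run f (u, acc, e)) (F acc u) C ∧ Inv (k + 1) (F acc u)) :
    Runs ((Tm.foldl l s body).run f e) (xs.foldl F y) (T + T' + 1 + xs.length * (C + 1)) ∧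
      Inv xs.length (xs.foldl F y) := by
  obtain ⟨h1, h2⟩ := hl
  obtain ⟨h3, h4⟩ := hs
  simp only [Tm.run]
  rw [h1, h3]
  have key : ∀ (zs : List a.Val) (k : ℕ) (acc : b.Val) (t U : ℕ), k + zs.length = xs.length →
      (∀ z ∈ zs, z ∈ xs) → Inv k acc → t ≤ U →
      Runs (zs.foldl (fun acc u => ((body.run f (u, acc.1, e)).1,
        acc.2 + (body.run f (u, acc.1, e)).2 + 1)) (acc, t)) (zs.foldl F acc)
        (U + zs.length * (C + 1)) ∧ Inv xs.length (zs.foldl F acc) := by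
    intro zs
    induction zs with
    | nil =>
      intro k acc t U hk _ hi ht
      simp only [List.length_nil, add_zero] at hk
      exact ⟨⟨rfl, by simpa using ht⟩, by simpa [hk] using hi⟩
    | cons z zs ih =>
      intro k acc t U hk hz hi ht
      simp only [List.length_cons] at hk
      obtain ⟨⟨r1, r2⟩, hi'⟩ := hstep k (by omega) z (hz z List.mem_cons_self) acc hi
      simp only [List.foldl_cons]
      rw [r1]
      have := ih (k + 1) (F acc z) (t + (body.run f (z, acc, e)).2 + 1) (U + (C + 1)) (by omega)
        (fun w hw => hz w (List.mem_cons_of_mem _ hw)) hi' (by omega)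
      refine ⟨this.1.mono ?_, this.2⟩
      rw [List.length_cons, Nat.succ_mul]
      omega
  exact key xs 0 y _ (T + T' + 1) (by simp) (fun _ h => h) h0 (by omega)

/-- Right folds whose body has a bounded cost. -/
theorem foldr {l : Tm Φ Γ (.list a)} {s : Tm Φ Γ b} {body : Tm Φ (a :: b :: Γ) b}
    {xs : List a.Val} {y : b.Val} {T T' C : ℕ} (F : a.Val → b.Val → b.Val)
    (hl : Runs (l.run f e) xs T) (hs : Runs (s.run f e) y T')
    (hstep : ∀ u ∈ xs, ∀ acc, Runs (body.run f (u, acc, e)) (F u acc) C) :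
    Runs ((Tm.foldr l s body).run f e) (xs.foldr F y) (T + T' + 1 + xs.length * (C + 1)) := by
  obtain ⟨h1, h2⟩ := hl
  obtain ⟨h3, h4⟩ := hs
  simp only [Tm.run]
  rw [h1, h3]
  clear h1
  induction xs with
  | nil => exact ⟨rfl, by simpa using by omega⟩
  | cons z zs ih =>
    obtain ⟨i1, i2⟩ := ih fun u hu => hstep u (List.mem_cons_of_mem _ hu)
    simp only [List.foldr_cons]
    rw [i1]
    obtain ⟨r1, r2⟩ := hstep z List.mem_cons_self (zs.foldr F y)
    refine ⟨r1, ?_⟩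
    rw [List.length_cons, Nat.succ_mul]
    simp only
    omega

/-- Recursion: a family of specifications, one for each depth. -/
theorem recur {n : Tm Φ Γ .nat} {s : Tm Φ Γ a} {base : Tm Φ (a :: Γ) b}
    {step : Tm ((a, b) :: Φ) (a :: Γ) b} {k : ℕ} {x : a.Val} {T T' : ℕ}
    (P : ℕ → a.Val → Prop) (val : ℕ → a.Val → b.Val) (C : ℕ → ℕ)
    (hn : Runs (n.run f e) k T) (hs : Runs (s.run f e) x T')
    (hbase : ∀ u, P 0 u → Runs (base.run f (u, e)) (val 0 u) (C 0))
    (hstep : ∀ j, ∀ g : a.Val → b.Val × ℕ, (∀ u, P j u → Runs (g u) (val j u) (C j)) →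
      ∀ u, P (j + 1) u → Runs (step.run (g, f) (u, e)) (val (j + 1) u) (C (j + 1)))
    (hP : P k x) :
    Runs ((Tm.recur n s base step).run f e) (val k x) (T + T' + C k + (1 + k)) := by
  obtain ⟨h1, h2⟩ := hn
  obtain ⟨h3, h4⟩ := hs
  simp only [Tm.run]
  rw [h1, h3]
  have key : ∀ j u, P j u → Runs (Nat.rec (motive := fun _ => a.Val → b.Val × ℕ)
      (fun u => base.run f (u, e)) (fun _ g u => step.run (g, f) (u, e)) j u)
      (val j u) (C j) := by
    intro j
    induction j with
    | zero => exact hbase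
    | succ j ih => exact hstep j _ ih
  obtain ⟨r1, r2⟩ := key k x hP
  have := Nat.size_le_self k
  exact ⟨r1, by simp only; omega⟩

end Runs

/-! ### Subprograms on lists -/

/-- Bound for the cost of an operation with two operands of bit length at most `M`. -/
def opCost (M : ℕ) : ℕ := (1 + 2 * M) ^ 2

theorem opCost_mono {M M' : ℕ} (h : M ≤ M') : opCost M ≤ opCost M' := by
  unfold opCost; gcongr

theorem one_le_opCost (M : ℕ) : 1 ≤ opCost M := Nat.one_le_pow _ _ (by omega)

section Terms

variable {Φ : List (Ty × Ty)} {Γ : List Ty} {a b c a' b' c' : Ty}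

/-- The variable of the innermost binder. -/
def x0 : Tm Φ (a :: Γ) a := .var .here
/-- The variable below one binder. -/
def x1 : Tm Φ (b :: a :: Γ) a := .var (.there .here)
/-- The variable below two binders. -/
def x2 : Tm Φ (c :: b :: a :: Γ) a := .var (.there (.there .here))
/-- The variable below three binders. -/
def x3 : Tm Φ (a' :: c :: b :: a :: Γ) a := .var (.there (.there (.there .here)))
/-- The variable below four binders. -/
def x4 : Tm Φ (b' :: a' :: c :: b :: a :: Γ) a :=
  .var (.there (.there (.there (.there .here))))
/-- The variable below five binders. -/
def x5 : Tm Φ (c' :: b' :: a' :: c :: b :: a :: Γ) a :=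
  .var (.there (.there (.there (.there (.there .here)))))

namespace Runs

variable {f : FEnv Φ} {e : Env Γ} {u : a.Val} {u1 : b.Val} {u2 : c.Val} {u3 : a'.Val}
  {u4 : b'.Val} {u5 : c'.Val}

theorem x0 : Runs ((x0 : Tm Φ (a :: Γ) a).run f (u, e)) u 1 := ⟨rfl, le_rfl⟩
theorem x1 : Runs ((x1 : Tm Φ (b :: a :: Γ) a).run f (u1, u, e)) u 1 := ⟨rfl, le_rfl⟩
theorem x2 : Runs ((x2 : Tm Φ (c :: b :: a :: Γ) a).run f (u2, u1, u, e)) u 1 := ⟨rfl, le_rfl⟩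
theorem x3 : Runs ((x3 : Tm Φ (a' :: c :: b :: a :: Γ) a).run f (u3, u2, u1, u, e)) u 1 :=
  ⟨rfl, le_rfl⟩
theorem x4 : Runs ((x4 : Tm Φ (b' :: a' :: c :: b :: a :: Γ) a).run f (u4, u3, u2, u1, u, e)) u 1 :=
  ⟨rfl, le_rfl⟩
theorem x5 : Runs ((x5 : Tm Φ (c' :: b' :: a' :: c :: b :: a :: Γ) a).run f
    (u5, u4, u3, u2, u1, u, e)) u 1 :=
  ⟨rfl, le_rfl⟩

variable {Δ : List Ty} {d : Env Δ}

theorem natOp {op : Prim (.prod .nat .nat) b} {s : Tm Φ Δ (.prod .nat .nat)} {x y T : ℕ} (M : ℕ)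
    (hs : Runs (s.run f d) (x, y) T) (hx : x ≤ M) (hy : y ≤ M) :
    Runs ((Tm.prim op s).run f d) (op.apply (x, y)) (T + opCost M) := by
  refine prim hs ?_
  have h1 := Nat.size_le_self x
  have h2 := Nat.size_le_self y
  simp only [Ty.bits]
  omega

theorem natAdd {s : Tm Φ Δ (.prod .nat .nat)} {x y T : ℕ} (M : ℕ)
    (hs : Runs (s.run f d) (x, y) T) (hx : x ≤ M) (hy : y ≤ M) :
    Runs ((Tm.prim .natAdd s).run f d) (x + y : ℕ) (T + opCost M) := natOp M hs hx hy

theorem natMul {s : Tm Φ Δ (.prod .nat .nat)} {x y T : ℕ} (M : ℕ)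
    (hs : Runs (s.run f d) (x, y) T) (hx : x ≤ M) (hy : y ≤ M) :
    Runs ((Tm.prim .natMul s).run f d) (x * y : ℕ) (T + opCost M) := natOp M hs hx hy

theorem ratOf {s : Tm Φ Δ (.prod .nat .nat)} {x y T : ℕ} (M : ℕ)
    (hs : Runs (s.run f d) (x, y) T) (hx : x ≤ M) (hy : y ≤ M) :
    Runs ((Tm.prim .ratOf s).run f d) ((x : ℚ) / (y : ℚ) : ℚ) (T + opCost M) := natOp M hs hx hy

/-- Branching on equality of natural numbers. -/
theorem iteEq {s : Tm Φ Δ (.prod .nat .nat)} {t t' : Tm Φ Δ a} {x y T U : ℕ} {z z' : a.Val} (M : ℕ)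
    (hs : Runs (s.run f d) (x, y) T) (hx : x ≤ M) (hy : y ≤ M)
    (ht : x = y → Runs (t.run f d) z U) (ht' : x ≠ y → Runs (t'.run f d) z' U) :
    Runs ((Tm.ite (.prim .natEq s) t t').run f d) (if x = y then z else z')
      (T + opCost M + U + 1) :=
  ite (natOp M hs hx hy) (by simp [Prim.apply]) ht ht'

/-- Branching on comparison of natural numbers. -/
theorem iteLe {s : Tm Φ Δ (.prod .nat .nat)} {t t' : Tm Φ Δ a} {x y T U : ℕ} {z z' : a.Val} (M : ℕ)
    (hs : Runs (s.run f d) (x, y) T) (hx : x ≤ M) (hy : y ≤ M)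
    (ht : x ≤ y → Runs (t.run f d) z U) (ht' : ¬ x ≤ y → Runs (t'.run f d) z' U) :
    Runs ((Tm.ite (.prim .natLe s) t t').run f d) (if x ≤ y then z else z')
      (T + opCost M + U + 1) :=
  ite (natOp M hs hx hy) (by simp [Prim.apply]) ht ht'

theorem ratOp {op : Prim (.prod .rat .rat) b} {s : Tm Φ Δ (.prod .rat .rat)} {x y : ℚ} {T : ℕ}
    (R : ℕ) (hs : Runs (s.run f d) (x, y) T) (hx : ratSize x ≤ R) (hy : ratSize y ≤ R) :
    Runs ((Tm.prim op s).run f d) (op.apply (x, y)) (T + opCost R) := by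
  refine prim hs ?_
  simp only [Ty.bits]
  unfold ratSize at hx hy
  omega

theorem ratAdd {s : Tm Φ Δ (.prod .rat .rat)} {x y : ℚ} {T : ℕ}
    (R : ℕ) (hs : Runs (s.run f d) (x, y) T) (hx : ratSize x ≤ R) (hy : ratSize y ≤ R) :
    Runs ((Tm.prim .ratAdd s).run f d) (x + y : ℚ) (T + opCost R) := ratOp R hs hx hy

theorem ratSub {s : Tm Φ Δ (.prod .rat .rat)} {x y : ℚ} {T : ℕ}
    (R : ℕ) (hs : Runs (s.run f d) (x, y) T) (hx : ratSize x ≤ R) (hy : ratSize y ≤ R) :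
    Runs ((Tm.prim .ratSub s).run f d) (x - y : ℚ) (T + opCost R) := ratOp R hs hx hy

theorem ratMul {s : Tm Φ Δ (.prod .rat .rat)} {x y : ℚ} {T : ℕ}
    (R : ℕ) (hs : Runs (s.run f d) (x, y) T) (hx : ratSize x ≤ R) (hy : ratSize y ≤ R) :
    Runs ((Tm.prim .ratMul s).run f d) (x * y : ℚ) (T + opCost R) := ratOp R hs hx hy

theorem ratDiv {s : Tm Φ Δ (.prod .rat .rat)} {x y : ℚ} {T : ℕ}
    (R : ℕ) (hs : Runs (s.run f d) (x, y) T) (hx : ratSize x ≤ R) (hy : ratSize y ≤ R) :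
    Runs ((Tm.prim .ratDiv s).run f d) (x / y : ℚ) (T + opCost R) := ratOp R hs hx hy

end Runs

/-- Pairs of natural numbers. -/
abbrev pairTy : Ty := .prod .nat .nat

/-- Deletions of nodes and colors: `(0, u)` deletes the node `u` and `(u + 1, c)` deletes the
color `c` from the list of `u`. -/
abbrev delTy : Ty := .list pairTy

/-- The list of neighbors and the list of colors of a node. -/
abbrev rowTy : Ty := .prod (.list .nat) (.list .nat)

/-- An instance as a list of rows, the current deletions, a node and a color. -/
abbrev argTy : Ty := .prod (.list rowTy) (.prod delTy pairTy)

/-- Membership of a pair in a list of deletions. -/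
def memTm : Tm Φ (.prod pairTy delTy :: Γ) .nat :=
  .foldl (.snd x0) (.lit 0)
    (.ite (.prim .natEq (.pair (.fst x0) (.fst (.fst x2))))
      (.ite (.prim .natEq (.pair (.snd x0) (.snd (.fst x2)))) (.lit 1) x1) x1)

/-- Deletion of the elements `c` of a list for which `(k, c)` is among the deletions. -/
def keepTm : Tm Φ (.prod .nat (.prod (.list .nat) delTy) :: Γ) (.list .nat) :=
  .foldr (.fst (.snd x0)) .nil
    (.ite (.bind (.pair (.pair (.fst x2) x0) (.snd (.snd x2))) memTm) x1 (.cons x0 x1))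

/-- The entry of a list with a given index. -/
def rowTm : Tm Φ (.prod .nat (.list rowTy) :: Γ) rowTy :=
  .snd (.foldl (.snd x0) (.pair (.lit 0) (.pair .nil .nil))
    (.pair (.prim .natAdd (.pair (.fst x1) (.lit 1)))
      (.ite (.prim .natEq (.pair (.fst x1) (.fst x2))) x0 (.snd x1))))

/-- The current list of colors of a node. -/
def colsTm : Tm Φ (argTy :: Γ) (.list .nat) :=
  .bind (.pair (.prim .natAdd (.pair (.fst (.snd (.snd x0))) (.lit 1)))
    (.pair (.snd (.bind (.pair (.fst (.snd (.snd x0))) (.fst x0)) rowTm)) (.fst (.snd x0)))) keepTm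

/-- The remaining neighbors of a node. Their deletions carry the key `0`, so that the same
subprogram serves for neighbors and for colors. -/
def nbrsTm : Tm Φ (argTy :: Γ) (.list .nat) :=
  .bind (.pair (.lit 0)
    (.pair (.fst (.bind (.pair (.fst (.snd (.snd x0))) (.fst x0)) rowTm)) (.fst (.snd x0)))) keepTm

/-- The length of a list. -/
def lenTm : Tm Φ (.list a :: Γ) .nat :=
  .foldl x0 (.lit 0) (.prim .natAdd (.pair x1 (.lit 1)))

/-- The minimum of two rational numbers. -/
def minTm : Tm Φ (.prod .rat .rat :: Γ) .rat :=
  .ite (.prim .ratLe x0) (.fst x0) (.snd x0)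

end Terms

/-- Graph data: for every node the list of its neighbors and the list of its colors. -/
abbrev Data : Type := List (List ℕ × List ℕ)

/-- Deletions of nodes and colors: `(0, u)` deletes the node `u` and `(u + 1, c)` deletes the
color `c` from the list of `u`. -/
abbrev Del : Type := List (ℕ × ℕ)

/-- The elements `c` of a list for which `(k, c)` has not been deleted. -/
def keep (k : ℕ) (l : List ℕ) (D : Del) : List ℕ := l.filter fun c => (k, c) ∉ D

/-- The remaining neighbors of a node. -/
def nbrList (g : Data) (D : Del) (v : ℕ) : List ℕ := keep 0 (g.getD v ([], [])).1 D

/-- The current list of colors of a node. -/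
def colList (g : Data) (D : Del) (v : ℕ) : List ℕ := keep (v + 1) (g.getD v ([], [])).2 D

/-- Bounds on the data: `W` bounds the lengths of the lists and `M` everything else. -/
structure SmallData (W M : ℕ) (g : Data) : Prop where
  length_le : g.length ≤ M
  nbrs_length : ∀ row ∈ g, row.1.length ≤ W
  cols_length : ∀ row ∈ g, row.2.length ≤ W
  nbrs_le : ∀ row ∈ g, ∀ x ∈ row.1, x + 1 ≤ M
  cols_le : ∀ row ∈ g, ∀ x ∈ row.2, x ≤ M

/-- All deletions concern numbers of size at most `M`. -/
def SmallDel (M : ℕ) (D : Del) : Prop := ∀ p ∈ D, p.1 ≤ M ∧ p.2 ≤ M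

theorem SmallDel.cons {M : ℕ} {D : Del} (h : SmallDel M D) {x y : ℕ} (hx : x ≤ M) (hy : y ≤ M) :
    SmallDel M ((x, y) :: D) := by
  intro p hp
  rcases List.mem_cons.1 hp with rfl | hp
  · exact ⟨hx, hy⟩
  · exact h p hp

theorem length_keep_le (k : ℕ) (l : List ℕ) (D : Del) : (keep k l D).length ≤ l.length :=
  List.length_filter_le _ _

namespace SmallData

variable {W M : ℕ} {g : Data}

theorem getD (h : SmallData W M g) (v : ℕ) :
    (g.getD v ([], [])).1.length ≤ W ∧ (g.getD v ([], [])).2.length ≤ W ∧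
    (∀ x ∈ (g.getD v ([], [])).1, x + 1 ≤ M) ∧ ∀ x ∈ (g.getD v ([], [])).2, x ≤ M := by
  by_cases hv : v < g.length
  · rw [List.getD_eq_getElem _ _ hv]
    have hm := List.getElem_mem hv
    exact ⟨h.nbrs_length _ hm, h.cols_length _ hm, h.nbrs_le _ hm, h.cols_le _ hm⟩
  · rw [List.getD_eq_default _ _ (not_lt.1 hv)]
    simp

theorem length_nbrList_le (h : SmallData W M g) (D : Del) (v : ℕ) :
    (nbrList g D v).length ≤ W := (length_keep_le _ _ _).trans (h.getD v).1

theorem length_colList_le (h : SmallData W M g) (D : Del) (v : ℕ) :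
    (colList g D v).length ≤ W := (length_keep_le _ _ _).trans (h.getD v).2.1

theorem nbrList_le (h : SmallData W M g) {D : Del} {v x : ℕ} (hx : x ∈ nbrList g D v) :
    x + 1 ≤ M := (h.getD v).2.2.1 x (List.mem_of_mem_filter hx)

theorem colList_le (h : SmallData W M g) {D : Del} {v x : ℕ} (hx : x ∈ colList g D v) :
    x ≤ M := (h.getD v).2.2.2 x (List.mem_of_mem_filter hx)

end SmallData

theorem foldl_index_eq_getD {A : Type} (l : List A) (v k : ℕ) (z : A) :
    (l.foldl (fun (acc : ℕ × A) u => (acc.1 + 1, if acc.1 = v then u else acc.2)) (k, z)).2 =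
      if k ≤ v then l.getD (v - k) z else z := by
  induction l generalizing k z with
  | nil => simp
  | cons u l ih =>
    rw [List.foldl_cons, ih]
    rcases lt_trichotomy k v with h | h | h
    · rw [if_pos (by omega), if_pos h.le, if_neg h.ne]
      obtain ⟨m, hm⟩ : ∃ m, v - k = m + 1 := ⟨v - k - 1, by omega⟩
      rw [hm, List.getD_cons_succ, show v - (k + 1) = m by omega]
    · subst h
      simp
    · rw [if_neg (by omega), if_neg (by omega), if_neg (by omega)]

theorem foldl_mem_eq (D : Del) (p : ℕ × ℕ) (z : ℕ) :
    D.foldl (fun acc u => if u.1 = p.1 then (if u.2 = p.2 then 1 else acc) else acc) z =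
      if p ∈ D then 1 else z := by
  induction D generalizing z with
  | nil => simp
  | cons u D ih =>
    rw [List.foldl_cons, ih]
    by_cases h : u = p
    · subst h; simp
    · have h' : p ≠ u := fun e => h e.symm
      have : ¬ (u.1 = p.1 ∧ u.2 = p.2) := fun e => h (Prod.ext e.1 e.2)
      simp only [List.mem_cons, h', false_or]
      split_ifs <;> tauto

theorem foldl_length_eq {A : Type} (l : List A) (k : ℕ) :
    l.foldl (fun acc _ => acc + 1) k = k + l.length := by
  induction l generalizing k with
  | nil => rfl
  | cons u l ih => rw [List.foldl_cons, ih, List.length_cons]; omega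

theorem foldr_keep_eq (k : ℕ) (l : List ℕ) (D : Del) :
    l.foldr (fun c acc => if (k, c) ∈ D then acc else c :: acc) [] = keep k l D := by
  induction l with
  | nil => rfl
  | cons c l ih =>
    unfold keep at *
    by_cases h : (k, c) ∈ D
    · rw [List.foldr_cons, ih, if_pos h, List.filter_cons_of_neg (by simpa using h)]
    · rw [List.foldr_cons, ih, if_neg h, List.filter_cons_of_pos (by simpa using h)]

/-- Cost bound for the membership test, for data bounded by `M`. -/
def memCost (M : ℕ) : ℕ := M * (2 * opCost M + 18) + 5
/-- Cost bound for the removal of deleted elements, for data bounded by `M`. -/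
def keepCost (M : ℕ) : ℕ := M * (memCost M + 16) + 5
/-- Cost bound for the access to a row, for data bounded by `M`. -/
def rowCost (M : ℕ) : ℕ := M * (2 * opCost M + 18) + 9
/-- Cost bound for the current neighbors or colors of a node, for data bounded by `M`. -/
def listCost (M : ℕ) : ℕ := rowCost M + keepCost M + opCost M + 30
/-- Cost bound for the length of a list, for data bounded by `M`. -/
def lenCost (M : ℕ) : ℕ := M * (opCost M + 5) + 4

section Costs

variable {Φ : List (Ty × Ty)} {Γ : List Ty} {f : FEnv Φ} {e : Env Γ} {M W : ℕ}

theorem runs_memTm {p : ℕ × ℕ} {D : Del} (h1 : p.1 ≤ M) (h2 : p.2 ≤ M) (hD : SmallDel M D)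
    (hl : D.length ≤ M) :
    Runs ((memTm : Tm Φ (.prod pairTy delTy :: Γ) .nat).run f ((p, D), e))
      (if p ∈ D then 1 else 0 : ℕ) (memCost M) := by
  have := Runs.foldl (f := f) (e := ((p, D), e)) (l := .snd x0) (s := .lit 0)
    (body := .ite (.prim .natEq (.pair (.fst x0) (.fst (.fst x2))))
      (.ite (.prim .natEq (.pair (.snd x0) (.snd (.fst x2)))) (.lit 1) x1) x1)
    (C := 2 * opCost M + 17)
    (fun (acc : ℕ) (u : ℕ × ℕ) => if u.1 = p.1 then (if u.2 = p.2 then 1 else acc) else acc)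
    (fun _ _ => True) (.snd .x0) (.lit 0) trivial
    (fun k _ u hu acc _ => by
      refine ⟨Runs.mono (Runs.iteEq M (.pair (.fst .x0) (.fst (.fst .x2))) (hD u hu).1 h1
        (fun _ => Runs.iteEq M (.pair (.snd .x0) (.snd (.fst .x2))) (hD u hu).2 h2
          (fun _ => Runs.lit 1) (fun _ => Runs.mono .x1 (by omega)))
        (fun _ => Runs.mono .x1 (by omega))) (by omega), trivial⟩)
  refine (this.1.congr (foldl_mem_eq D p 0)).mono ?_
  have : D.length * (2 * opCost M + 17 + 1) ≤ M * (2 * opCost M + 18) := Nat.mul_le_mul hl le_rfl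
  unfold memCost
  simp only
  omega

theorem runs_keepTm {k : ℕ} {l : List ℕ} {D : Del} (hk : k ≤ M) (hl : ∀ x ∈ l, x ≤ M)
    (hll : l.length ≤ M) (hD : SmallDel M D) (hDl : D.length ≤ M) :
    Runs ((keepTm : Tm Φ (.prod .nat (.prod (.list .nat) delTy) :: Γ) (.list .nat)).run f
      ((k, l, D), e)) (keep k l D) (keepCost M) := by
  have := Runs.foldr (f := f) (e := ((k, l, D), e)) (l := .fst (.snd x0)) (s := .nil)
    (body := .ite (.bind (.pair (.pair (.fst x2) x0) (.snd (.snd x2))) memTm) x1 (.cons x0 x1))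
    (C := memCost M + 15)
    (fun (c : ℕ) (acc : List ℕ) => if (k, c) ∈ D then acc else c :: acc)
    (.fst (.snd .x0)) .nil
    (fun u hu acc => Runs.mono (Runs.ite
      (.bind (.pair (.pair (.fst .x2) .x0) (.snd (.snd .x2)))
        (runs_memTm (p := (k, u)) hk (hl u hu) hD hDl)) (by simp)
        (fun _ => Runs.mono .x1 (by omega)) (fun _ => .cons .x0 .x1)) (by omega))
  refine (this.congr (foldr_keep_eq k l D)).mono ?_
  have : l.length * (memCost M + 15 + 1) ≤ M * (memCost M + 16) := Nat.mul_le_mul hll le_rfl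
  unfold keepCost
  simp only
  omega

theorem runs_rowTm {v : ℕ} {g : Data} (hM : 1 ≤ M) (hv : v ≤ M) (hg : g.length ≤ M) :
    Runs ((rowTm : Tm Φ (.prod .nat (.list rowTy) :: Γ) rowTy).run f ((v, g), e))
      (g.getD v ([], [])) (rowCost M) := by
  have := Runs.foldl (f := f) (e := ((v, g), e)) (a := rowTy) (b := .prod .nat rowTy) (xs := g)
    (l := .snd x0) (s := .pair (.lit 0) (.pair .nil .nil))
    (body := .pair (.prim .natAdd (.pair (.fst x1) (.lit 1)))
      (.ite (.prim .natEq (.pair (.fst x1) (.fst x2))) x0 (.snd x1)))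
    (C := 2 * opCost M + 17)
    (fun (acc : ℕ × List ℕ × List ℕ) u => (acc.1 + 1, if acc.1 = v then u else acc.2))
    (fun k acc => acc.1 = k) (.snd .x0) (.pair (.lit 0) (.pair .nil .nil)) rfl
    (fun k hk u hu acc hacc => by
      have hk' : acc.1 ≤ M := by rw [hacc]; exact (hk.trans_le hg).le
      refine ⟨Runs.mono (Runs.pair (Runs.natAdd M (.pair (.fst .x1) (.lit 1)) hk' hM)
        (Runs.iteEq M (.pair (.fst .x1) (.fst .x2)) hk' hv (fun _ => Runs.mono .x0 (by omega))
          (fun _ => .snd .x1))) (by omega), by simp [hacc]⟩)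
  refine ((Runs.snd this.1).congr ?_).mono ?_
  · exact (foldl_index_eq_getD g v 0 ([], [])).trans (by simp)
  · have : g.length * (2 * opCost M + 17 + 1) ≤ M * (2 * opCost M + 18) :=
      Nat.mul_le_mul hg le_rfl
    unfold rowCost
    omega

theorem runs_colsTm {v i : ℕ} {g : Data} {D : Del} (hg : SmallData W M g) (hW : W ≤ M)
    (hv : v + 1 ≤ M) (hD : SmallDel M D) (hDl : D.length ≤ M) :
    Runs ((colsTm : Tm Φ (argTy :: Γ) (.list .nat)).run f ((g, D, v, i), e))
      (colList g D v) (listCost M) := by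
  have h := hg.getD v
  have hM : 1 ≤ M := by omega
  have hv' : v ≤ M := by omega
  refine Runs.mono (Runs.bind (.pair (.natAdd M (.pair (.fst (.snd (.snd .x0))) (.lit 1)) hv' hM)
    (.pair (.snd (.bind (.pair (.fst (.snd (.snd .x0))) (.fst .x0))
      (runs_rowTm hM hv' hg.length_le))) (.fst (.snd .x0))))
    (runs_keepTm hv h.2.2.2 (h.2.1.trans hW) hD hDl)) ?_
  unfold listCost
  omega

theorem runs_nbrsTm {v i : ℕ} {g : Data} {D : Del} (hg : SmallData W M g) (hW : W ≤ M)
    (hv : v + 1 ≤ M) (hD : SmallDel M D) (hDl : D.length ≤ M) :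
    Runs ((nbrsTm : Tm Φ (argTy :: Γ) (.list .nat)).run f ((g, D, v, i), e))
      (nbrList g D v) (listCost M) := by
  have h := hg.getD v
  have hM : 1 ≤ M := by omega
  have hv' : v ≤ M := by omega
  refine Runs.mono (Runs.bind (.pair (.lit 0)
    (.pair (.fst (.bind (.pair (.fst (.snd (.snd .x0))) (.fst .x0))
      (runs_rowTm hM hv' hg.length_le))) (.fst (.snd .x0))))
    (runs_keepTm (Nat.zero_le _) (fun x hx => (Nat.le_succ x).trans (h.2.2.1 x hx))
      (h.1.trans hW) hD hDl)) ?_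
  unfold listCost
  omega

theorem runs_lenTm {a : Ty} {l : List a.Val} (hM : 1 ≤ M) (hl : l.length ≤ M) :
    Runs ((lenTm : Tm Φ (.list a :: Γ) .nat).run f (l, e)) l.length (lenCost M) := by
  have := Runs.foldl (f := f) (e := (l, e)) (l := x0) (s := .lit 0)
    (body := .prim .natAdd (.pair x1 (.lit 1))) (C := opCost M + 4)
    (fun (acc : ℕ) (_ : a.Val) => acc + 1)
    (fun k acc => acc = k) .x0 (.lit 0) rfl
    (fun k hk u hu acc hacc => by
      refine ⟨Runs.mono (Runs.natAdd M (.pair .x1 (.lit 1)) ?_ hM) (by omega), by simp [hacc]⟩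
      rw [hacc]; exact (hk.trans_le hl).le)
  refine (this.1.congr ((foldl_length_eq l 0).trans (zero_add _))).mono ?_
  have : l.length * (opCost M + 4 + 1) ≤ M * (opCost M + 5) := Nat.mul_le_mul hl le_rfl
  unfold lenCost
  omega

theorem runs_minTm {x y : ℚ} {R : ℕ} (hx : ratSize x ≤ R) (hy : ratSize y ≤ R) :
    Runs ((minTm : Tm Φ (.prod .rat .rat :: Γ) .rat).run f ((x, y), e)) (min x y)
      (opCost R + 4) := by
  refine ((Runs.ite (p := x ≤ y) (Runs.ratOp (op := .ratLe) R .x0 hx hy) (by simp [Prim.apply])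
    (fun _ => Runs.fst .x0) (fun _ => Runs.snd .x0)).congr ?_).mono (by omega)
  exact (min_def x y).symm

end Costs

/-! ### The estimates of CountCOLOR on lists -/

/-- The weight `A_j`: the color `j` is deleted from the lists of the neighbors one after the
other. -/
def weightL (p : Del → ℕ → ℕ → ℚ) (ns : List ℕ) (D : Del) (j : ℕ) : ℚ :=
  (ns.foldl (fun acc w => (acc.1 * (1 - p acc.2 w j), (w + 1, j) :: acc.2)) ((1 : ℚ), D)).1

/-- The sum of the weights of the colors in `cs`, and the weight of the color `i`, or `0` if it is
not in `cs`. -/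
def sumsL (A : ℕ → ℚ) (cs : List ℕ) (i : ℕ) : ℚ × ℚ :=
  cs.foldl (fun acc j => (acc.1 + A j, if j = i then A j else acc.2)) ((0 : ℚ), (0 : ℚ))

/-- The normalized weight of the color `i`. -/
def ratioL (A : ℕ → ℚ) (cs : List ℕ) (i : ℕ) : ℚ := (sumsL A cs i).2 / (sumsL A cs i).1

/-- Numerators and denominators of the cut-offs `p₁ / (q₁ m)` and `p₂ / q₂` at a node with `m`
neighbors. -/
structure Cutoffs where
  p₁ : ℕ
  q₁ : ℕ
  p₂ : ℕ
  q₂ : ℕ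

/-- The cut-offs that belong to the constants `b` and `ε`. -/
structure Cutoffs.Fits (κ : Cutoffs) (b ε : ℝ) : Prop where
  first : (κ.p₁ : ℝ) / κ.q₁ = 1 / (2 * (1 + ε))
  second : (κ.p₂ : ℝ) / κ.q₂ = 1 / b

/-- The estimate `Phi` on lists. The normalized weight is also the correct value for isolated nodes
and for colors outside the list of the node. -/
def phiL (κ : Cutoffs) (g : Data) : ℕ → Del → ℕ → ℕ → ℚ
  | 0, D, v, i => ratioL (fun _ => 1) (colList g D v) i
  | d + 1, D, v, i =>
      if (nbrList g D v).length ≠ 0 then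
        min (min ((κ.p₁ : ℚ) / ((κ.q₁ * (nbrList g D v).length : ℕ) : ℚ)) ((κ.p₂ : ℚ) / (κ.q₂ : ℚ)))
          (ratioL (weightL (phiL κ g d) (nbrList g D v) ((0, v) :: D)) (colList g D v) i)
      else ratioL (weightL (phiL κ g d) (nbrList g D v) ((0, v) :: D)) (colList g D v) i

theorem List.foldl_invariant {A B : Type} (F : B → A → B) (Inv : ℕ → B → Prop) (xs : List A)
    (y : B) (h0 : Inv 0 y) (hstep : ∀ k < xs.length, ∀ u ∈ xs, ∀ acc, Inv k acc →
      Inv (k + 1) (F acc u)) : Inv xs.length (xs.foldl F y) := by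
  have key : ∀ (zs : List A) (k : ℕ) (acc : B), k + zs.length = xs.length →
      (∀ z ∈ zs, z ∈ xs) → Inv k acc → Inv xs.length (zs.foldl F acc) := by
    intro zs
    induction zs with
    | nil =>
      intro k acc hk _ hi
      simp only [List.length_nil, add_zero] at hk
      simpa [hk] using hi
    | cons z zs ih =>
      intro k acc hk hz hi
      simp only [List.length_cons] at hk
      exact ih (k + 1) (F acc z) (by omega) (fun w hw => hz w (List.mem_cons_of_mem _ hw))
        (hstep k (by omega) z (hz z List.mem_cons_self) acc hi)
  exact key xs 0 y (by simp) (fun _ h => h) h0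

/-- A rational number in the unit interval with a denominator of bit length at most `y`. -/
structure UnitSize (y : ℕ) (x : ℚ) : Prop where
  nonneg : 0 ≤ x
  le_one : x ≤ 1
  denSize_le : denSize x ≤ y

namespace UnitSize

variable {x x' : ℚ} {y y' : ℕ}

theorem ratSize_le (h : UnitSize y x) : ratSize x ≤ 2 * y :=
  (ratSize_le_of_le_one h.nonneg h.le_one).trans (Nat.mul_le_mul_left 2 h.denSize_le)

theorem mono (h : UnitSize y x) (hy : y ≤ y') : UnitSize y' x :=
  ⟨h.nonneg, h.le_one, h.denSize_le.trans hy⟩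

theorem one_sub (h : UnitSize y x) : UnitSize y (1 - x) :=
  ⟨by linarith [h.le_one], by linarith [h.nonneg], (denSize_one_sub_le x).trans h.denSize_le⟩

theorem mul (h : UnitSize y x) (h' : UnitSize y' x') : UnitSize (y + y') (x * x') :=
  ⟨mul_nonneg h.nonneg h'.nonneg, mul_le_one₀ h.le_one h'.nonneg h'.le_one,
    (denSize_mul_le x x').trans (add_le_add h.denSize_le h'.denSize_le)⟩

end UnitSize

theorem unitSize_one : UnitSize 1 1 := ⟨zero_le_one, le_rfl, denSize_one.le⟩

theorem unitSize_zero {a : ℕ} (ha : 1 ≤ a) : UnitSize a 0 :=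
  ⟨le_rfl, zero_le_one, denSize_zero.le.trans ha⟩

/-- Invariant of the product in `weightL`. -/
theorem weightL_step {y k : ℕ} {x p : ℚ} (hx : UnitSize (1 + k * y) x) (hp : UnitSize y p) :
    UnitSize (1 + (k + 1) * y) (x * (1 - p)) :=
  (hx.mul hp.one_sub).mono (by rw [Nat.succ_mul]; omega)

theorem unitSize_weightL {p : Del → ℕ → ℕ → ℚ} {y : ℕ} (hp : ∀ D w j, UnitSize y (p D w j))
    (ns : List ℕ) (D : Del) (j : ℕ) : UnitSize (1 + ns.length * y) (weightL p ns D j) :=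
  List.foldl_invariant _ (fun k (acc : ℚ × Del) => UnitSize (1 + k * y) acc.1) ns _
    (by simpa using unitSize_one) fun _ _ _ _ _ hi => weightL_step hi (hp _ _ _)

/-- Invariant of the sums in `sumsL`, after `k` colors. -/
structure SumsInv (a k : ℕ) (acc : ℚ × ℚ) : Prop where
  unit : UnitSize a acc.2
  le : acc.2 ≤ acc.1
  le_card : acc.1 ≤ k
  denSize_le : denSize acc.1 ≤ 1 + k * a

namespace SumsInv

variable {a k : ℕ} {acc : ℚ × ℚ}

theorem zero (ha : 1 ≤ a) : SumsInv a 0 (0, 0) :=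
  ⟨unitSize_zero ha, le_rfl, by simp, by simp [denSize_zero]⟩

theorem step (h : SumsInv a k acc) {x : ℚ} (hx : UnitSize a x) (p : Prop) [Decidable p] :
    SumsInv a (k + 1) (acc.1 + x, if p then x else acc.2) := by
  have h0 := h.unit.nonneg
  have h1 := h.le
  have h2 := hx.nonneg
  have h3 := h.le_card
  have h4 := hx.le_one
  refine ⟨?_, ?_, ?_, ?_⟩
  · simp only
    split_ifs
    · exact hx
    · exact h.unit
  · simp only
    split_ifs <;> linarith
  · push_cast
    linarith
  · have := denSize_add_le acc.1 x
    have h5 := h.denSize_le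
    have h6 := hx.denSize_le
    simp only
    rw [Nat.succ_mul]
    omega

theorem nonneg (h : SumsInv a k acc) : 0 ≤ acc.1 := h.unit.nonneg.trans h.le

theorem ratSize_le (h : SumsInv a k acc) : ratSize acc.1 ≤ k + 2 * (1 + k * a) :=
  (ratSize_le_of_le h.nonneg h.le_card).trans
    (Nat.add_le_add_left (Nat.mul_le_mul_left 2 h.denSize_le) k)

theorem div (h : SumsInv a k acc) : UnitSize (a + (k + (1 + k * a) + 1)) (acc.2 / acc.1) := by
  refine ⟨div_nonneg h.unit.nonneg h.nonneg, div_le_one_of_le₀ h.le h.nonneg, ?_⟩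
  rw [div_eq_mul_inv]
  have h1 := denSize_mul_le acc.2 acc.1⁻¹
  have h2 := denSize_inv_le_of_le h.nonneg h.le_card
  have h3 := h.unit.denSize_le
  have h4 := h.denSize_le
  omega

end SumsInv

theorem sumsInv_sumsL {A : ℕ → ℚ} {a : ℕ} {cs : List ℕ} (ha : 1 ≤ a)
    (hA : ∀ j ∈ cs, UnitSize a (A j)) (i : ℕ) : SumsInv a cs.length (sumsL A cs i) :=
  List.foldl_invariant _ (SumsInv a) cs _ (.zero ha) fun _ _ u hu _ hi => hi.step (hA u hu) _

/-- Bound for the bit length of the denominator of the estimate of depth `k`. -/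
def denBound (κ : Cutoffs) (W k : ℕ) : ℕ :=
  (κ.p₁ + κ.q₁ + κ.p₂ + κ.q₂ + 3) * (4 * (W + 1) ^ 2) ^ (k + 1)

section DenBound

variable (κ : Cutoffs) (W k : ℕ)

theorem one_le_denBound : 1 ≤ denBound κ W k :=
  Nat.succ_le_of_lt (Nat.mul_pos (by omega) (by positivity))

theorem denBound_zero_ge : 2 * W + 3 ≤ denBound κ W 0 := by
  unfold denBound
  rw [zero_add, pow_one]
  calc 2 * W + 3 ≤ 1 * (4 * (W + 1) ^ 2) := by nlinarith
    _ ≤ _ := Nat.mul_le_mul_right _ (by omega)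

theorem denBound_succ : denBound κ W (k + 1) = denBound κ W k * (4 * (W + 1) ^ 2) := by
  unfold denBound
  rw [pow_succ _ (k + 1), ← mul_assoc]

theorem denBound_mono {k k' : ℕ} (h : k ≤ k') : denBound κ W k ≤ denBound κ W k' := by
  unfold denBound
  exact Nat.mul_le_mul_left _ (Nat.pow_le_pow_right (by positivity) (by omega))

theorem weight_le_denBound :
    (1 + W * denBound κ W k) * (W + 1) + W + 2 ≤ denBound κ W (k + 1) := by
  rw [denBound_succ]
  have := one_le_denBound κ W k
  nlinarith [Nat.zero_le (W * denBound κ W k), Nat.zero_le (W ^ 2 * denBound κ W k)]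

theorem cutoffs_le_denBound :
    κ.p₁ + κ.q₁ * W + κ.p₂ + κ.q₂ + 2 ≤ denBound κ W k := by
  refine le_trans ?_ (denBound_mono κ W (Nat.zero_le k))
  unfold denBound
  rw [zero_add, pow_one]
  calc κ.p₁ + κ.q₁ * W + κ.p₂ + κ.q₂ + 2 ≤ (κ.p₁ + κ.q₁ + κ.p₂ + κ.q₂ + 3) * (W + 1) := by
        nlinarith [Nat.zero_le (κ.p₁ * W), Nat.zero_le (κ.p₂ * W), Nat.zero_le (κ.q₂ * W)]
    _ ≤ _ := Nat.mul_le_mul_left _ (by nlinarith)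

end DenBound

theorem denSize_min_le {x x' : ℚ} {y : ℕ} (h : denSize x ≤ y) (h' : denSize x' ≤ y) :
    denSize (min x x') ≤ y := by
  rcases min_choice x x' with e | e <;> rw [e] <;> assumption

theorem ratSize_min_le {x x' : ℚ} {y : ℕ} (h : ratSize x ≤ y) (h' : ratSize x' ≤ y) :
    ratSize (min x x') ≤ y := by
  rcases min_choice x x' with e | e <;> rw [e] <;> assumption

theorem ratSize_natCast_div_le (p q : ℕ) : ratSize ((p : ℚ) / (q : ℚ)) ≤ p + q + 2 := by
  have h := ratSize_div_le (p : ℚ) q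
  have h1 := Nat.size_le_self p
  have h2 := Nat.size_le_self q
  have e : ∀ n : ℕ, ratSize (n : ℚ) = Nat.size n + 1 := fun n => by simp [ratSize]
  rw [e, e] at h
  omega

theorem SmallData.weight_bound {W M : ℕ} {g : Data} (hg : SmallData W M g) {κ : Cutoffs} {d : ℕ}
    {p : Del → ℕ → ℕ → ℚ} (hp : ∀ D w j, UnitSize (denBound κ W d) (p D w j)) (D D' : Del)
    (v j : ℕ) : UnitSize (1 + W * denBound κ W d) (weightL p (nbrList g D v) D' j) :=
  (unitSize_weightL hp _ _ _).mono
    (Nat.add_le_add_left (Nat.mul_le_mul_right _ (hg.length_nbrList_le D v)) 1)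

theorem SumsInv.div_le {a k W y : ℕ} {acc : ℚ × ℚ} (h : SumsInv a k acc) (hk : k ≤ W)
    (hy : a * (W + 1) + W + 2 ≤ y) : UnitSize y (acc.2 / acc.1) := by
  refine h.div.mono ?_
  have : k * a ≤ W * a := Nat.mul_le_mul_right a hk
  have e : a * (W + 1) = W * a + a := by ring
  omega

theorem unitSize_phiL (κ : Cutoffs) {W M : ℕ} {g : Data} (hg : SmallData W M g) (d : ℕ) :
    ∀ D v i, UnitSize (denBound κ W d) (phiL κ g d D v i) := by
  induction d with
  | zero =>
    intro D v i
    rw [phiL]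
    refine SumsInv.div_le (sumsInv_sumsL le_rfl (fun _ _ => unitSize_one) i)
      (hg.length_colList_le D v) ?_
    have := denBound_zero_ge κ W
    omega
  | succ d ih =>
    intro D v i
    have hr : UnitSize (denBound κ W (d + 1))
        (ratioL (weightL (phiL κ g d) (nbrList g D v) ((0, v) :: D)) (colList g D v) i) :=
      SumsInv.div_le (sumsInv_sumsL (by omega) (fun j _ => hg.weight_bound ih D _ v j) i)
        (hg.length_colList_le D v) (weight_le_denBound κ W d)
    rw [phiL]
    split_ifs with h
    · refine ⟨?_, (min_le_right _ _).trans hr.le_one, ?_⟩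
      · exact le_min (le_min (by positivity) (by positivity)) hr.nonneg
      · have hc := cutoffs_le_denBound κ W (d + 1)
        have hm : κ.q₁ * (nbrList g D v).length ≤ κ.q₁ * W :=
          Nat.mul_le_mul_left _ (hg.length_nbrList_le D v)
        refine denSize_min_le (denSize_min_le ?_ ?_) hr.denSize_le
        · exact (denSize_natCast_div_le _ _).trans (by omega)
        · exact (denSize_natCast_div_le _ _).trans (by omega)
    · exact hr

/-! ### The program for the estimates -/

section Terms

variable {Φ : List (Ty × Ty)} {Γ : List Ty} {a b c a' b' c' d' : Ty}

/-- The variable below six binders. -/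
def x6 : Tm Φ (d' :: c' :: b' :: a' :: c :: b :: a :: Γ) a :=
  .var (.there (.there (.there (.there (.there (.there .here))))))

theorem Runs.x6 {f : FEnv Φ} {e : Env Γ} {u : a.Val} {u1 : b.Val} {u2 : c.Val} {u3 : a'.Val}
    {u4 : b'.Val} {u5 : c'.Val} {u6 : d'.Val} :
    Runs ((x6 : Tm Φ (d' :: c' :: b' :: a' :: c :: b :: a :: Γ) a).run f
      (u6, u5, u4, u3, u2, u1, u, e)) u 1 :=
  ⟨rfl, le_rfl⟩

/-- The rational number `1`. -/
def oneTm : Tm Φ Γ .rat := .prim .ratOf (.pair (.lit 1) (.lit 1))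

/-- The rational number `0`. -/
def zeroTm : Tm Φ Γ .rat := .prim .ratOf (.pair (.lit 0) (.lit 1))

/-- The normalized weight of a color, where `A` computes the weights. The innermost variables are
a list of neighbors and the arguments of the estimate. -/
def ratioTm (A : Tm Φ (.nat :: .prod .rat .rat :: .list .nat :: .list .nat :: argTy :: Γ) .rat) :
    Tm Φ (.list .nat :: argTy :: Γ) .rat :=
  .bind (.bind x1 colsTm)
    (.bind (.foldl x0 (.pair zeroTm zeroTm)
      (.bind A (.pair (.prim .ratAdd (.pair (.fst x2) x0))
        (.ite (.prim .natEq (.pair x1 (.snd (.snd (.snd x5))))) x0 (.snd x2)))))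
      (.prim .ratDiv (.pair (.snd x0) (.fst x0))))

/-- The weight of a color, by calls of the estimate of smaller depth. -/
def weightTm : Tm ((argTy, .rat) :: Φ)
    (.nat :: .prod .rat .rat :: .list .nat :: .list .nat :: argTy :: Γ) .rat :=
  .fst (.foldl x3 (.pair oneTm (.cons (.pair (.lit 0) (.fst (.snd (.snd x4)))) (.fst (.snd x4))))
    (.pair
      (.prim .ratMul (.pair (.fst x1) (.prim .ratSub (.pair oneTm
        (.call .here (.pair (.fst x6) (.pair (.snd x1) (.pair x0 x2))))))))
      (.cons (.pair (.prim .natAdd (.pair x0 (.lit 1))) x2) (.snd x1))))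

/-- The estimate of depth `0`. -/
def baseTm : Tm Φ (argTy :: Γ) .rat := .bind .nil (ratioTm oneTm)

/-- The estimate of positive depth. -/
def stepTm (κ : Cutoffs) : Tm ((argTy, .rat) :: Φ) (argTy :: Γ) .rat :=
  .bind nbrsTm (.bind (ratioTm weightTm) (.bind (.bind x1 lenTm)
    (.ite x0
      (.bind (.pair
        (.bind (.pair (.prim .ratOf (.pair (.lit κ.p₁) (.prim .natMul (.pair (.lit κ.q₁) x0))))
          (.prim .ratOf (.pair (.lit κ.p₂) (.lit κ.q₂)))) minTm) x1) minTm)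
      x1)))

end Terms

/-- Cost bound for a normalized weight, if weights cost `C`. -/
def ratioCost (M W R C : ℕ) : ℕ :=
  listCost M + 2 * opCost M + opCost R + 35 + W * (C + opCost R + opCost M + 25)

/-- Cost bound for a weight, if calls cost `C`. -/
def weightCost (M W R C : ℕ) : ℕ :=
  opCost M + 25 + W * (C + 2 * opCost R + 2 * opCost M + 40)

section Costs

variable {Φ : List (Ty × Ty)} {Γ : List Ty} {f : FEnv Φ} {e : Env Γ} {M W R : ℕ}

theorem runs_oneTm (hM : 1 ≤ M) : Runs ((oneTm : Tm Φ Γ .rat).run f e) (1 : ℚ) (opCost M + 5) :=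
  ((Runs.ratOf M (.pair (.lit 1) (.lit 1)) hM hM).congr (by simp)).mono (by omega)

theorem runs_zeroTm (hM : 1 ≤ M) : Runs ((zeroTm : Tm Φ Γ .rat).run f e) (0 : ℚ) (opCost M + 4) :=
  ((Runs.ratOf M (.pair (.lit 0) (.lit 1)) (Nat.zero_le _) hM).congr (by simp)).mono (by omega)

theorem runs_ratioTm
    {A : Tm Φ (.nat :: .prod .rat .rat :: .list .nat :: .list .nat :: argTy :: Γ) .rat}
    {Aval : ℕ → ℚ} {a C v i : ℕ} {g : Data} {D : Del} {ns : List ℕ} (hg : SmallData W M g)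
    (hW : W ≤ M) (hv : v + 1 ≤ M) (hi : i ≤ M) (hD : SmallDel M D) (hDl : D.length ≤ M)
    (ha : 1 ≤ a) (hu : ∀ j, UnitSize a (Aval j)) (hR : W + 2 * (1 + W * a) ≤ R) (haR : 2 * a ≤ R)
    (hA : ∀ j ∈ colList g D v, ∀ acc : ℚ × ℚ, Runs (A.run f
      (j, acc, colList g D v, ns, (g, D, v, i), e)) (Aval j) C) :
    Runs ((ratioTm A).run f (ns, (g, D, v, i), e)) (ratioL Aval (colList g D v) i)
      (ratioCost M W R C) := by
  have hM : 1 ≤ M := by omega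
  have hlen := hg.length_colList_le D v
  have hsum : ∀ k acc, k ≤ W → SumsInv a k acc → ratSize acc.1 ≤ R := by
    intro k acc hk h
    refine h.ratSize_le.trans (le_trans ?_ hR)
    have : k * a ≤ W * a := Nat.mul_le_mul_right a hk
    omega
  have hfold := Runs.foldl (f := f) (e := (colList g D v, ns, (g, D, v, i), e)) (a := .nat)
    (b := .prod .rat .rat) (xs := colList g D v) (l := x0) (s := .pair zeroTm zeroTm)
    (body := .bind A (.pair (.prim .ratAdd (.pair (.fst x2) x0))
        (.ite (.prim .natEq (.pair x1 (.snd (.snd (.snd x5))))) x0 (.snd x2))))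
    (C := C + opCost R + opCost M + 24)
    (fun (acc : ℚ × ℚ) j => (acc.1 + Aval j, if j = i then Aval j else acc.2))
    (SumsInv a) .x0 (.pair (runs_zeroTm hM) (runs_zeroTm hM)) (.zero ha)
    (fun k hk j hj acc hacc => by
      refine ⟨Runs.mono (Runs.bind (hA j hj acc) (.pair (.ratAdd R (.pair (.fst .x2) .x0) ?_ ?_)
        (Runs.iteEq M (.pair .x1 (.snd (.snd (.snd .x5)))) (hg.colList_le hj) hi
          (fun _ => Runs.mono .x0 (by omega)) (fun _ => .snd .x2)))) (by omega),
        hacc.step (hu j) _⟩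
      · exact hsum k acc (by omega) hacc
      · exact (hu j).ratSize_le.trans haR)
  refine Runs.mono (Runs.bind (.bind .x1 (runs_colsTm hg hW hv hD hDl))
    (.bind hfold.1 (.ratDiv R (.pair (.snd .x0) (.fst .x0)) ?_ ?_))) ?_
  · exact hfold.2.unit.ratSize_le.trans haR
  · exact hsum _ _ hlen hfold.2
  · have : (colList g D v).length * (C + opCost R + opCost M + 24 + 1) ≤
        W * (C + opCost R + opCost M + 25) := Nat.mul_le_mul hlen le_rfl
    unfold ratioCost
    omega

theorem runs_weightTm {p : Del → ℕ → ℕ → ℚ} {h : argTy.Val → ℚ × ℕ} {y C v i j : ℕ} {g : Data}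
    {D : Del} {acc₀ : ℚ × ℚ} {cs : List ℕ} (hg : SmallData W M g)
    (hv : v + 1 ≤ M) (hj : j ≤ M) (hD : SmallDel M D) (hp : ∀ D w j, UnitSize y (p D w j))
    (hR : 2 * (1 + W * y) ≤ R) (hyR : 2 * y ≤ R)
    (hcall : ∀ D' w, SmallDel M D' → D'.length ≤ D.length + W + 1 → w + 1 ≤ M →
      Runs (h (g, D', w, j)) (p D' w j) C) :
    Runs ((weightTm : Tm ((argTy, .rat) :: Φ)
      (.nat :: .prod .rat .rat :: .list .nat :: .list .nat :: argTy :: Γ) .rat).run (h, f)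
      (j, acc₀, cs, nbrList g D v, (g, D, v, i), e))
      (weightL p (nbrList g D v) ((0, v) :: D) j) (weightCost M W R C) := by
  have hM : 1 ≤ M := by omega
  have hlen := hg.length_nbrList_le D v
  have hfold := Runs.foldl (Φ := (argTy, .rat) :: Φ) (f := (h, f))
    (e := (j, acc₀, cs, nbrList g D v, (g, D, v, i), e)) (a := .nat)
    (Γ := .nat :: .prod .rat .rat :: .list .nat :: .list .nat :: argTy :: Γ)
    (b := .prod .rat delTy) (xs := nbrList g D v) (l := x3)
    (s := .pair oneTm (.cons (.pair (.lit 0) (.fst (.snd (.snd x4)))) (.fst (.snd x4))))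
    (body := .pair
      (.prim .ratMul (.pair (.fst x1) (.prim .ratSub (.pair oneTm
        (.call .here (.pair (.fst x6) (.pair (.snd x1) (.pair x0 x2))))))))
      (.cons (.pair (.prim .natAdd (.pair x0 (.lit 1))) x2) (.snd x1)))
    (C := C + 2 * opCost R + 2 * opCost M + 39)
    (fun (acc : ℚ × Del) w => (acc.1 * (1 - p acc.2 w j), (w + 1, j) :: acc.2))
    (fun k acc => UnitSize (1 + k * y) acc.1 ∧ SmallDel M acc.2 ∧ acc.2.length = D.length + 1 + k)
    .x3 (.pair (runs_oneTm hM) (.cons (.pair (.lit 0) (.fst (.snd (.snd .x4)))) (.fst (.snd .x4))))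
    ⟨by simpa using unitSize_one, hD.cons (Nat.zero_le _) (by simpa using by omega), by simp⟩
    (fun k hk w hw acc hacc => by
      obtain ⟨h1, h2, h3⟩ := hacc
      have hwM := hg.nbrList_le hw
      have hk' : k * y ≤ W * y := Nat.mul_le_mul_right y (by omega)
      refine ⟨Runs.mono (Runs.pair (.ratMul R (.pair (.fst .x1) (.ratSub R (.pair (runs_oneTm hM)
        (Runs.call (.pair (.fst .x6) (.pair (.snd .x1) (.pair .x0 .x2)))
          (hcall acc.2 w h2 (by omega) hwM))) ?_ ?_)) ?_ ?_)
        (.cons (.pair (.natAdd M (.pair .x0 (.lit 1)) (by omega) hM) .x2) (.snd .x1)))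
        (by omega), weightL_step h1 (hp _ _ _), h2.cons hwM hj, ?_⟩
      · exact unitSize_one.ratSize_le.trans (by omega)
      · exact (hp _ _ _).ratSize_le.trans hyR
      · exact h1.ratSize_le.trans (by omega)
      · exact (hp _ _ _).one_sub.ratSize_le.trans hyR
      · simp only [List.length_cons]; omega)
  refine (Runs.fst hfold.1).mono ?_
  have : (nbrList g D v).length * (C + 2 * opCost R + 2 * opCost M + 39 + 1) ≤
      W * (C + 2 * opCost R + 2 * opCost M + 40) := Nat.mul_le_mul hlen le_rfl
  unfold weightCost
  omega

end Costs

/-- Cost bound for the estimate of depth `k`. -/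
def phiCost (κ : Cutoffs) (M W : ℕ) : ℕ → ℕ
  | 0 => ratioCost M W (2 * denBound κ W 0) (opCost M + 5) + 5
  | k + 1 => listCost M + lenCost M + 4 * opCost M + 4 * opCost (2 * denBound κ W (k + 1)) +
      M + 80 + ratioCost M W (2 * denBound κ W (k + 1))
        (weightCost M W (2 * denBound κ W (k + 1)) (phiCost κ M W k))

/-- Admissible arguments of a call of depth `k`: each level deletes at most `W + 1` items more. -/
structure CallOk (M W : ℕ) (g : Data) (k : ℕ) (u : Data × Del × ℕ × ℕ) : Prop where
  data : u.1 = g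
  del : SmallDel M u.2.1
  length : u.2.1.length + k * (W + 1) ≤ M
  node : u.2.2.1 + 1 ≤ M
  color : u.2.2.2 ≤ M

section Costs

variable {Φ : List (Ty × Ty)} {Γ : List Ty} {f : FEnv Φ} {e : Env Γ} {M W : ℕ} {g : Data}
  {κ : Cutoffs}

theorem runs_baseTm (hg : SmallData W M g) (hW : W ≤ M) {u : Data × Del × ℕ × ℕ}
    (hu : CallOk M W g 0 u) :
    Runs ((baseTm : Tm Φ (argTy :: Γ) .rat).run f (u, e)) (phiL κ g 0 u.2.1 u.2.2.1 u.2.2.2)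
      (phiCost κ M W 0) := by
  obtain ⟨g', D, v, i⟩ := u
  obtain ⟨h1, h2, h3, h4, h5⟩ := hu
  simp only at h1 h2 h3 h4 h5
  subst h1
  have hM : 1 ≤ M := by omega
  have hb := denBound_zero_ge κ W
  refine Runs.mono (Runs.bind .nil (runs_ratioTm hg hW h4 h5 h2 (by omega) le_rfl
    (fun _ => unitSize_one) (R := 2 * denBound κ W 0) (by omega) (by omega)
    (fun j _ acc => runs_oneTm hM))) ?_
  unfold phiCost
  omega

theorem runs_stepTm (hg : SmallData W M g) (hW : W ≤ M)
    (hκ : κ.p₁ + κ.q₁ * (W + 1) + κ.p₂ + κ.q₂ ≤ M) {k : ℕ} {h : Data × Del × ℕ × ℕ → ℚ × ℕ}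
    (hcall : ∀ u, CallOk M W g k u → Runs (h u) (phiL κ g k u.2.1 u.2.2.1 u.2.2.2)
      (phiCost κ M W k)) {u : Data × Del × ℕ × ℕ} (hu : CallOk M W g (k + 1) u) :
    Runs ((stepTm κ : Tm ((argTy, .rat) :: Φ) (argTy :: Γ) .rat).run (h, f) (u, e))
      (phiL κ g (k + 1) u.2.1 u.2.2.1 u.2.2.2) (phiCost κ M W (k + 1)) := by
  obtain ⟨g', D, v, i⟩ := u
  obtain ⟨h1, h2, h3, h4, h5⟩ := hu
  simp only at h1 h2 h3 h4 h5
  subst h1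
  have hM : 1 ≤ M := by omega
  rw [Nat.succ_mul] at h3
  have hnl := hg.length_nbrList_le D v
  have hw := weight_le_denBound κ W k
  have hmul : (1 + W * denBound κ W k) * (W + 1) =
    W * (1 + W * denBound κ W k) + (1 + W * denBound κ W k) := by ring
  have h1y := one_le_denBound κ W k
  have hyy := denBound_mono κ W (Nat.le_succ k)
  have hc := cutoffs_le_denBound κ W (k + 1)
  set Y := denBound κ W (k + 1) with hY
  have hq : κ.q₁ * (nbrList g' D v).length ≤ κ.q₁ * W := Nat.mul_le_mul_left _ hnl
  have hqW : κ.q₁ * (W + 1) = κ.q₁ * W + κ.q₁ := by ring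
  have hA := hg.weight_bound (unitSize_phiL κ hg k) D ((0, v) :: D) v
  have hr : UnitSize Y (ratioL (weightL (phiL κ g' k) (nbrList g' D v) ((0, v) :: D))
      (colList g' D v) i) :=
    SumsInv.div_le (sumsInv_sumsL (by omega) (fun j _ => hA j) i) (hg.length_colList_le D v) hw
  have hratio := runs_ratioTm (Φ := (argTy, .rat) :: Φ) (f := (h, f)) (e := e) (A := weightTm)
    (Aval := weightL (phiL κ g' k) (nbrList g' D v) ((0, v) :: D))
    (a := 1 + W * denBound κ W k) (ns := nbrList g' D v) (R := 2 * Y)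
    (C := weightCost M W (2 * Y) (phiCost κ M W k)) hg hW h4 h5 h2 (by omega)
    (by omega) hA (by omega) (by omega)
    (fun j hj acc => runs_weightTm hg h4 (hg.colList_le hj) h2 (unitSize_phiL κ hg k)
      (by omega) (by omega) (fun D' w hD' hl hw' => hcall (g', D', w, j)
        ⟨rfl, hD', by simp only; omega, hw', hg.colList_le hj⟩))
  have hs1 := ratSize_natCast_div_le κ.p₁ (κ.q₁ * (nbrList g' D v).length)
  have hs2 := ratSize_natCast_div_le κ.p₂ κ.q₂
  refine Runs.mono (Runs.bind (runs_nbrsTm hg hW h4 h2 (by omega)) (.bind hratio (.bind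
    (.bind .x1 (runs_lenTm hM (hnl.trans hW)))
    (Runs.ite .x0 Iff.rfl
      (fun _ => Runs.bind (.pair (.bind (.pair
        (.ratOf M (.pair (.lit κ.p₁) (.natMul M (.pair (.lit κ.q₁) .x0) ?_ ?_)) ?_ ?_)
        (.ratOf M (.pair (.lit κ.p₂) (.lit κ.q₂)) ?_ ?_))
        (runs_minTm (R := 2 * Y) ?_ ?_)) .x1) (runs_minTm (R := 2 * Y) ?_ ?_))
      (fun _ => Runs.mono .x1 (by omega)))))) ?_
  · omega
  · exact hnl.trans hW
  · omega
  · omega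
  · omega
  · omega
  · exact hs1.trans (by omega)
  · exact hs2.trans (by omega)
  · exact ratSize_min_le (hs1.trans (by omega)) (hs2.trans (by omega))
  · exact hr.ratSize_le
  · rw [phiCost, ← hY]
    omega

end Costs

/-! ### The main program -/

section Terms

variable {Φ : List (Ty × Ty)} {Γ : List Ty}

/-- The maximum of two natural numbers. -/
def maxTm : Tm Φ (pairTy :: Γ) .nat := .ite (.prim .natLe x0) (.snd x0) (.fst x0)

/-- The number of edges, counted at their smaller ends. -/
def edgesTm : Tm Φ (.list rowTy :: Γ) .nat :=
  .snd (.foldl x0 (.pair (.lit 0) (.lit 0))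
    (.pair (.prim .natAdd (.pair (.fst x1) (.lit 1)))
      (.foldl (.fst x0) (.snd x1)
        (.ite (.prim .natLe (.pair x0 (.fst x3))) x1 (.prim .natAdd (.pair x1 (.lit 1)))))))

/-- The depth of the recursion. -/
def depthTm (K : ℕ) : Tm Φ (inputTy :: Γ) .nat :=
  .prim .natMul (.pair (.lit K) (.prim .natBits (.prim .natAdd (.pair
    (.bind (.pair (.bind (.snd (.fst x0)) lenTm)
      (.bind (.pair (.bind (.snd (.fst x0)) edgesTm) (.fst (.fst x0))) maxTm)) maxTm)
    (.snd x0)))))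

/-- CountCOLOR; every round treats the next node and the first color of its list. -/
def countTm (κ : Cutoffs) (K : ℕ) : Tm Φ (inputTy :: Γ) .rat :=
  .bind (depthTm K) (.snd (.snd (.foldl (.snd (.fst x1)) (.pair (.lit 0) (.pair .nil oneTm))
    (.bind (.pair (.snd (.fst x3)) (.pair (.fst (.snd x1)) (.pair (.fst x1) (.lit 0))))
      (.bind (.foldr (.bind x0 colsTm) (.lit 0) x0)
        (.pair (.prim .natAdd (.pair (.fst x3) (.lit 1)))
          (.pair
            (.foldl (.bind x1 nbrsTm) (.cons (.pair (.lit 0) (.fst x3)) (.fst (.snd x3)))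
              (.cons (.pair (.prim .natAdd (.pair x0 (.lit 1))) x2) x1))
            (.prim .ratDiv (.pair (.snd (.snd x3))
              (.recur x4 (.pair (.fst x1) (.pair (.fst (.snd x1)) (.pair (.fst x3) x0)))
                baseTm (stepTm κ)))))))))))

end Terms

/-- The number of edges, counted at their smaller ends. -/
def edgesL (g : Data) : ℕ :=
  (g.foldl (fun (acc : ℕ × ℕ) row => (acc.1 + 1,
    row.1.foldl (fun c u => if u ≤ acc.1 then c else c + 1) acc.2)) (0, 0)).2

/-- One round of CountCOLOR. The state consists of the next node, the deletions and the current
product. -/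
def roundL (κ : Cutoffs) (g : Data) (d : ℕ) (acc : ℕ × Del × ℚ) : ℕ × Del × ℚ :=
  (acc.1 + 1,
    (nbrList g acc.2.1 acc.1).foldl
      (fun D w => (w + 1, (colList g acc.2.1 acc.1).headD 0) :: D) ((0, acc.1) :: acc.2.1),
    acc.2.2 / phiL κ g d acc.2.1 acc.1 ((colList g acc.2.1 acc.1).headD 0))

/-- CountCOLOR with depth `d`, treating the nodes in their order. -/
def countL (κ : Cutoffs) (g : Data) (d : ℕ) : ℚ :=
  (g.foldl (fun acc _ => roundL κ g d acc) (0, [], 1)).2.2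

/-- Cost bound for the computation of the depth. -/
def depthCost (K M : ℕ) : ℕ :=
  lenCost M + 5 * opCost M + K + 60 + (M * (opCost M + 20 + M * (2 * opCost M + 15)))

/-- Bound for the bit length of the product after all rounds. -/
def prodBound (κ : Cutoffs) (M W d : ℕ) : ℕ := 2 + M * (2 * denBound κ W d)

/-- Cost bound for CountCOLOR. -/
def countCost (κ : Cutoffs) (K M W d : ℕ) : ℕ :=
  depthCost K M + opCost M + 30 + M * (2 * listCost M + opCost M +
    M * (opCost M + 20) + phiCost κ M W d + opCost (prodBound κ M W d) + d + 80)

section Costs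

variable {Φ : List (Ty × Ty)} {Γ : List Ty} {f : FEnv Φ} {e : Env Γ} {M W : ℕ} {g : Data}
  {κ : Cutoffs}

theorem runs_maxTm {x y : ℕ} (hx : x ≤ M) (hy : y ≤ M) :
    Runs ((maxTm : Tm Φ (pairTy :: Γ) .nat).run f ((x, y), e)) (max x y) (opCost M + 4) :=
  ((Runs.iteLe M .x0 hx hy (fun _ => Runs.snd .x0) (fun _ => Runs.fst .x0)).congr
    (max_def x y).symm).mono (by omega)

theorem runs_edgesTm (hg : SmallData W M g) (hW : W ≤ M) (hM : 1 ≤ M)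
    (hgW : g.length * (W + 1) ≤ M) :
    Runs ((edgesTm : Tm Φ (.list rowTy :: Γ) .nat).run f (g, e)) (edgesL g)
      (M * (opCost M + 20 + M * (2 * opCost M + 15)) + 10) ∧ edgesL g ≤ M := by
  have h := Runs.foldl (f := f) (e := (g, e)) (Γ := .list rowTy :: Γ) (a := rowTy) (b := pairTy)
    (xs := g) (l := x0)
    (s := .pair (.lit 0) (.lit 0))
    (body := .pair (.prim .natAdd (.pair (.fst x1) (.lit 1)))
      (.foldl (.fst x0) (.snd x1)
        (.ite (.prim .natLe (.pair x0 (.fst x3))) x1 (.prim .natAdd (.pair x1 (.lit 1))))))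
    (C := opCost M + 19 + M * (2 * opCost M + 15))
    (fun (acc : ℕ × ℕ) row => (acc.1 + 1,
      row.1.foldl (fun c u => if u ≤ acc.1 then c else c + 1) acc.2))
    (fun k (acc : ℕ × ℕ) => acc.1 = k ∧ acc.2 ≤ k * W) .x0 (.pair (.lit 0) (.lit 0)) ⟨rfl, by simp⟩
    (fun k hk (row : List ℕ × List ℕ) hrow (acc : ℕ × ℕ) hacc => by
      obtain ⟨h1, h2⟩ := hacc
      have hk' : k + 1 ≤ g.length := hk
      have hkW : (k + 1) * (W + 1) ≤ M := (Nat.mul_le_mul_right _ hk').trans hgW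
      have hexp : (k + 1) * (W + 1) = k * W + W + k + 1 := by ring
      have hrl := hg.nbrs_length row hrow
      have hin := Runs.foldl (f := f) (Γ := rowTy :: pairTy :: .list rowTy :: Γ)
        (e := (row, acc, g, e)) (a := .nat) (b := .nat)
        (xs := row.1) (l := .fst x0) (s := .snd x1)
        (body := .ite (.prim .natLe (.pair x0 (.fst x3))) x1 (.prim .natAdd (.pair x1 (.lit 1))))
        (C := 2 * opCost M + 14) (fun (c : ℕ) u => if u ≤ acc.1 then c else c + 1)
        (fun j (c : ℕ) => c ≤ acc.2 + j) (.fst .x0) (.snd .x1) le_rfl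
        (fun j hj (u : ℕ) hu (c : ℕ) hc => by
          have hu' := hg.nbrs_le row hrow u hu
          refine ⟨Runs.mono (Runs.iteLe M (.pair .x0 (.fst .x3)) (by omega) (by omega)
            (fun _ => Runs.mono .x1 (T' := opCost M + 5) (by omega))
            (fun _ => Runs.mono (Runs.natAdd M (.pair .x1 (.lit 1)) (by omega) hM) (by omega)))
            (by omega), ?_⟩
          split_ifs <;> omega)
      refine ⟨(Runs.pair (.natAdd M (.pair (.fst .x1) (.lit 1)) (by omega) hM) hin.1).mono ?_,
        by simp [h1], ?_⟩
      · have : row.1.length * (2 * opCost M + 14 + 1) ≤ M * (2 * opCost M + 15) :=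
          Nat.mul_le_mul (hrl.trans hW) le_rfl
        omega
      · have h3 : row.1.foldl (fun c u => if u ≤ acc.1 then c else c + 1) acc.2 ≤
          acc.2 + row.1.length := hin.2
        rw [Nat.succ_mul]
        change row.1.foldl (fun c u => if u ≤ acc.1 then c else c + 1) acc.2 ≤ _
        omega)
  refine ⟨(Runs.snd h.1).mono ?_, h.2.2.trans ?_⟩
  · have : g.length * (opCost M + 19 + M * (2 * opCost M + 15) + 1) ≤
        M * (opCost M + 20 + M * (2 * opCost M + 15)) :=
      Nat.mul_le_mul hg.length_le (by omega)
    omega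
  · refine le_trans (Nat.mul_le_mul_left _ (Nat.le_succ W)) hgW

theorem runs_depthTm {K q r : ℕ} (hg : SmallData W M g) (hW : W ≤ M) (hM : 1 ≤ M)
    (hgW : g.length * (W + 1) ≤ M) (hq : q ≤ M) (hr : r ≤ M) (hK : K ≤ M)
    (hn : max g.length (max (edgesL g) q) + r ≤ M) :
    Runs ((depthTm K : Tm Φ (inputTy :: Γ) .nat).run f (((q, g), r), e))
      (K * Nat.size (max g.length (max (edgesL g) q) + r)) (depthCost K M) := by
  obtain ⟨he, heM⟩ := runs_edgesTm (Φ := Φ) (Γ := inputTy :: Γ) (f := f)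
    (e := (((q, g), r), e)) hg hW hM hgW
  have hs := Nat.size_le_self (max g.length (max (edgesL g) q) + r)
  have hmax : max (edgesL g) q ≤ M := max_le heM hq
  refine Runs.mono (Runs.natMul M (.pair (.lit K) (Runs.prim (op := .natBits) (B := 2 * M)
    (.natAdd M (.pair
    (.bind (.pair (.bind (.snd (.fst .x0)) (runs_lenTm hM hg.length_le))
      (.bind (.pair (.bind (.snd (.fst .x0)) he) (.fst (.fst .x0))) (runs_maxTm heM hq)))
      (runs_maxTm hg.length_le hmax)) (.snd .x0)) (max_le hg.length_le hmax) hr) ?_)) hK ?_) ?_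
  · simp only [Ty.bits]; omega
  · exact hs.trans hn
  · unfold depthCost
    have : (1 + 2 * M) ^ 2 = opCost M := rfl
    rw [this]
    omega

theorem foldr_head_eq (l : List ℕ) (z : ℕ) : l.foldr (fun u _ => u) z = l.headD z := by
  cases l <;> rfl

/-- The program computes `countL`. The invariant of the rounds: after `k` nodes there are at most
`k (W + 1)` deletions, and every round adds at most the size of one estimate to the product. -/
theorem runs_countTm {K q r d : ℕ} (hg : SmallData W M g) (hW : W ≤ M) (hM : 1 ≤ M)
    (hd : d = K * Nat.size (max g.length (max (edgesL g) q) + r))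
    (hgW : (g.length + d) * (W + 1) ≤ M) (hq : q ≤ M) (hr : r ≤ M) (hK : K ≤ M)
    (hn : max g.length (max (edgesL g) q) + r ≤ M)
    (hκ : κ.p₁ + κ.q₁ * (W + 1) + κ.p₂ + κ.q₂ ≤ M) :
    Runs ((countTm κ K : Tm Φ (inputTy :: Γ) .rat).run f (((q, g), r), e))
      (countL κ g d) (countCost κ K M W d) := by
  rw [Nat.add_mul] at hgW
  have hdep := runs_depthTm (Φ := Φ) (f := f) (e := e) hg hW hM (by omega) hq hr hK hn
  rw [← hd] at hdep
  have h := Runs.foldl (f := f) (e := (d, ((q, g), r), e)) (Γ := .nat :: inputTy :: Γ) (a := rowTy)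
    (b := .prod .nat (.prod delTy .rat)) (xs := g) (l := .snd (.fst x1))
    (s := .pair (.lit 0) (.pair .nil oneTm))
    (body := .bind (.pair (.snd (.fst x3)) (.pair (.fst (.snd x1)) (.pair (.fst x1) (.lit 0))))
      (.bind (.foldr (.bind x0 colsTm) (.lit 0) x0)
        (.pair (.prim .natAdd (.pair (.fst x3) (.lit 1)))
          (.pair
            (.foldl (.bind x1 nbrsTm) (.cons (.pair (.lit 0) (.fst x3)) (.fst (.snd x3)))
              (.cons (.pair (.prim .natAdd (.pair x0 (.lit 1))) x2) x1))
            (.prim .ratDiv (.pair (.snd (.snd x3))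
              (.recur x4 (.pair (.fst x1) (.pair (.fst (.snd x1)) (.pair (.fst x3) x0)))
                baseTm (stepTm κ))))))))
    (C := 2 * listCost M + opCost M + M * (opCost M + 20) + phiCost κ M W d +
      opCost (prodBound κ M W d) + d + 79)
    (fun (acc : ℕ × Del × ℚ) _ => roundL κ g d acc)
    (fun k (acc : ℕ × Del × ℚ) => acc.1 = k ∧ SmallDel M acc.2.1 ∧ acc.2.1.length ≤ k * (W + 1) ∧
      ratSize acc.2.2 ≤ 2 + k * (2 * denBound κ W d))
    (.snd (.fst .x1)) (.pair (.lit 0) (.pair .nil (runs_oneTm hM)))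
    ⟨rfl, by intro p hp; simp at hp, by simp, by
      have := unitSize_one.ratSize_le
      simpa using this⟩
    (fun k hk row hrow (acc : ℕ × Del × ℚ) hacc => by
      obtain ⟨v, D, z⟩ := acc
      obtain ⟨h1, h2, h3, h4⟩ := hacc
      simp only at h1 h2 h3 h4
      subst h1
      have hk' : v + 1 ≤ g.length := hk
      have hgM := hg.length_le
      have hkW := Nat.mul_le_mul_right (W + 1) hk'
      rw [Nat.succ_mul] at hkW
      have hvM : v + 1 ≤ M := hk'.trans hgM
      set i := (colList g D v).headD 0 with hi
      have hiM : i ≤ M := by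
        rw [hi]
        cases hc : colList g D v with
        | nil => exact Nat.zero_le _
        | cons c cs => exact hg.colList_le (D := D) (v := v) (by rw [hc]; exact List.mem_cons_self)
      have hcl := hg.length_colList_le D v
      have hnl := hg.length_nbrList_le D v
      have hφ := unitSize_phiL κ hg d D v i
      have hcol : ∀ e' : Env Γ, Runs ((Tm.foldr (.bind x0 colsTm) (.lit 0) x0 :
          Tm Φ (argTy :: rowTy :: .prod .nat (.prod delTy .rat) :: .nat :: inputTy :: Γ) .nat).run f
          ((g, D, v, 0), row, (v, D, z), d, ((q, g), r), e')) i
          (listCost M + M * 2 + 4) := fun e' => by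
        have := Runs.foldr (f := f)
          (Γ := argTy :: rowTy :: .prod .nat (.prod delTy .rat) :: .nat :: inputTy :: Γ)
          (e := ((g, D, v, 0), row, (v, D, z), d, ((q, g), r), e'))
          (a := .nat) (b := .nat) (xs := colList g D v) (l := .bind x0 colsTm) (s := .lit 0)
          (body := x0) (C := 1) (fun u _ => u)
          (.bind .x0 (runs_colsTm hg hW hvM h2 (by omega))) (.lit 0) (fun u _ acc => .x0)
        refine (this.congr (foldr_head_eq _ 0)).mono ?_
        have : (colList g D v).length * (1 + 1) ≤ M * 2 := Nat.mul_le_mul (hcl.trans hW) le_rfl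
        omega
      have hdel := Runs.foldl (f := f)
        (Γ := .nat :: argTy :: rowTy :: .prod .nat (.prod delTy .rat) :: .nat :: inputTy :: Γ)
        (e := (i, (g, D, v, 0), row, (v, D, z), d, ((q, g), r), e))
        (a := .nat) (b := delTy) (xs := nbrList g D v) (l := .bind x1 nbrsTm)
        (s := .cons (.pair (.lit 0) (.fst x3)) (.fst (.snd x3)))
        (body := .cons (.pair (.prim .natAdd (.pair x0 (.lit 1))) x2) x1) (C := opCost M + 9)
        (fun (D : Del) w => (w + 1, i) :: D)
        (fun j D' => SmallDel M D' ∧ D'.length = D.length + 1 + j)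
        (.bind .x1 (runs_nbrsTm hg hW hvM h2 (by omega)))
        (.cons (.pair (.lit 0) (.fst .x3)) (.fst (.snd .x3)))
        ⟨h2.cons (Nat.zero_le _) (by simp only; omega), by simp⟩
        (fun j hj (w : ℕ) hw (D' : Del) hD' => by
          have hwM := hg.nbrList_le hw
          refine ⟨Runs.mono (Runs.cons (.pair (.natAdd M (.pair .x0 (.lit 1)) (by omega) hM) .x2)
            .x1) (by omega), hD'.1.cons hwM hiM, ?_⟩
          simp only [List.length_cons, hD'.2]
          omega)
      have hrec := Runs.recur (f := f) (a := argTy) (b := .rat)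
        (Γ := .nat :: argTy :: rowTy :: .prod .nat (.prod delTy .rat) :: .nat :: inputTy :: Γ)
        (e := (i, (g, D, v, 0), row, (v, D, z), d, ((q, g), r), e)) (n := x4)
        (s := .pair (.fst x1) (.pair (.fst (.snd x1)) (.pair (.fst x3) x0)))
        (base := baseTm) (step := stepTm κ) (CallOk M W g)
        (fun k u => phiL κ g k u.2.1 u.2.2.1 u.2.2.2) (phiCost κ M W) .x4
        (.pair (.fst .x1) (.pair (.fst (.snd .x1)) (.pair (.fst .x3) .x0)))
        (fun u hu => runs_baseTm hg hW hu)
        (fun j h hcall u hu => runs_stepTm hg hW hκ hcall hu)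
        ⟨rfl, h2, by simp only; omega, hvM, hiM⟩
      have hz : ratSize z ≤ prodBound κ M W d := by
        refine h4.trans ?_
        unfold prodBound
        exact Nat.add_le_add_left (Nat.mul_le_mul_right _ (by omega)) 2
      have hφs : ratSize (phiL κ g d D v i) ≤ prodBound κ M W d := by
        refine hφ.ratSize_le.trans ?_
        unfold prodBound
        have := Nat.mul_le_mul_right (2 * denBound κ W d) hM
        omega
      refine ⟨Runs.mono (Runs.bind
        (.pair (.snd (.fst .x3)) (.pair (.fst (.snd .x1)) (.pair (.fst .x1) (.lit 0))))
        (.bind (hcol e) (.pair (.natAdd M (.pair (.fst .x3) (.lit 1)) (by simp only; omega) hM)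
          (.pair hdel.1 (.ratDiv (prodBound κ M W d) (.pair (.snd (.snd .x3)) hrec) hz hφs))))) ?_,
        rfl, hdel.2.1, ?_, ?_⟩
      · have : (nbrList g D v).length * (opCost M + 9 + 1) ≤ M * (opCost M + 10) :=
          Nat.mul_le_mul (hnl.trans hW) le_rfl
        have e1 : M * (opCost M + 20) = M * (opCost M + 10) + M * 2 + M * 8 := by ring
        omega
      · have h7 : (List.foldl (fun (D : Del) w => (w + 1, i) :: D) ((0, v) :: D)
          (nbrList g D v)).length = D.length + 1 + (nbrList g D v).length := hdel.2.2
        rw [Nat.succ_mul]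
        change (List.foldl (fun (D : Del) w => (w + 1, i) :: D) ((0, v) :: D)
          (nbrList g D v)).length ≤ _
        omega
      · have := ratSize_div_le z (phiL κ g d D v i)
        have h6 := hφ.ratSize_le
        rw [Nat.succ_mul]
        change ratSize (z / phiL κ g d D v i) ≤ _
        omega)
  refine Runs.mono (Runs.bind hdep (.snd (.snd h.1))) ?_
  have : g.length * (2 * listCost M + opCost M + M * (opCost M + 20) + phiCost κ M W d +
      opCost (prodBound κ M W d) + d + 79 + 1) ≤ M * (2 * listCost M + opCost M +
      M * (opCost M + 20) + phiCost κ M W d + opCost (prodBound κ M W d) + d + 80) :=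
    Nat.mul_le_mul hg.length_le le_rfl
  unfold countCost
  omega

end Costs

/-! ### The program carries out CountCOLOR -/

namespace GraphList

variable (I : GraphList)

/-- The rows of the encoding of an instance. -/
noncomputable abbrev rows : Data := I.encode.2

theorem length_rows : I.rows.length = I.N := by simp [rows, encode]

open Classical in
theorem getD_rows (v : Fin I.N) : I.rows.getD v ([], []) =
    (((List.finRange I.N).filter fun u => I.G.Adj v u).map Fin.val,
     ((List.finRange I.q).filter fun i => i ∈ I.L v).map Fin.val) := by
  rw [List.getD_eq_getElem _ _ (by rw [length_rows]; exact v.2)]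
  simp [rows, encode]

/-- The list `D` of deletions describes the remaining nodes `S` and the current lists `L`. -/
structure Rep (D : Del) (S : Finset (Fin I.N)) (L : Fin I.N → Finset (Fin I.q)) : Prop where
  node : ∀ u, u ∈ S ↔ (0, u.val) ∉ D
  color : ∀ u c, c ∈ L u ↔ c ∈ I.L u ∧ (u.val + 1, c.val) ∉ D

variable {I} {D : Del} {S : Finset (Fin I.N)} {L : Fin I.N → Finset (Fin I.q)}

theorem rep_nil : I.Rep [] Finset.univ I.L := ⟨by simp, by simp⟩

theorem Rep.erase (h : I.Rep D S L) (v : Fin I.N) : I.Rep ((0, v.val) :: D) (S.erase v) L := by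
  refine ⟨fun u => ?_, fun u c => ?_⟩
  · rw [Finset.mem_erase, h.node, List.mem_cons, not_or]
    simp [Fin.ext_iff]
  · rw [h.color, List.mem_cons, not_or]
    simp

theorem Rep.drop (h : I.Rep D S L) (w : Fin I.N) (j : Fin I.q) :
    I.Rep ((w.val + 1, j.val) :: D) S (dropColor L {w} j) := by
  refine ⟨fun u => ?_, fun u c => ?_⟩
  · rw [h.node, List.mem_cons, not_or]
    simp
  · unfold dropColor
    by_cases hu : u = w
    · subst hu
      have := h.color u c
      simp only [Finset.mem_singleton, if_true, Finset.mem_erase, this, List.mem_cons, not_or,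
        Prod.mk.injEq, true_and, Fin.ext_iff, ne_eq]
      tauto
    · have hu' : ¬ u.val = w.val := fun e => hu (Fin.ext e)
      simp only [Finset.mem_singleton, hu, if_false, h.color, List.mem_cons, not_or,
        Prod.mk.injEq, add_left_inj, hu', false_and, not_false_eq_true, true_and]

/-- The increasing list of the elements of a set of numbers. -/
def enum {n : ℕ} (T : Finset (Fin n)) : List (Fin n) := (List.finRange n).filter (· ∈ T)

theorem mem_enum {n : ℕ} {T : Finset (Fin n)} {u : Fin n} : u ∈ enum T ↔ u ∈ T := by
  simp [enum]

theorem pairwise_enum {n : ℕ} (T : Finset (Fin n)) : (enum T).Pairwise (· < ·) :=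
  (List.pairwise_lt_finRange n).filter _

theorem toFinset_enum {n : ℕ} (T : Finset (Fin n)) : (enum T).toFinset = T := by
  ext u; simp [mem_enum]

theorem nodup_enum {n : ℕ} (T : Finset (Fin n)) : (enum T).Nodup :=
  (pairwise_enum T).imp fun h => h.ne

theorem length_enum {n : ℕ} (T : Finset (Fin n)) : (enum T).length = T.card := by
  rw [← List.toFinset_card_of_nodup (nodup_enum T), toFinset_enum]

theorem Rep.nbrList_eq (h : I.Rep D S L) (v : Fin I.N) :
    nbrList I.rows D v = (enum (nbrs I.G S v)).map Fin.val := by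
  unfold nbrList keep
  rw [getD_rows, List.filter_map, List.filter_filter]
  unfold enum
  congr 1
  refine List.filter_congr fun u _ => ?_
  have hu := mem_nbrs (G := I.G) (S := S) (v := v) (u := u)
  rw [h.node] at hu
  rw [Bool.eq_iff_iff]
  simp [hu]

theorem Rep.colList_eq (h : I.Rep D S L) (v : Fin I.N) :
    colList I.rows D v = (enum (L v)).map Fin.val := by
  unfold colList keep
  rw [getD_rows, List.filter_map, List.filter_filter]
  unfold enum
  congr 1
  refine List.filter_congr fun u _ => ?_
  simp [h.color, and_comm]

theorem sumsL_map_enum (A : ℕ → ℚ) {n : ℕ} (T : Finset (Fin n)) (i : Fin n) :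
    sumsL A ((enum T).map Fin.val) i = (∑ j ∈ T, A j, if i ∈ T then A i else 0) := by
  have key : ∀ (l : List (Fin n)) (x y : ℚ),
      (l.map Fin.val).foldl (fun acc j => (acc.1 + A j, if j = i then A j else acc.2)) (x, y) =
        (x + (l.map fun j : Fin n => A j.val).sum, if i ∈ l then A i else y) := by
    intro l
    induction l with
    | nil => simp
    | cons j l ih =>
      intro x y
      rw [List.map_cons, List.foldl_cons, ih]
      refine Prod.ext ?_ ?_
      · simp [add_assoc]
      · by_cases h : j = i
        · subst h; simp
        · have h1 : ¬ i = j := fun e => h e.symm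
          have h2 : ¬ j.val = i.val := fun e => h (Fin.ext e)
          simp [h1, h2]
  unfold sumsL
  rw [key, ← List.sum_toFinset _ (nodup_enum T), toFinset_enum]
  simp [mem_enum]

/-- The list version of the weights agrees with the weights of the recursion. -/
theorem Rep.weightL_eq {p : Del → ℕ → ℕ → ℚ}
    {P : Finset (Fin I.N) → (Fin I.N → Finset (Fin I.q)) → Fin I.N → Fin I.q → ℝ}
    (hp : ∀ D S L, I.Rep D S L → ∀ w j, (p D (w : Fin I.N) (j : Fin I.q) : ℝ) = P S L w j)
    (h : I.Rep D S L) (v : Fin I.N) (j : Fin I.q) :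
    (weightL p ((enum (nbrs I.G S v)).map Fin.val) ((0, v.val) :: D) j : ℝ) =
      weight I.G S L v P j := by
  set T := nbrs I.G S v with hT
  have key : ∀ (l : List (Fin I.N)) (T₀ : Finset (Fin I.N)) (D : Del) (x : ℚ),
      l.Pairwise (· < ·) → (∀ t ∈ T₀, ∀ w ∈ l, t < w) → (∀ w, w ∈ T ↔ w ∈ T₀ ∨ w ∈ l) →
      I.Rep D (S.erase v) (dropColor L T₀ j) →
      ((((l.map Fin.val).foldl (fun (acc : ℚ × Del) w =>
        (acc.1 * (1 - p acc.2 w j), (w + 1, j.val) :: acc.2)) (x, D)).1 : ℚ) : ℝ) =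
        x * (l.map fun w => 1 - P (S.erase v) (dropColor L (T.filter (· < w)) j) w j).prod := by
    intro l
    induction l with
    | nil => simp
    | cons w l ih =>
      intro T₀ D x hl hlt hmem hrep
      rw [List.pairwise_cons] at hl
      have hT₀ : T.filter (· < w) = T₀ := by
        ext t
        rw [Finset.mem_filter, hmem, List.mem_cons]
        constructor
        · rintro ⟨h1 | rfl | h1, h2⟩
          · exact h1
          · exact absurd h2 (lt_irrefl _)
          · exact absurd (hl.1 t h1) (not_lt.2 h2.le)
        · exact fun h1 => ⟨Or.inl h1, hlt t h1 w List.mem_cons_self⟩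
      rw [List.map_cons, List.foldl_cons, ih (insert w T₀) _ _ hl.2 ?_ ?_ ?_, List.map_cons,
        List.prod_cons, hT₀]
      · push_cast
        rw [hp _ _ _ hrep w j]
        ring
      · intro t ht u hu
        rcases Finset.mem_insert.1 ht with rfl | ht
        · exact hl.1 u hu
        · exact hlt t ht u (List.mem_cons_of_mem _ hu)
      · intro u
        rw [hmem, List.mem_cons, Finset.mem_insert]
        tauto
      · rw [dropColor_insert]
        exact hrep.drop w j
  have h0 : dropColor L ∅ j = L := by funext u; simp [dropColor]
  unfold weightL weight
  rw [key (enum T) ∅ _ 1 (pairwise_enum T) (by simp) (by simp [mem_enum])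
    (by rw [h0]; exact h.erase v), ← List.prod_toFinset _ (nodup_enum T), toFinset_enum,
    Rat.cast_one, one_mul]

theorem Rep.phiL_eq {κ : Cutoffs} {b ε : ℝ} (hκ : κ.Fits b ε) (d : ℕ) :
    ∀ D S L, I.Rep D S L → ∀ (v : Fin I.N) (i : Fin I.q),
      (phiL κ I.rows d D v i : ℝ) = Phi b ε I.G d S L v i := by
  induction d with
  | zero =>
    intro D S L h v i
    rw [phiL, Phi, ratioL, h.colList_eq, sumsL_map_enum]
    split_ifs <;> simp
  | succ d ih =>
    intro D S L h v i
    have hr : (ratioL (weightL (phiL κ I.rows d) (nbrList I.rows D v) ((0, v.val) :: D))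
        (colList I.rows D v) i : ℝ) = if i ∈ L v then
          weight I.G S L v (Phi b ε I.G d) i / ∑ j ∈ L v, weight I.G S L v (Phi b ε I.G d) j
        else 0 := by
      rw [ratioL, h.colList_eq, h.nbrList_eq, sumsL_map_enum]
      push_cast
      simp_rw [h.weightL_eq ih]
      split_ifs <;> simp [h.weightL_eq ih]
    have hlen : (nbrList I.rows D v).length = (nbrs I.G S v).card := by
      rw [h.nbrList_eq, List.length_map, length_enum]
    rw [phiL, hlen, apply_ite (Rat.cast : ℚ → ℝ), Rat.cast_min, Rat.cast_min, hr]
    have hc1 : (((κ.p₁ : ℚ) / ((κ.q₁ * (nbrs I.G S v).card : ℕ) : ℚ) : ℚ) : ℝ) =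
        1 / (2 * (1 + ε) * ((nbrs I.G S v).card : ℝ)) := by
      push_cast
      rw [← div_div, hκ.first, div_div]
    have hc2 : (((κ.p₂ : ℚ) / (κ.q₂ : ℚ) : ℚ) : ℝ) = 1 / b := by
      push_cast
      exact hκ.second
    by_cases hi : i ∈ L v
    · rw [Phi_succ _ _ _ _ _ _ _ hi, hc1, hc2]
      simp only [hi, if_true]
      by_cases hm : (nbrs I.G S v).card = 0
      · have hw : ∀ j, weight I.G S L v (Phi b ε I.G d) j = 1 := fun j => by
          unfold weight
          rw [Finset.card_eq_zero.1 hm, Finset.prod_empty]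
        simp [hm, hw]
      · simp [hm]
    · rw [Phi_of_notMem _ _ _ _ _ _ _ hi]
      simp only [hi, if_false]
      split_ifs
      · rw [← Rat.cast_min]
        exact min_eq_right (Rat.cast_nonneg.2 (le_min (by positivity) (by positivity)))
      · rfl

theorem Rep.drop_nbrs (h : I.Rep D S L) (v : Fin I.N) (j : Fin I.q) :
    I.Rep (((enum (nbrs I.G S v)).map Fin.val).foldl (fun (D : Del) w => (w + 1, j.val) :: D)
      ((0, v.val) :: D)) (S.erase v) (dropColor L (nbrs I.G S v) j) := by
  have key : ∀ (l : List (Fin I.N)) (T₀ : Finset (Fin I.N)) (D : Del),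
      I.Rep D (S.erase v) (dropColor L T₀ j) →
      I.Rep ((l.map Fin.val).foldl (fun (D : Del) w => (w + 1, j.val) :: D) D) (S.erase v)
        (dropColor L (T₀ ∪ l.toFinset) j) := by
    intro l
    induction l with
    | nil => intro T₀ D h; simpa using h
    | cons w l ih =>
      intro T₀ D h
      have := ih (insert w T₀) ((w.val + 1, j.val) :: D)
        (by rw [dropColor_insert]; exact h.drop w j)
      rw [List.map_cons, List.foldl_cons]
      convert this using 2
      ext u
      simp only [Finset.mem_union, List.toFinset_cons, Finset.mem_insert]
      tauto
  have h0 : dropColor L ∅ j = L := by funext u; simp [dropColor]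
  have := key (enum (nbrs I.G S v)) ∅ _ (by rw [h0]; exact h.erase v)
  rwa [toFinset_enum, Finset.empty_union] at this

/-- The list version of CountCOLOR is a run of CountCOLOR. -/
theorem countColor_countL {κ : Cutoffs} {α b ε : ℝ} (hκ : κ.Fits b ε) (hα : 1 ≤ α) (hb : 0 < b)
    (hI : GoodOn α b I.G Finset.univ I.L) (d : ℕ) :
    CountColor b ε I.G d Finset.univ I.L (countL κ I.rows d : ℝ) := by
  have key : ∀ (l : Data) (v : ℕ) (D : Del) (z : ℚ) (S : Finset (Fin I.N))
      (L : Fin I.N → Finset (Fin I.q)), v + l.length = I.N → (∀ u, u ∈ S ↔ v ≤ u.val) →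
      I.Rep D S L → GoodOn α b I.G S L →
      ∃ z' : ℝ, CountColor b ε I.G d S L z' ∧
        ((l.foldl (fun acc _ => roundL κ I.rows d acc) (v, D, z)).2.2 : ℝ) = z * z' := by
    intro l
    induction l with
    | nil =>
      intro v D z S L hv hS _ _
      have : S = ∅ := by
        ext u
        have := u.2
        simp only [List.length_nil, add_zero] at hv
        simp only [hS, Finset.notMem_empty, iff_false]
        omega
      subst this
      exact ⟨1, .done L, by simp⟩
    | cons r l ih =>
      intro v D z S L hv hS hrep hgood
      rw [List.length_cons] at hv
      set v' : Fin I.N := ⟨v, by omega⟩ with hv'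
      have hvS : v' ∈ S := (hS v').2 le_rfl
      have hne : (L v').Nonempty := by
        rw [← Finset.card_pos]
        have h1 := hgood v' hvS
        have h2 : (0 : ℝ) ≤ (nbrs I.G S v').card := Nat.cast_nonneg _
        have : (0 : ℝ) < (L v').card := by nlinarith
        exact_mod_cast this
      obtain ⟨i, hi, hhead⟩ : ∃ i ∈ L v', (colList I.rows D v).headD 0 = i.val := by
        have hc := hrep.colList_eq v'
        simp only [hv'] at hc
        rw [hc]
        cases he : enum (L v') with
        | nil =>
          obtain ⟨c, hc⟩ := hne
          have := mem_enum.2 hc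
          rw [he] at this
          simp at this
        | cons c cs =>
          refine ⟨c, mem_enum.1 (by rw [he]; exact List.mem_cons_self), ?_⟩
          simp
      have hφ := hrep.phiL_eq hκ d _ _ _ v' i
      have hd := hrep.drop_nbrs v' i
      rw [← hrep.nbrList_eq v'] at hd
      obtain ⟨z', hz', e⟩ := ih (v + 1) _ (z / phiL κ I.rows d D v i.val) (S.erase v')
        (dropColor L (nbrs I.G S v') i) (by omega) (fun u => by
          rw [Finset.mem_erase, hS, ne_eq, Fin.ext_iff]
          simp only [hv']
          omega) hd (hgood.erase hα hvS subset_rfl i)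
      refine ⟨_, .step S L v' i z' hvS hi hz', ?_⟩
      rw [List.foldl_cons]
      have hround : roundL κ I.rows d (v, D, z) = (v + 1,
          (nbrList I.rows D v).foldl (fun (D : Del) w => (w + 1, i.val) :: D) ((0, v) :: D),
          z / phiL κ I.rows d D v i.val) := by
        unfold roundL
        rw [hhead]
      rw [hround]
      refine e.trans ?_
      push_cast
      rw [show phiL κ I.rows d D v i.val = phiL κ I.rows d D v'.val i.val from rfl, hφ]
      rw [div_eq_mul_inv, mul_assoc]
  obtain ⟨z', hz', e⟩ := key I.rows 0 [] 1 Finset.univ I.L (by rw [length_rows, zero_add])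
    (by simp) rep_nil hI
  rw [Rat.cast_one, one_mul] at e
  unfold countL
  rw [e]
  exact hz'

/-! ### Size of the encoding -/

theorem edgesL_eq (g : Data) (k : ℕ) (c : ℕ) :
    (g.foldl (fun (acc : ℕ × ℕ) row => (acc.1 + 1,
      row.1.foldl (fun c u => if u ≤ acc.1 then c else c + 1) acc.2)) (k, c)).2 =
      c + ∑ i : Fin g.length, ((g[i]).1.filter fun u => k + i.val < u).length := by
  have inner : ∀ (l : List ℕ) (k c : ℕ), l.foldl (fun c u => if u ≤ k then c else c + 1) c =
      c + (l.filter fun u => k < u).length := by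
    intro l k
    induction l with
    | nil => simp
    | cons u l ih =>
      intro c
      rw [List.foldl_cons, ih]
      by_cases h : u ≤ k
      · rw [if_pos h, List.filter_cons_of_neg (by simpa using h)]
      · rw [if_neg h, List.filter_cons_of_pos (by simpa using h), List.length_cons]
        omega
  induction g generalizing k c with
  | nil => simp
  | cons row g ih =>
    rw [List.foldl_cons, ih, inner]
    refine Eq.trans ?_ (congrArg (c + ·) (Fin.sum_univ_succ (n := g.length)
      (fun i => (((row :: g)[i]).1.filter fun u => k + i.val < u).length)).symm)
    simp only [Fin.getElem_fin, Fin.val_zero, List.getElem_cons_zero, add_zero, Fin.val_succ,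
      List.getElem_cons_succ]
    rw [add_assoc]
    congr 2
    refine Finset.sum_congr rfl fun i _ => ?_
    rw [show k + 1 + i.val = k + (i.val + 1) by omega]

variable (I)

theorem ncard_edgeSet :
    I.G.edgeSet.ncard = ∑ v : Fin I.N, ((nbrs I.G Finset.univ v).filter (v < ·)).card := by
  classical
  rw [← Finset.card_sigma, ← Set.ncard_coe_finset]
  symm
  refine Set.ncard_congr (fun a _ => s(a.1, a.2)) ?_ ?_ ?_
  · rintro ⟨a, b⟩ h
    simp only [Finset.coe_sigma, Set.mem_sigma_iff, Finset.mem_coe, Finset.mem_filter,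
      mem_nbrs] at h
    exact h.2.1.2
  · rintro ⟨a, b⟩ ⟨a', b'⟩ h h' e
    simp only [Finset.coe_sigma, Set.mem_sigma_iff, Finset.mem_coe, Finset.mem_filter] at h h'
    rcases Sym2.eq_iff.1 e with ⟨h1, h2⟩ | ⟨h1, h2⟩
    · simp only at h1 h2
      subst h1; subst h2; rfl
    · simp only at h1 h2
      subst h1; subst h2
      exact absurd h.2.2 (not_lt.2 h'.2.2.le)
  · intro e he
    induction e with
    | _ a b =>
      have hab : I.G.Adj a b := he
      rcases lt_or_gt_of_ne hab.ne with h | h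
      · exact ⟨⟨a, b⟩, by simp [mem_nbrs, hab, h], rfl⟩
      · exact ⟨⟨b, a⟩, by simp [mem_nbrs, hab.symm, h], Sym2.eq_swap⟩

theorem edgesL_rows : edgesL I.rows = I.G.edgeSet.ncard := by
  classical
  unfold edgesL
  rw [edgesL_eq, zero_add, ncard_edgeSet]
  refine Fintype.sum_equiv (finCongr I.length_rows) _ _ fun i => ?_
  have h := I.getD_rows (finCongr I.length_rows i)
  rw [List.getD_eq_getElem _ _ (by simp)] at h
  simp only [finCongr_apply, Fin.val_cast] at h
  simp only [Fin.getElem_fin, zero_add, h]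
  rw [List.filter_map, List.filter_filter, List.length_map, ← length_enum]
  unfold enum
  congr 1
  refine List.filter_congr fun u _ => ?_
  simp [mem_nbrs, Fin.lt_def, and_comm]

theorem size_eq : I.size = max I.rows.length (max (edgesL I.rows) I.q) := by
  rw [length_rows, edgesL_rows, size]

/-- The rows are small if the lists of colors have length at most `W` and there are no more
neighbors than colors. -/
theorem smallData {α β : ℝ} (hI : I.Good α β) (hα : 1 ≤ α) (hβ : 0 ≤ β) {W M : ℕ}
    (hW : ∀ v, (I.L v).card ≤ W) (hN : I.N ≤ M) (hq : I.q ≤ M) : SmallData W M I.rows := by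
  classical
  have hrow : ∀ row ∈ I.rows, ∃ v : Fin I.N, row =
      ((enum (nbrs I.G Finset.univ v)).map Fin.val, (enum (I.L v)).map Fin.val) := by
    intro row h
    simp only [rows, encode, List.mem_map, List.mem_finRange, true_and] at h
    obtain ⟨v, rfl⟩ := h
    refine ⟨v, ?_⟩
    unfold enum
    simp [mem_nbrs]
  refine ⟨by rw [length_rows]; exact hN, ?_, ?_, ?_, ?_⟩
  · intro row h
    obtain ⟨v, rfl⟩ := hrow row h
    rw [List.length_map, length_enum]
    refine le_trans ?_ (hW v)
    have h1 := hI.2 v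
    rw [deg_eq] at h1
    have h2 : (0 : ℝ) ≤ (nbrs I.G Finset.univ v).card := Nat.cast_nonneg _
    have : ((nbrs I.G Finset.univ v).card : ℝ) ≤ (I.L v).card := by nlinarith
    exact_mod_cast this
  · intro row h
    obtain ⟨v, rfl⟩ := hrow row h
    rw [List.length_map, length_enum]
    exact hW v
  · intro row h x hx
    obtain ⟨v, rfl⟩ := hrow row h
    obtain ⟨u, -, rfl⟩ := List.mem_map.1 hx
    exact Nat.succ_le_of_lt (u.2.trans_le hN)
  · intro row h x hx
    obtain ⟨v, rfl⟩ := hrow row h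
    obtain ⟨u, -, rfl⟩ := List.mem_map.1 hx
    exact (u.2.trans_le hq).le

end GraphList

/-! ### Estimates of the running time -/

/-- Functions with a polynomial bound. -/
def PolyBounded (f : ℕ → ℕ) : Prop := ∃ c k : ℕ, ∀ M, f M ≤ c * (M + 1) ^ k

namespace PolyBounded

variable {f g : ℕ → ℕ}

theorem const (a : ℕ) : PolyBounded fun _ => a := ⟨a, 0, fun M => by simp⟩

theorem id : PolyBounded fun M => M := ⟨1, 1, fun M => by simp⟩

theorem add (hf : PolyBounded f) (hg : PolyBounded g) : PolyBounded fun M => f M + g M := by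
  obtain ⟨c, k, h⟩ := hf
  obtain ⟨c', k', h'⟩ := hg
  refine ⟨c + c', k + k', fun M => ?_⟩
  calc f M + g M ≤ c * (M + 1) ^ k + c' * (M + 1) ^ k' := add_le_add (h M) (h' M)
    _ ≤ c * (M + 1) ^ (k + k') + c' * (M + 1) ^ (k + k') := by
        gcongr <;> omega
    _ = _ := by ring

theorem mul (hf : PolyBounded f) (hg : PolyBounded g) : PolyBounded fun M => f M * g M := by
  obtain ⟨c, k, h⟩ := hf
  obtain ⟨c', k', h'⟩ := hg
  refine ⟨c * c', k + k', fun M => ?_⟩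
  calc f M * g M ≤ (c * (M + 1) ^ k) * (c' * (M + 1) ^ k') := Nat.mul_le_mul (h M) (h' M)
    _ = _ := by ring

theorem pow (hf : PolyBounded f) (n : ℕ) : PolyBounded fun M => f M ^ n := by
  induction n with
  | zero => simpa using const 1
  | succ n ih => simpa only [pow_succ] using ih.mul hf

theorem opCost : PolyBounded opCost := ((const 1).add ((const 2).mul id)).pow 2

theorem memCost : PolyBounded memCost :=
  (id.mul (((const 2).mul opCost).add (const 18))).add (const 5)

theorem keepCost : PolyBounded keepCost := (id.mul (memCost.add (const 16))).add (const 5)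

theorem rowCost : PolyBounded rowCost :=
  (id.mul (((const 2).mul opCost).add (const 18))).add (const 9)

theorem listCost : PolyBounded listCost := ((rowCost.add keepCost).add opCost).add (const 30)

theorem lenCost : PolyBounded lenCost := (id.mul (opCost.add (const 5))).add (const 4)

theorem depthCost (K : ℕ) : PolyBounded (depthCost K) :=
  (((lenCost.add ((const 5).mul opCost)).add (const K)).add (const 60)).add
    (id.mul ((opCost.add (const 20)).add (id.mul (((const 2).mul opCost).add (const 15)))))

end PolyBounded

/-- The cost of one call apart from the recursive calls and the rational arithmetic. -/
def localCost (M : ℕ) : ℕ := 2 * listCost M + lenCost M + 14 * opCost M + M + 300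

theorem PolyBounded.localCost : PolyBounded localCost :=
  (((((const 2).mul listCost).add lenCost).add ((const 14).mul opCost)).add id).add (const 300)

/-- The recursion makes at most `(W + 1) ^ 2` calls on each level. -/
theorem phiCost_le (κ : Cutoffs) (M W k : ℕ) :
    phiCost κ M W k ≤
      localCost M * opCost (2 * denBound κ W k) * (k + 1) * (W + 1) ^ (2 * k + 2) := by
  induction k with
  | zero =>
    have hO := one_le_opCost (2 * denBound κ W 0)
    rw [phiCost]
    unfold ratioCost localCost
    generalize opCost (2 * denBound κ W 0) = O at *
    generalize opCost M = o at *
    generalize listCost M = l at *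
    calc l + 2 * o + O + 35 + W * (o + 5 + O + o + 25) + 5
        ≤ (W + 1) * (l + 2 * o + O + 35 + (o + 5 + O + o + 25) + 5) := by nlinarith
      _ ≤ (W + 1) * ((2 * l + lenCost M + 14 * o + M + 300) * O) := by
          refine Nat.mul_le_mul_left _ ?_
          nlinarith [Nat.zero_le (lenCost M * O), Nat.zero_le (M * O), Nat.mul_le_mul_left l hO,
            Nat.mul_le_mul_left o hO]
      _ ≤ (W + 1) ^ 2 * ((2 * l + lenCost M + 14 * o + M + 300) * O) := by
          refine Nat.mul_le_mul_right _ ?_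
          nlinarith
      _ = _ := by ring
  | succ k ih =>
    have hO := one_le_opCost (2 * denBound κ W (k + 1))
    have hOO : opCost (2 * denBound κ W k) ≤ opCost (2 * denBound κ W (k + 1)) :=
      opCost_mono (Nat.mul_le_mul_left 2 (denBound_mono κ W (Nat.le_succ k)))
    have hstep : phiCost κ M W (k + 1) ≤ (W + 1) ^ 2 *
        (phiCost κ M W k + localCost M * opCost (2 * denBound κ W (k + 1))) := by
      rw [phiCost]
      unfold ratioCost weightCost localCost
      generalize opCost (2 * denBound κ W (k + 1)) = O at *
      generalize opCost M = o at *
      generalize listCost M = l at *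
      generalize lenCost M = n at *
      generalize phiCost κ M W k = T at *
      calc l + n + 4 * o + 4 * O + M + 80 + (l + 2 * o + O + 35 +
            W * (o + 25 + W * (T + 2 * O + 2 * o + 40) + O + o + 25))
          ≤ (W + 1) ^ 2 * (l + n + 4 * o + 4 * O + M + 80 + (l + 2 * o + O + 35 +
            ((o + 25 + (T + 2 * O + 2 * o + 40) + O + o + 25)))) := by
            generalize hX : T + 2 * O + 2 * o + 40 = X
            generalize hA : l + n + 4 * o + 4 * O + M + 80 = A
            generalize hB : l + 2 * o + O + 35 = B
            have : W * (o + 25 + W * X + O + o + 25) = W * (o + 25 + O + o + 25) + W ^ 2 * X := by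
              ring
            rw [this]
            have h1 : 1 ≤ (W + 1) ^ 2 := Nat.one_le_pow _ _ (by omega)
            have h2 : W ≤ (W + 1) ^ 2 := by nlinarith
            have h3 : W ^ 2 ≤ (W + 1) ^ 2 := by nlinarith
            have e1 := Nat.mul_le_mul_right (A + B) h1
            have e2 := Nat.mul_le_mul_right (o + 25 + O + o + 25) h2
            have e3 := Nat.mul_le_mul_right X h3
            nlinarith
        _ ≤ _ := by
            refine Nat.mul_le_mul_left _ ?_
            nlinarith [Nat.mul_le_mul_left l hO, Nat.mul_le_mul_left o hO,
              Nat.mul_le_mul_left n hO, Nat.mul_le_mul_left M hO]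
    refine hstep.trans ?_
    calc (W + 1) ^ 2 * (phiCost κ M W k + localCost M * opCost (2 * denBound κ W (k + 1)))
        ≤ (W + 1) ^ 2 * (localCost M * opCost (2 * denBound κ W (k + 1)) * (k + 1) *
            (W + 1) ^ (2 * k + 2) + localCost M * opCost (2 * denBound κ W (k + 1)) *
            (W + 1) ^ (2 * k + 2)) := by
          refine Nat.mul_le_mul_left _ (add_le_add (ih.trans ?_) ?_)
          · gcongr
          · exact Nat.le_mul_of_pos_right _ (by positivity)
      _ = _ := by ring

/-- The polynomial factor of the running time. -/
def polyFactor (κ : Cutoffs) (K M : ℕ) : ℕ :=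
  depthCost K M + opCost M + 30 + M * (2 * listCost M + opCost M + M * (opCost M + 20) +
    localCost M * (25 * (κ.p₁ + κ.q₁ + κ.p₂ + κ.q₂ + 3) ^ 2) * (M + 1) +
    81 * M ^ 2 * (κ.p₁ + κ.q₁ + κ.p₂ + κ.q₂ + 3) ^ 2 + M + 80)

theorem polyBounded_polyFactor (κ : Cutoffs) (K : ℕ) : PolyBounded (polyFactor κ K) := by
  have h1 := (((PolyBounded.const 2).mul .listCost).add .opCost).add
    (PolyBounded.id.mul (PolyBounded.opCost.add (.const 20)))
  have h2 := (PolyBounded.localCost.mul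
    (.const (25 * (κ.p₁ + κ.q₁ + κ.p₂ + κ.q₂ + 3) ^ 2))).mul (PolyBounded.id.add (.const 1))
  have h3 := ((PolyBounded.const 81).mul (PolyBounded.id.pow 2)).mul
    (.const ((κ.p₁ + κ.q₁ + κ.p₂ + κ.q₂ + 3) ^ 2))
  exact (((PolyBounded.depthCost K).add .opCost).add (.const 30)).add
    (PolyBounded.id.mul ((((h1.add h2).add h3).add .id).add (.const 80)))

theorem denBound_sq_mul_le (κ : Cutoffs) (W d : ℕ) :
    denBound κ W d ^ 2 * (W + 1) ^ (2 * d + 2) ≤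
      (κ.p₁ + κ.q₁ + κ.p₂ + κ.q₂ + 3) ^ 2 * (4 * (W + 1)) ^ (6 * (d + 1)) := by
  unfold denBound
  have e1 : ((4 * (W + 1) ^ 2) ^ (d + 1)) ^ 2 * (W + 1) ^ (2 * d + 2) =
      (16 * (W + 1) ^ 6) ^ (d + 1) := by
    rw [show 2 * d + 2 = 2 * (d + 1) by ring, pow_mul (W + 1), ← pow_mul, mul_comm (d + 1) 2,
      pow_mul, ← mul_pow]
    congr 1
    ring
  rw [mul_pow, mul_assoc, e1, pow_mul (4 * (W + 1))]
  refine Nat.mul_le_mul_left _ (Nat.pow_le_pow_left ?_ _)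
  rw [mul_pow]
  exact Nat.mul_le_mul_right _ (by norm_num)

theorem countCost_le (κ : Cutoffs) (K M W d : ℕ) (hM : 1 ≤ M) (hd : d ≤ M) :
    countCost κ K M W d ≤ polyFactor κ K M * (4 * (W + 1)) ^ (6 * (d + 1)) := by
  set c₀ := κ.p₁ + κ.q₁ + κ.p₂ + κ.q₂ + 3 with hc₀
  set B := (4 * (W + 1)) ^ (6 * (d + 1)) with hB
  have hB1 : 1 ≤ B := Nat.one_le_pow _ _ (by omega)
  have hy1 := one_le_denBound κ W d
  have hsq := denBound_sq_mul_le κ W d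
  have hW1 : 1 ≤ (W + 1) ^ (2 * d + 2) := Nat.one_le_pow _ _ (by omega)
  have hphi : phiCost κ M W d ≤ localCost M * (25 * c₀ ^ 2) * (M + 1) * B := by
    refine (phiCost_le κ M W d).trans ?_
    have hO : opCost (2 * denBound κ W d) ≤ 25 * denBound κ W d ^ 2 := by
      unfold opCost
      calc (1 + 2 * (2 * denBound κ W d)) ^ 2 ≤ (5 * denBound κ W d) ^ 2 :=
            Nat.pow_le_pow_left (by omega) 2
        _ = _ := by ring
    calc localCost M * opCost (2 * denBound κ W d) * (d + 1) * (W + 1) ^ (2 * d + 2)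
        ≤ localCost M * (25 * denBound κ W d ^ 2) * (M + 1) * (W + 1) ^ (2 * d + 2) := by gcongr
      _ = localCost M * 25 * (M + 1) * (denBound κ W d ^ 2 * (W + 1) ^ (2 * d + 2)) := by ring
      _ ≤ localCost M * 25 * (M + 1) * (c₀ ^ 2 * B) := Nat.mul_le_mul_left _ hsq
      _ = _ := by ring
  have hprod : opCost (prodBound κ M W d) ≤ 81 * M ^ 2 * c₀ ^ 2 * B := by
    unfold opCost prodBound
    have h1 : 1 ≤ M * denBound κ W d := Nat.mul_pos hM hy1
    calc (1 + 2 * (2 + M * (2 * denBound κ W d))) ^ 2 ≤ (9 * (M * denBound κ W d)) ^ 2 := by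
          refine Nat.pow_le_pow_left ?_ 2
          have : M * (2 * denBound κ W d) = 2 * (M * denBound κ W d) := by ring
          omega
      _ = 81 * M ^ 2 * (denBound κ W d ^ 2 * 1) := by ring
      _ ≤ 81 * M ^ 2 * (denBound κ W d ^ 2 * (W + 1) ^ (2 * d + 2)) := by gcongr
      _ ≤ 81 * M ^ 2 * (c₀ ^ 2 * B) := Nat.mul_le_mul_left _ hsq
      _ = _ := by ring
  unfold countCost polyFactor
  rw [← hc₀, add_mul _ _ B, mul_assoc M]
  have e : ∀ a : ℕ, a ≤ a * B := fun a => Nat.le_mul_of_pos_right a hB1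
  refine add_le_add (e _) (Nat.mul_le_mul_left M ?_)
  rw [add_mul, add_mul, add_mul, add_mul]
  have h1 := e (2 * listCost M + opCost M + M * (opCost M + 20))
  have h2 := hd.trans (e M)
  have h3 := e 80
  omega

/-- The cost of CountCOLOR in terms of the input. -/
theorem exists_countCost_bound (κ : Cutoffs) (K : ℕ) : ∃ c k e : ℕ, ∀ x W s : ℕ, s ≤ x →
    countCost κ K ((κ.p₁ + κ.q₁ + κ.p₂ + κ.q₂ + K + 1) * (x + 1) * (W + 1)) W (K * s) ≤
      c * ((x + 1) * (W + 1)) ^ k * (4 * (W + 1)) ^ (e * (s + 1)) := by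
  obtain ⟨c, k, h⟩ := polyBounded_polyFactor κ K
  set a := κ.p₁ + κ.q₁ + κ.p₂ + κ.q₂ + K + 1 with ha
  refine ⟨c * (a + 1) ^ k, k, 6 * (K + 1), fun x W s hs => ?_⟩
  have hxW : 1 ≤ (x + 1) * (W + 1) := Nat.mul_pos (by omega) (by omega)
  have hM : 1 ≤ a * (x + 1) * (W + 1) :=
    Nat.mul_pos (Nat.mul_pos (by omega) (by omega)) (by omega)
  have hd : K * s ≤ a * (x + 1) * (W + 1) := by
    calc K * s ≤ a * (x + 1) := Nat.mul_le_mul (by omega) (by omega)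
      _ ≤ _ := Nat.le_mul_of_pos_right _ (by omega)
  refine (countCost_le κ K _ W _ hM hd).trans (Nat.mul_le_mul ((h _).trans ?_) ?_)
  · rw [mul_assoc c, ← mul_pow]
    gcongr
    nlinarith
  · refine Nat.pow_le_pow_right (by omega) ?_
    nlinarith [Nat.zero_le (K * s)]

/-! ### Polynomial and quasi-polynomial running time -/

section Program

variable {α β b ε : ℝ} {κ : Cutoffs} {K : ℕ} {I : GraphList} {δ : ℝ} {W : ℕ}

/-- The program on the encoding of an instance, with all data bounded by one number. -/
theorem runs_program (hI : I.Good α β) (hα : 1 ≤ α) (hβ : 0 ≤ β) (hW : ∀ v, (I.L v).card ≤ W) :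
    Runs (Tm.run (countTm κ K : Program) () (Program.input I δ))
      (countL κ I.rows (K * Nat.size (I.size + ⌈1 / δ⌉₊)))
      (countCost κ K ((κ.p₁ + κ.q₁ + κ.p₂ + κ.q₂ + K + 1) * (I.size + ⌈1 / δ⌉₊ + 1) * (W + 1)) W
        (K * Nat.size (I.size + ⌈1 / δ⌉₊))) := by
  set r := ⌈1 / δ⌉₊ with hr
  set a := κ.p₁ + κ.q₁ + κ.p₂ + κ.q₂ + K + 1 with ha
  set x := I.size + r with hx
  have hN := I.N_le_size
  have hq := I.q_le_size
  have hs := Nat.size_le_self x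
  have hW1 : (x + 1) * (W + 1) ≤ a * (x + 1) * (W + 1) := by
    rw [mul_assoc]
    exact Nat.le_mul_of_pos_left _ (by omega)
  have hxM : x + 1 ≤ (x + 1) * (W + 1) := Nat.le_mul_of_pos_right _ (by omega)
  have hWM : W + 1 ≤ (x + 1) * (W + 1) := Nat.le_mul_of_pos_left _ (by omega)
  have haM : a ≤ a * (x + 1) * (W + 1) := by
    rw [mul_assoc]
    exact Nat.le_mul_of_pos_right _ (by positivity)
  have hsize := I.size_eq
  have hg := I.smallData hI hα hβ hW (M := a * (x + 1) * (W + 1)) (by omega) (by omega)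
  refine runs_countTm (Γ := []) (Φ := []) (g := I.rows) (f := ()) (e := ())
    hg (q := I.q) (r := r) (by omega) (by omega) ?_ ?_ (by omega)
    (by omega) (by omega) ?_ ?_
  · rw [← hsize]
  · refine Nat.mul_le_mul_right _ ?_
    rw [GraphList.length_rows]
    have : K * Nat.size x ≤ K * x := Nat.mul_le_mul_left K hs
    nlinarith [Nat.zero_le ((κ.p₁ + κ.q₁ + κ.p₂ + κ.q₂) * (x + 1))]
  · rw [← hsize]
    omega
  · calc κ.p₁ + κ.q₁ * (W + 1) + κ.p₂ + κ.q₂ ≤ a * (W + 1) := by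
          nlinarith [Nat.zero_le (κ.p₁ * W), Nat.zero_le (κ.p₂ * W), Nat.zero_le (κ.q₂ * W),
            Nat.zero_le (K * W)]
      _ ≤ a * (W + 1) * (x + 1) := Nat.le_mul_of_pos_right _ (by omega)
      _ = a * (x + 1) * (W + 1) := by ring

/-- Uniform bound for the running time, for lists of at most `W` colors. -/
theorem exists_time_bound (κ : Cutoffs) (K : ℕ) (hα : 1 ≤ α) (hβ : 0 ≤ β) :
    ∃ c k e : ℕ, ∀ I : GraphList, I.Good α β → ∀ δ : ℝ, ∀ W : ℕ, (∀ v, (I.L v).card ≤ W) →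
      Program.time (countTm κ K) I δ ≤ c * ((I.size + ⌈1 / δ⌉₊ + 1) * (W + 1)) ^ k *
        (4 * (W + 1)) ^ (e * (Nat.size (I.size + ⌈1 / δ⌉₊) + 1)) := by
  obtain ⟨c, k, e, h⟩ := exists_countCost_bound κ K
  refine ⟨c, k, e, fun I hI δ W hW => ?_⟩
  exact (runs_program hI hα hβ hW).2.trans (h _ W _ (Nat.size_le_self _))

theorem card_L_le_size (I : GraphList) (v : Fin I.N) : (I.L v).card ≤ I.size :=
  (Finset.card_le_univ _).trans (by rw [Fintype.card_fin]; exact I.q_le_size)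

theorem two_pow_size_le {x : ℕ} (hx : 0 < x) : 2 ^ Nat.size x ≤ 2 * x := by
  obtain ⟨m, hm⟩ : ∃ m, Nat.size x = m + 1 :=
    ⟨Nat.size x - 1, by have := Nat.size_pos.2 hx; omega⟩
  have : 2 ^ m ≤ x := Nat.lt_size.1 (by omega)
  rw [hm, pow_succ]
  omega

theorem ceil_inv_le (hδ : 0 < δ) : (⌈1 / δ⌉₊ : ℝ) ≤ 1 / δ + 1 :=
  (Nat.ceil_lt_add_one (by positivity)).le

/-- For lists of bounded size a constant to the power of the depth is polynomial. -/
theorem polyTime_countTm (κ : Cutoffs) (K : ℕ) (hα : 1 ≤ α) (hβ : 0 ≤ β) (l : ℕ) :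
    Program.PolyTime (countTm κ K) {I | I.Good α β ∧ ∀ v, (I.L v).card ≤ l} := by
  obtain ⟨c, k, e, h⟩ := exists_time_bound (α := α) (β := β) κ K hα hβ
  obtain ⟨t, ht⟩ : ∃ t : ℕ, 4 * (l + 1) ≤ 2 ^ t := ⟨4 * (l + 1), Nat.lt_two_pow_self.le⟩
  refine ⟨(c * (l + 1) ^ k * 4 ^ (t * e) * 2 ^ (k + t * e) : ℕ), k + t * e,
    fun I hI δ hδ => ?_⟩
  set r := ⌈1 / δ⌉₊ with hr
  set x := I.size + r with hx
  have hr0 : 0 < r := Nat.ceil_pos.2 (by positivity)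
  have h1 : Program.time (countTm κ K) I δ ≤
      c * (l + 1) ^ k * 4 ^ (t * e) * (x + 1) ^ (k + t * e) := by
    refine (h I hI.1 δ l hI.2).trans ?_
    calc c * ((x + 1) * (l + 1)) ^ k * (4 * (l + 1)) ^ (e * (Nat.size x + 1))
        ≤ c * ((x + 1) * (l + 1)) ^ k * (2 ^ t) ^ (e * (Nat.size x + 1)) := by gcongr
      _ = c * ((x + 1) * (l + 1)) ^ k * (2 * 2 ^ Nat.size x) ^ (t * e) := by
          congr 1
          rw [← pow_mul, ← pow_succ', ← pow_mul]
          ring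
      _ ≤ c * ((x + 1) * (l + 1)) ^ k * (4 * (x + 1)) ^ (t * e) := by
          have h5 : 2 * 2 ^ Nat.size x ≤ 4 * (x + 1) := by
            have := two_pow_size_le (x := x) (by omega)
            omega
          exact Nat.mul_le_mul_left _ (Nat.pow_le_pow_left h5 _)
      _ = _ := by rw [mul_pow, mul_pow, pow_add]; ring
  have h2 : ((x + 1 : ℕ) : ℝ) ≤ 2 * ((I.size : ℝ) + 1 / δ + 1) := by
    have := ceil_inv_le hδ
    have h0 : (0 : ℝ) ≤ I.size := Nat.cast_nonneg _
    have h0' : 0 < 1 / δ := by positivity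
    rw [hx]
    push_cast
    linarith
  calc (Program.time (countTm κ K) I δ : ℝ)
      ≤ ((c * (l + 1) ^ k * 4 ^ (t * e) * (x + 1) ^ (k + t * e) : ℕ) : ℝ) := by exact_mod_cast h1
    _ = ((c * (l + 1) ^ k * 4 ^ (t * e) : ℕ) : ℝ) * ((x + 1 : ℕ) : ℝ) ^ (k + t * e) := by
        push_cast; ring
    _ ≤ ((c * (l + 1) ^ k * 4 ^ (t * e) : ℕ) : ℝ) *
          (2 * ((I.size : ℝ) + 1 / δ + 1)) ^ (k + t * e) := by gcongr
    _ = _ := by rw [mul_pow]; push_cast; ring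

/-- Without a bound on the lists the number of colors enters with the depth as exponent. -/
theorem quasiPolyTime_countTm (κ : Cutoffs) (K : ℕ) (hα : 1 ≤ α) (hβ : 0 ≤ β) :
    ∃ C : ℝ, 0 ≤ C ∧ ∀ I : GraphList, I.Good α β → ∀ δ : ℝ, 0 < δ →
      (Program.time (countTm κ K) I δ : ℝ) ≤
        (2 : ℝ) ^ (C * Real.log ((I.size : ℝ) + 1 / δ + 2) ^ 2) := by
  obtain ⟨c, k, e, h⟩ := exists_time_bound (α := α) (β := β) κ K hα hβ
  refine ⟨(c + 2 * k + 9 * e) / Real.log 2 ^ 2, by positivity, fun I hI δ hδ => ?_⟩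
  set r := ⌈1 / δ⌉₊ with hr
  set x := I.size + r with hx
  set n := I.size with hn
  set X : ℝ := (n : ℝ) + 1 / δ + 2 with hX
  have hr0 : 0 < r := Nat.ceil_pos.2 (by positivity)
  have hδ' : 0 < 1 / δ := by positivity
  have hn0 : (0 : ℝ) ≤ n := Nat.cast_nonneg _
  have hX2 : 2 ≤ X := by rw [hX]; linarith
  have hX1 : 1 ≤ X := by linarith
  have hlog2 : 0 < Real.log 2 := Real.log_pos (by norm_num)
  set Λ : ℝ := Real.log X / Real.log 2 with hΛ
  have hΛ1 : 1 ≤ Λ := by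
    rw [hΛ, le_div_iff₀ hlog2, one_mul]
    exact Real.log_le_log (by norm_num) hX2
  have hXΛ : X = (2 : ℝ) ^ Λ := by
    rw [Real.rpow_def_of_pos (by norm_num), hΛ, mul_div_cancel₀ _ hlog2.ne',
      Real.exp_log (by linarith)]
  have hxX : ((x + 1 : ℕ) : ℝ) ≤ X := by
    have := ceil_inv_le hδ
    rw [hx, hX]
    push_cast
    linarith
  have hnX : ((n + 1 : ℕ) : ℝ) ≤ X := by
    rw [hX]; push_cast; linarith
  have hs : ((Nat.size x + 1 : ℕ) : ℝ) ≤ 3 * Λ := by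
    have h1 := two_pow_size_le (x := x) (by omega)
    have h2 : ((2 ^ Nat.size x : ℕ) : ℝ) ≤ X * X := by
      calc ((2 ^ Nat.size x : ℕ) : ℝ) ≤ ((2 * x : ℕ) : ℝ) := by exact_mod_cast h1
        _ = 2 * (x : ℝ) := by push_cast; ring
        _ ≤ X * X := by
            have : (x : ℝ) ≤ X := by push_cast at hxX; linarith
            have : (0 : ℝ) ≤ x := Nat.cast_nonneg _
            nlinarith
    have h3 := Real.log_le_log (by positivity) h2
    rw [Nat.cast_pow, Real.log_pow, Real.log_mul (by linarith) (by linarith)] at h3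
    have h4 : (Nat.size x : ℝ) ≤ 2 * Λ := by
      rw [hΛ, ← mul_div_assoc, le_div_iff₀ hlog2]
      push_cast at h3
      linarith
    push_cast
    linarith
  have hc : (c : ℝ) ≤ X ^ c := by
    calc (c : ℝ) ≤ (2 : ℝ) ^ c := by exact_mod_cast Nat.lt_two_pow_self.le
      _ ≤ X ^ c := by gcongr
  have h4X : ((4 * (n + 1) : ℕ) : ℝ) ≤ X ^ 3 := by
    have : (4 : ℝ) ≤ X ^ 2 := by nlinarith
    calc ((4 * (n + 1) : ℕ) : ℝ) = 4 * ((n + 1 : ℕ) : ℝ) := by push_cast; ring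
      _ ≤ X ^ 2 * X := by gcongr
      _ = X ^ 3 := by ring
  have hT : (Program.time (countTm κ K) I δ : ℝ) ≤
      X ^ (c + 2 * k + 3 * (e * (Nat.size x + 1))) := by
    calc (Program.time (countTm κ K) I δ : ℝ)
        ≤ ((c * ((x + 1) * (n + 1)) ^ k * (4 * (n + 1)) ^ (e * (Nat.size x + 1)) : ℕ) : ℝ) := by
          exact_mod_cast h I hI δ n (card_L_le_size I)
      _ = (c : ℝ) * (((x + 1 : ℕ) : ℝ) * ((n + 1 : ℕ) : ℝ)) ^ k *
            ((4 * (n + 1) : ℕ) : ℝ) ^ (e * (Nat.size x + 1)) := by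
          rw [Nat.cast_mul, Nat.cast_mul, Nat.cast_pow, Nat.cast_pow, Nat.cast_mul (x + 1)]
      _ ≤ X ^ c * (X * X) ^ k * (X ^ 3) ^ (e * (Nat.size x + 1)) := by gcongr
      _ = _ := by rw [← pow_two, ← pow_mul, ← pow_mul, ← pow_add, ← pow_add]
  refine hT.trans ?_
  rw [← Real.rpow_natCast, hXΛ, ← Real.rpow_mul (by norm_num), ← hXΛ]
  refine Real.rpow_le_rpow_of_exponent_le (by norm_num) ?_
  have e1 : (c + 2 * k + 9 * e : ℝ) / Real.log 2 ^ 2 * Real.log X ^ 2 =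
      (c + 2 * k + 9 * e) * Λ ^ 2 := by rw [hΛ, div_pow]; ring
  rw [e1]
  have e2 : ((c + 2 * k + 3 * (e * (Nat.size x + 1)) : ℕ) : ℝ) =
      c + 2 * k + 3 * (e * ((Nat.size x + 1 : ℕ) : ℝ)) := by push_cast; ring
  rw [e2]
  have e3 : (e : ℝ) * ((Nat.size x + 1 : ℕ) : ℝ) ≤ e * (3 * Λ) := by gcongr
  have e4 : (0 : ℝ) ≤ c + 2 * k := by positivity
  have e5 : (c + 2 * k : ℝ) ≤ (c + 2 * k) * Λ := le_mul_of_one_le_right e4 hΛ1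
  calc Λ * (c + 2 * k + 3 * (e * ((Nat.size x + 1 : ℕ) : ℝ)))
      ≤ Λ * ((c + 2 * k) * Λ + 3 * (e * (3 * Λ))) := by
        refine mul_le_mul_of_nonneg_left ?_ (by linarith)
        linarith
    _ = _ := by ring

/-- For fixed accuracy, `n + 1 / δ + 2` is at most a power of `n`. -/
theorem exists_log_le (hδ : 0 < δ) : ∃ j : ℝ, ∀ n : ℕ, 2 ≤ n →
    Real.log ((n : ℝ) + 1 / δ + 2) ^ 2 ≤ j * Real.log (n : ℝ) ^ 2 := by
  have hδ' : 0 < 1 / δ := by positivity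
  obtain ⟨t, ht⟩ := pow_unbounded_of_one_lt (1 / δ + 3) (one_lt_two (α := ℝ))
  refine ⟨(1 + t) ^ 2, fun n hn => ?_⟩
  have hn' : (2 : ℝ) ≤ n := by exact_mod_cast hn
  have h1 : (n : ℝ) + 1 / δ + 2 ≤ (n : ℝ) ^ (1 + t) := by
    calc (n : ℝ) + 1 / δ + 2 ≤ n * (1 / δ + 3) := by nlinarith
      _ ≤ n * n ^ t := by
          gcongr
          exact ht.le.trans (pow_le_pow_left₀ (by norm_num) hn' t)
      _ = _ := by rw [pow_add, pow_one]
  have h2 := Real.log_le_log (by linarith) h1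
  rw [Real.log_pow] at h2
  have h3 : 0 ≤ Real.log ((n : ℝ) + 1 / δ + 2) := Real.log_nonneg (by linarith)
  rw [← mul_pow]
  refine pow_le_pow_left₀ h3 (h2.trans_eq ?_) 2
  push_cast
  ring

end Program

/-- Cut-offs for given constants. -/
theorem exists_cutoffs {b ε : ℚ} (hb : 0 < b) (hε : 0 < ε) :
    ∃ κ : Cutoffs, κ.Fits (b : ℝ) (ε : ℝ) := by
  have key : ∀ x : ℚ, 0 < x → ((x.num.natAbs : ℝ) / (x.den : ℝ)) = (x : ℝ) := by
    intro x hx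
    have h : ((x.num.natAbs : ℤ) : ℝ) = (x.num : ℝ) := by
      rw [Int.natAbs_of_nonneg (Rat.num_nonneg.2 hx.le)]
    rw [Rat.cast_def, ← h, Int.cast_natCast]
  refine ⟨⟨(1 / (2 * (1 + ε))).num.natAbs, (1 / (2 * (1 + ε))).den, (1 / b).num.natAbs,
    (1 / b).den⟩, ?_, ?_⟩
  · rw [key _ (by positivity)]
    push_cast
    rfl
  · rw [key _ (by positivity)]
    push_cast
    rfl

theorem theorem1 (αc α β : ℝ) (hαc : αc * Real.exp (-(1 / αc)) = 2) (hα : αc < α)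
    (hβ : 0 < β) (hαβ : BetaCond α β) :
    -- the constants of the algorithm and the algorithm depend on `α` and `β` only
    ∃ (b ε₀ : ℚ) (K : ℕ) (P : Program),
      0 < b ∧ (b : ℝ) ≤ β ∧ BetaCond α b ∧
      0 < ε₀ ∧ 2 * (1 + (ε₀ : ℝ)) ≤ α * Real.exp (-(1 / α) * (1 + 1 / (b : ℝ))) ∧
      -- the program carries out CountCOLOR with logarithmic depth
      (∀ I : GraphList, I.Good α β → ∀ δ : ℝ, 0 < δ →
        CountColor (b : ℝ) (ε₀ : ℝ) I.G (K * Nat.size (I.size + ⌈1 / δ⌉₊))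
          Finset.univ I.L (P.output I δ : ℝ)) ∧
      -- with this depth every run of CountCOLOR is accurate, whatever its choices
      (∀ I : GraphList, I.Good α β → ∀ δ : ℝ, 0 < δ → ∀ z : ℝ,
        CountColor (b : ℝ) (ε₀ : ℝ) I.G (K * Nat.size (I.size + ⌈1 / δ⌉₊))
          Finset.univ I.L z →
        1 - δ ≤ z / (I.Z : ℝ) ∧ z / (I.Z : ℝ) ≤ 1 + δ) ∧
      -- a fully polynomial time approximation scheme when the lists have bounded size
      (∀ l : ℕ, P.IsFPTAS {I | I.Good α β ∧ ∀ v, (I.L v).card ≤ l}) ∧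
      -- no bound on the lists: approximation in quasi-polynomial time
      P.Approximates {I | I.Good α β} ∧
      (∃ c : ℝ, ∀ I : GraphList, I.Good α β → ∀ δ : ℝ, 0 < δ →
        (P.time I δ : ℝ) ≤ (2 : ℝ) ^ (c * Real.log ((I.size : ℝ) + 1 / δ + 2) ^ 2)) ∧
      (∀ δ : ℝ, 0 < δ → ∃ c : ℝ, ∀ I : GraphList, I.Good α β → 2 ≤ I.size →
        (P.time I δ : ℝ) ≤ (2 : ℝ) ^ (c * Real.log (I.size : ℝ) ^ 2)) := by
  have hα0 : 0 < α := by
    refine lt_trans ?_ hα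
    by_contra h
    have := mul_nonpos_of_nonpos_of_nonneg (not_lt.1 h) (Real.exp_pos (-(1 / αc))).le
    linarith
  obtain ⟨b, ε₀, hb, hbβ, hbc, hε, hc⟩ := exists_constants hα0 hβ hαβ
  obtain ⟨K, hK⟩ := hc.exists_depth_factor
  obtain ⟨κ, hκ⟩ := exists_cutoffs hb hε
  have hα1 : 1 ≤ α := by linarith [hc.two_lt]
  have hb0 : (0 : ℝ) < b := by exact_mod_cast hb
  have hrun : ∀ I : GraphList, I.Good α β → ∀ δ : ℝ, 0 < δ →
      CountColor (b : ℝ) (ε₀ : ℝ) I.G (K * Nat.size (I.size + ⌈1 / δ⌉₊))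
        Finset.univ I.L (Program.output (countTm κ K) I δ : ℝ) := by
    intro I hI δ _
    have h := (runs_program (κ := κ) (K := K) (δ := δ) hI hα1 hβ.le (card_L_le_size I)).1
    have h' := GraphList.countColor_countL hκ hα1 hb0 (hI.goodOn hbβ)
      (K * Nat.size (I.size + ⌈1 / δ⌉₊))
    rw [← h] at h'
    exact h'
  have hacc : ∀ I : GraphList, I.Good α β → ∀ δ : ℝ, 0 < δ → ∀ z : ℝ,
      CountColor (b : ℝ) (ε₀ : ℝ) I.G (K * Nat.size (I.size + ⌈1 / δ⌉₊)) Finset.univ I.L z →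
      1 - δ ≤ z / (I.Z : ℝ) ∧ z / (I.Z : ℝ) ≤ 1 + δ :=
    fun I hI δ hδ z hz => hz.accurate hc hbβ hK hI hδ
  obtain ⟨C, hC, hq⟩ := quasiPolyTime_countTm (α := α) (β := β) κ K hα1 hβ.le
  refine ⟨b, ε₀, K, countTm κ K, hb, hbβ, hbc, hε, hc.cutoff, hrun, hacc, fun l => ⟨?_, ?_⟩, ?_,
    ⟨C, hq⟩, fun δ hδ => ?_⟩
  · exact fun I hI δ hδ => hacc I hI.1 δ hδ _ (hrun I hI.1 δ hδ)
  · exact polyTime_countTm κ K hα1 hβ.le l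
  · exact fun I hI δ hδ => hacc I hI δ hδ _ (hrun I hI δ hδ)
  · obtain ⟨j, hj⟩ := exists_log_le hδ
    refine ⟨C * j, fun I hI hn => (hq I hI δ hδ).trans ?_⟩
    refine Real.rpow_le_rpow_of_exponent_le (by norm_num) ?_
    rw [mul_assoc]
    exact mul_le_mul_of_nonneg_left (hj _ hn) hC
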